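/- Let $H$ and $U$ be complex Hilbert spaces and let $A$, with domain $D(A)\subset H$, be the infinitesimal generator of a strongly continuous semigroup $(e^{tA})_{t\ge 0}$ on $H$. Assume: - $(\mathcal H_1)$ the spectrum $\sigma(A)$ consists of isolated eigenvalues $\lambda_j$ of finite algebraic multiplicity, i.e. for each $j$ the projection $\frac1{2\pi i}\oint_{|\lambda-\lambda_j|=\delta}(\lambda-A)^{-1}d\lambda$ ($\delta>0$ small) has finite-dimensional range; - $(\mathcal H_2)$ the root vectors of $A$ (the elements of $\bigcup_{j,n}\operatorname{Ker}(\lambda_j-A)^n$) span a dense subspace of $H$; - $(\mathcal H_3)$ the semigroup $(e^{tA})$ is analytic. Fix a real $\mu_0>\sup_j\operatorname{Re}\lambda_j$. For $\alpha\ge 0$ let $H_\alpha=D((\mu_0-A)^\alpha)$ and $H^*_\alpha=D((\mu_0-A^*)^\alpha)$, with norms $\|(\mu_0-A)^\alpha x\|_H$ and $\|(\mu_0-A^*)^\alpha x\|_H$; for $\alpha<0$ let $H_\alpha=(H^*_{-\alpha})'$ be the space of continuous antilinear functionals on $H^*_{-\alpha}$, where $H$ is the pivot space. Assume further: - $(\mathcal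 H_4)$ $D((\mu_0-A)^\alpha)=[H,D(A)]_\alpha$ (complex interpolation) for all $\alpha\in[0,1]$; - $(\mathcal H_5)$ $B\in\mathcal L(U,H_{-\gamma})$ for some $\gamma\in[0,1)$. The adjoint $B^*:H^*_\gamma\to U$ is defined by $(u\,|\,B^*\varepsilon)_U=\langle Bu,\varepsilon\rangle$. Let $\tau>0$. For a Hilbert space $E$ and $\mathcal B\in\mathcal L(E,H_{-\gamma})$, a solution of $y'=Ay+\mathcal Bu$ on $[0,\tau]$ with $u\in L^2(0,\tau;E)$ and $y(0)=y_0\in H_{1/2-\gamma}$ is a function $y\in C([0,\tau];H_{1/2-\gamma})$ with $$\langle y(t),\varepsilon\rangle=\langle y_0,\varepsilon\rangle+\int_0^t\big(\langle y(s),A^*\varepsilon\rangle+\langle \mathcal Bu(s),\varepsilon\rangle\big)\,ds$$ for all $t\in[0,\tau]$ and all $\varepsilon\in D(A^*)$ such that $\varepsilon,A^*\varepsilon\in H^*_\gamma$ (such a $y$ exists, is unique and belongs to $H^1(0,\tau;H_{-\gamma})\cap L^2(0,\tau;H_{1-\gamma})$). The system $y'=Ay+\mathcal Bu$ is *approximately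 controllable* if for all $y_0,y_1\in H_{1/2-\gamma}$ and all $r>0$ there is $u\in L^2(0,\tau;E)$ such that the solution with $y(0)=y_0$ satisfies $\|y(\tau)-y_1\|_{H_{1/2-\gamma}}<r$. It is *approximately controllable by $K$-dimensional control* if there is one subspace $E_K\subset E$ with $\dim E_K\le K$ such that, for all $y_0,y_1,r$, the control $u$ can be taken with values in $E_K$. A family $v=(v_l)\in\ell^2(\mathbb N,U)$ (respectively a finite family $v\in U^K$) is *admissible* if the system $y'=Ay+\sum_l w_l\,Bv_l$ with control $w\in L^2(0,\tau;\ell^2(\mathbb N))$ (respectively $w\in L^2(0,\tau;\mathbb C^K)$) is approximately controllable. Let $\ell_j=\dim\operatorname{Ker}(\lambda_j-A)$ be the geometric multiplicities. Consider the condition $$\text{(UC)}\qquad \forall\varepsilon\in D(A^*),\ \forall\lambda\in\mathbb C:\quad A^*\varepsilon=\lambda\varepsilon\ \text{ and }\ B^*\varepsilon=0\ \Longrightarrow\ \varepsilon=0 .$$ Let $\mathcal E$ be the closure in $H^*_\gamma$ of the linear span of all the eigenspaces $\operatorname{Ker}(\overline\lambda_j-A^*)$. A subset of a topological space is called residual if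 it is a countable intersection of open dense sets. Then, for every $\tau>0$ and every integer $K\ge 1$: 1. The system $y'=Ay+Bu$ is approximately controllable if and only if (UC) holds. 2. The system $y'=Ay+Bu$ is approximately controllable by $K$-dimensional control if and only if (UC) holds and $\sup_j\ell_j\le K$. 3. For every $j$ the space $\operatorname{Ker}(\overline\lambda_j-A^*)$ has dimension $\ell_j$. For any choice of bases $(\varepsilon_k(\overline\lambda_j))_{1\le k\le\ell_j}$ of these spaces, a family $v\in\ell^2(\mathbb N,U)$ is admissible if and only if $\operatorname{rank}W_j(v)=\ell_j$ for all $j$, where $W_j(v):\mathbb C^{\ell_j}\to\ell^2(\mathbb N)$, $W_j(v)x=\big(\sum_k x_k\,(v_l\,|\,B^*\varepsilon_k(\overline\lambda_j))_U\big)_l$; and a family $v\in U^K$ is admissible if and only if $\operatorname{rank}W_j(v)=\ell_j$ for all $j$, where $W_j(v)$ is the $K\times\ell_j$ matrix $\big((v_l\,|\,B^*\varepsilon_k(\overline\lambda_j))_U\big)_{l,k}$. 4. If (UC) holds, the set of admissible families of $\ell^2(\mathbb N,U)$ is residual in $\ell^2(\mathbb N,U)$; moreover, if $v\in\ell^2(\mathbb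 N,U)$ is admissible, then so is its orthogonal projection onto the closure of $\ell^2(\mathbb N,B^*\mathcal E)$. 5. If (UC) holds and $\sup_j\ell_j\le K$, the set of admissible families of $U^K$ is residual in $U^K$; moreover, if $v\in U^K$ is admissible, then so is its orthogonal projection onto the closure of $(B^*\mathcal E)^K$. -/

import Mathlib

open MeasureTheory Set Filter Topology
open scoped InnerProductSpace LinearPMap ComplexConjugate ENNReal NNReal

noncomputable section

namespace ParabolicControl

universe u v

variable {H : Type u} [NormedAddCommGroup H] [InnerProductSpace ℂ H]

/-! ### Semigroups and generators -/

/-- A strongly continuous semigroup `t ↦ e^{tA}`, `t ≥ 0`, of bounded operators on `H`. -/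
structure C0Semigroup (H : Type u) [NormedAddCommGroup H] [InnerProductSpace ℂ H] where
  /-- the operator `e^{tA}` -/
  op : ℝ≥0 → H →L[ℂ] H
  op_zero : op 0 = ContinuousLinearMap.id ℂ H
  op_add : ∀ s t, op (s + t) = (op s).comp (op t)
  tendsto_zero : ∀ x, Tendsto (fun t => op t x) (𝓝 0) (𝓝 x)

/-- `A` is the infinitesimal generator of `S`: `x ∈ D(A)` and `A x = y` if and only if
`(e^{tA} x - x) / t → y` as `t → 0+`. -/
def C0Semigroup.IsGenerator (S : C0Semigroup H) (A : H →ₗ.[ℂ] H) : Prop :=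
  ∀ x y : H, (x, y) ∈ A.graph ↔
    Tendsto (fun t : ℝ≥0 => ((t : ℝ) : ℂ)⁻¹ • (S.op t x - x)) (𝓝[>] 0) (𝓝 y)

/-- The open sector `{z ≠ 0, |arg z| < δ}`. -/
def sector (δ : ℝ) : Set ℂ := {z | z ≠ 0 ∧ |z.arg| < δ}

/-- The semigroup is analytic: it extends to a holomorphic semigroup on a sector around the
positive half-line which is strongly continuous at the origin of the sector. -/
def C0Semigroup.IsAnalytic (S : C0Semigroup H) : Prop :=
  ∃ δ : ℝ, 0 < δ ∧ δ ≤ Real.pi / 2 ∧ ∃ T : ℂ → H →L[ℂ] H,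
    (∀ t : ℝ≥0, 0 < t → T ((t : ℝ) : ℂ) = S.op t) ∧
    DifferentiableOn ℂ T (sector δ) ∧
    (∀ z ∈ sector δ, ∀ w ∈ sector δ, T (z + w) = (T z).comp (T w)) ∧
    (∀ x, Tendsto (fun z => T z x) (𝓝[sector δ] 0) (𝓝 x))

/-! ### Spectral notions for unbounded operators -/

/-- `R = (z - A)⁻¹` as an everywhere defined bounded operator: `R x = y` if and only if
`y ∈ D(A)` and `z y - A y = x`. -/
def IsResolventAt (A : H →ₗ.[ℂ] H) (z : ℂ) (R : H →L[ℂ] H) : Prop :=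
  ∀ x y : H, R x = y ↔ (y, z • y - x) ∈ A.graph

/-- The spectrum of the unbounded operator `A`. -/
def spec (A : H →ₗ.[ℂ] H) : Set ℂ := {z | ¬ ∃ R, IsResolventAt A z R}

open scoped Classical in
/-- The resolvent `(z - A)⁻¹` (and `0` for `z` in the spectrum). -/
def resolventOp (A : H →ₗ.[ℂ] H) (z : ℂ) : H →L[ℂ] H :=
  if h : ∃ R, IsResolventAt A z R then h.choose else 0

/-- The Riesz projection `(2πi)⁻¹ ∮_{|z - lam| = δ} (z - A)⁻¹ dz`. -/
def rieszProj (A : H →ₗ.[ℂ] H) (lam : ℂ) (δ : ℝ) : H →L[ℂ] H :=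
  (2 * Real.pi * Complex.I : ℂ)⁻¹ • ∮ z in C(lam, δ), resolventOp A z

/-- The eigenspace `Ker (lam - A)`. -/
def eigSpace (A : H →ₗ.[ℂ] H) (lam : ℂ) : Submodule ℂ H :=
  A.graph.comap (LinearMap.prod LinearMap.id (lam • LinearMap.id))

/-- The geometric multiplicity of `lam`. -/
def geomMult (A : H →ₗ.[ℂ] H) (lam : ℂ) : ℕ := Module.finrank ℂ (eigSpace A lam)

/-- The set `Ker (lam - A)ⁿ`. -/
def kerPow (A : H →ₗ.[ℂ] H) (lam : ℂ) : ℕ → Set H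
  | 0 => {0}
  | n + 1 => {x | ∃ y ∈ kerPow A lam n, (x, lam • x - y) ∈ A.graph}

/-- The spectrum of `A` consists of isolated eigenvalues of finite algebraic multiplicity (the
dimension of the range of the Riesz projection). -/
def HasIsolatedEigenvalues (A : H →ₗ.[ℂ] H) : Prop :=
  ∀ lam ∈ spec A, eigSpace A lam ≠ ⊥ ∧
    ∃ δ : ℝ, 0 < δ ∧ spec A ∩ Metric.closedBall lam δ = {lam} ∧
      FiniteDimensional ℂ (rieszProj A lam δ).range

/-- The linear span of the root vectors of `A` is dense in `H`. -/
def RootVectorsComplete (A : H →ₗ.[ℂ] H) : Prop :=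
  Dense (Submodule.span ℂ (⋃ lam ∈ spec A, ⋃ n : ℕ, kerPow A lam n) : Set H)

/-! ### Fractional powers and complex interpolation -/

/-- If `T t = e^{tG}`, this is
`(μ - G)^{-α} = Γ(α)⁻¹ ∫₀^∞ t^{α-1} e^{-μt} e^{tG} dt` for `α > 0`, and `1` for `α = 0`. -/
def fracPowNeg (T : ℝ≥0 → H →L[ℂ] H) (μ α : ℝ) : H →L[ℂ] H :=
  if α = 0 then ContinuousLinearMap.id ℂ H
  else ((Real.Gamma α)⁻¹ : ℂ) •
    ∫ t in Ioi (0 : ℝ), ((t ^ (α - 1) * Real.exp (-μ * t) : ℝ) : ℂ) • T t.toNNReal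

/-- `(μ - A)^{-α}`, where `S.op t = e^{tA}`. -/
def C0Semigroup.powNeg (S : C0Semigroup H) (μ α : ℝ) : H →L[ℂ] H := fracPowNeg S.op μ α

variable [CompleteSpace H]

/-- `(μ - A*)^{-α}`; the semigroup generated by `A*` is `(e^{tA})*`. -/
def C0Semigroup.powNegAdj (S : C0Semigroup H) (μ α : ℝ) : H →L[ℂ] H :=
  fracPowNeg (fun t => ContinuousLinearMap.adjoint (S.op t)) μ α

/-- The complex interpolation space `[H, D(A)]_θ`: the values at `θ` of the `H`-valued bounded
functions on the strip `0 ≤ Re z ≤ 1`, continuous there and holomorphic inside, whose restriction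
to `Re z = 1` is bounded and continuous with values in `D(A)` (with its graph norm). -/
def complexInterp (A : H →ₗ.[ℂ] H) (θ : ℝ) : Set H :=
  {x | ∃ (f : ℂ → H) (g : ℝ → H) (C : ℝ),
    DiffContOnCl ℂ f (Complex.re ⁻¹' Ioo 0 1) ∧
    (∀ z : ℂ, z.re ∈ Icc (0 : ℝ) 1 → ‖f z‖ ≤ C) ∧
    (∀ s : ℝ, (f (1 + s * Complex.I), g s) ∈ A.graph) ∧
    Continuous g ∧ (∀ s, ‖g s‖ ≤ C) ∧
    f θ = x}

/-- `D((μ - A)^α) = [H, D(A)]_α` for all `α ∈ [0, 1]`. -/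
def InterpolationProperty (S : C0Semigroup H) (A : H →ₗ.[ℂ] H) (μ : ℝ) : Prop :=
  ∀ α ∈ Icc (0 : ℝ) 1, ((S.powNeg μ α).range : Set H) = complexInterp A α

/-! ### The scale of spaces -/

/-- The range of a bounded operator `P`, with the norm `‖P z‖ = ‖z‖` when `P` is injective (in
general, the norm transported from `H / Ker P`). For `P = (μ - A)^{-α}`, this is the
space `D((μ - A)^α)` with the norm `‖(μ - A)^α x‖`. -/
def FracDom (P : H →L[ℂ] H) : Type u := P.range

namespace FracDom

variable (P : H →L[ℂ] H)

instance : AddCommGroup (FracDom P) := inferInstanceAs (AddCommGroup P.range)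

instance : Module ℂ (FracDom P) := inferInstanceAs (Module ℂ P.range)

/-- The inclusion of `FracDom P` into `H`. -/
def incl : FracDom P →ₗ[ℂ] H := P.range.subtype

/-- The algebraic isomorphism with `H / Ker P`. -/
def toQuot : FracDom P ≃ₗ[ℂ] (H ⧸ P.ker) := P.toLinearMap.quotKerEquivRange.symm

instance isClosedKer : IsClosed ((P.ker : Submodule ℂ H) : Set H) := P.isClosed_ker

instance : NormedAddCommGroup (FracDom P) :=
  NormedAddCommGroup.induced (FracDom P) (H ⧸ P.ker) (toQuot P).toLinearMap (toQuot P).injective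

instance : NormedSpace ℂ (FracDom P) :=
  NormedSpace.induced ℂ (FracDom P) (H ⧸ P.ker) (toQuot P).toLinearMap

/-- The element `P z` of `FracDom P`. -/
def mk (z : H) : FracDom P := ⟨P z, z, rfl⟩

theorem incl_mk (z : H) : incl P (mk P z) = P z := rfl

theorem norm_mk (hP : Function.Injective P) (z : H) : ‖mk P z‖ = ‖z‖ := by
  have h1 : toQuot P (mk P z) = Submodule.Quotient.mk z := by
    exact (P.toLinearMap.quotKerEquivRange.symm_apply_eq).mpr rfl
  have h2 : ‖mk P z‖ = ‖toQuot P (mk P z)‖ := rfl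
  rw [h2, h1]
  apply le_antisymm (Submodule.Quotient.norm_mk_le _ z)
  refine le_of_forall_pos_le_add fun ε hε => ?_
  obtain ⟨m, hm, hlt⟩ :=
    Submodule.Quotient.norm_mk_lt (Submodule.Quotient.mk z : H ⧸ P.ker) hε
  have h4 : m - z ∈ P.ker := (Submodule.Quotient.eq _).mp hm
  have h5 : m = z := hP (by simpa [sub_eq_zero] using h4)
  rw [h5] at hlt
  exact hlt.le

end FracDom

namespace C0Semigroup

/-- `H_α = D((μ - A)^α)` for `α ≥ 0`. -/
abbrev HPos (S : C0Semigroup H) (μ α : ℝ) : Type u := FracDom (S.powNeg μ α)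

/-- `H*_α = D((μ - A*)^α)` for `α ≥ 0`. -/
abbrev HStar (S : C0Semigroup H) (μ α : ℝ) : Type u := FracDom (S.powNegAdj μ α)

/-- `H_{-s} = D((μ - A*)^s)'` for `s ≥ 0`: the continuous antilinear functionals on `H*_s`. An
element `x` of the pivot space `H` is identified with the functional `ε ↦ (x | ε)_H`. -/
abbrev HNeg (S : C0Semigroup H) (μ s : ℝ) : Type u := S.HStar μ s →L⋆[ℂ] ℂ

/-- For `α ≥ -γ`, the norm of `H_α` on the elements of `H_{-γ}`, with value `∞` exactly outside of
`H_α`. For `α ≥ 0`, a functional on `H*_γ` belongs to `H_α` if it is `ε ↦ (x | ε)_H` with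
`x ∈ D((μ - A)^α)`; for `α < 0`, if it is the restriction to `H*_γ` of a continuous antilinear
functional on `H*_{-α} ⊇ H*_γ`. -/
def scaleNorm (S : C0Semigroup H) (μ γ α : ℝ) (φ : S.HNeg μ γ) : ℝ≥0∞ :=
  if 0 ≤ α then
    ⨅ (x : S.HPos μ α) (_ : ∀ ε : S.HStar μ γ,
      φ ε = ⟪FracDom.incl _ ε, FracDom.incl _ x⟫_ℂ), ‖x‖ₑ
  else
    ⨅ (ψ : S.HNeg μ (-α)) (_ : ∀ (ε : S.HStar μ γ) (η : S.HStar μ (-α)),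
      FracDom.incl _ ε = FracDom.incl _ η → φ ε = ψ η), ‖ψ‖ₑ

end C0Semigroup

/-! ### The controlled system `y' = A y + B u` -/

section System

variable (S : C0Semigroup H) (A : H →ₗ.[ℂ] H) (μ γ τ : ℝ)

/-- `y` is the solution of `y' = A y + B u` on `[0, τ]`, `y(0) = y₀`, in `C([0, τ]; H_{1/2-γ})`.
The equation is integrated in time and tested against the `ε ∈ D(A*)` with
`ε, A* ε ∈ H*_γ`; weak solutions of this kind are unique, so that a solution with the additional
regularity `H¹(0, τ; H_{-γ}) ∩ L²(0, τ; H_{1-γ})` is the same thing. -/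
structure IsSolution {E : Type v} [NormedAddCommGroup E] [NormedSpace ℂ E]
    (B : E →L[ℂ] S.HNeg μ γ) (u : ℝ → E) (y₀ : S.HNeg μ γ) (y : ℝ → S.HNeg μ γ) : Prop where
  mem : ∀ t ∈ Icc 0 τ, S.scaleNorm μ γ (1 / 2 - γ) (y t) < ∞
  cont : ∀ t₀ ∈ Icc 0 τ,
    Tendsto (fun t => S.scaleNorm μ γ (1 / 2 - γ) (y t - y t₀)) (𝓝[Icc 0 τ] t₀) (𝓝 0)
  init : y 0 = y₀
  eqn : ∀ ε η : S.HStar μ γ, (FracDom.incl _ ε, FracDom.incl _ η) ∈ A†.graph →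
    ∀ t ∈ Icc 0 τ, y t ε = y₀ ε + ∫ s in (0 : ℝ)..t, (y s η + B (u s) ε)

/-- Approximate controllability in time `τ` of `y' = A y + B u` with controls in
`L²(0, τ; W)`, for a subspace `W` of the control space. -/
def ApproxControllableIn {E : Type v} [NormedAddCommGroup E] [NormedSpace ℂ E]
    (B : E →L[ℂ] S.HNeg μ γ) (W : Submodule ℂ E) : Prop :=
  ∀ y₀ y₁ : S.HNeg μ γ, S.scaleNorm μ γ (1 / 2 - γ) y₀ < ∞ →
    S.scaleNorm μ γ (1 / 2 - γ) y₁ < ∞ → ∀ r : ℝ, 0 < r →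
    ∃ u : ℝ → E, MemLp u 2 (volume.restrict (Ioo 0 τ)) ∧
      (∀ᵐ t ∂(volume.restrict (Ioo 0 τ)), u t ∈ W) ∧
      ∃ y : ℝ → S.HNeg μ γ, IsSolution S A μ γ τ B u y₀ y ∧
        S.scaleNorm μ γ (1 / 2 - γ) (y τ - y₁) < ENNReal.ofReal r

/-- Approximate controllability in time `τ` of `y' = A y + B u`. -/
def ApproxControllable {E : Type v} [NormedAddCommGroup E] [NormedSpace ℂ E]
    (B : E →L[ℂ] S.HNeg μ γ) : Prop :=
  ApproxControllableIn S A μ γ τ B ⊤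

/-- Approximate controllability in time `τ` by `K`-dimensional control: one subspace of the control
space, of dimension at most `K`, suffices for all initial and target states. -/
def ApproxControllableByDim {E : Type v} [NormedAddCommGroup E] [NormedSpace ℂ E]
    (B : E →L[ℂ] S.HNeg μ γ) (K : ℕ) : Prop :=
  ∃ W : Submodule ℂ E, FiniteDimensional ℂ W ∧ Module.finrank ℂ W ≤ K ∧
    ApproxControllableIn S A μ γ τ B W

end System

/-! ### The adjoint of the control operator and the Fattorini–Hautus condition -/

section Adjoint

variable {U : Type v} [NormedAddCommGroup U] [InnerProductSpace ℂ U] [CompleteSpace U]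
variable {S : C0Semigroup H} {μ γ : ℝ}

/-- The functional `u ↦ ⟨B u, ε⟩` on `U`. -/
def evalAt (B : U →L[ℂ] S.HNeg μ γ) (ε : S.HStar μ γ) : StrongDual ℂ U :=
  (ContinuousLinearMap.apply' ℂ (starRingEnd ℂ) ε).comp B

/-- The adjoint `B* : H*_γ → U`, characterized by `(u | B* ε)_U = ⟨B u, ε⟩`. -/
def adjB (B : U →L[ℂ] S.HNeg μ γ) : S.HStar μ γ →ₗ[ℂ] U where
  toFun ε := (InnerProductSpace.toDual ℂ U).symm (evalAt B ε)
  map_add' ε η := by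
    refine ext_inner_right ℂ fun w => ?_
    simp [evalAt, inner_add_left]
  map_smul' c ε := by
    refine ext_inner_right ℂ fun w => ?_
    simp [evalAt, inner_smul_left]

theorem inner_adjB (B : U →L[ℂ] S.HNeg μ γ) (ε : S.HStar μ γ) (w : U) :
    ⟪adjB B ε, w⟫_ℂ = B w ε := by
  simp [adjB, evalAt]

open scoped Classical in
/-- `B* ε` for `ε ∈ H`, understood to be `0` if `ε ∉ H*_γ`. -/
def adjBOn (B : U →L[ℂ] S.HNeg μ γ) (x : H) : U :=
  if h : ∃ ε : S.HStar μ γ, FracDom.incl _ ε = x then adjB B h.choose else 0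

/-- The Fattorini–Hautus condition (UC): the only `ε ∈ D(A*)` with `A* ε = lam ε` for some `lam`
and `B* ε = 0` is `ε = 0`. -/
def FattoriniHautus (A : H →ₗ.[ℂ] H) (B : U →L[ℂ] S.HNeg μ γ) : Prop :=
  ∀ (ε : S.HStar μ γ) (lam : ℂ),
    (FracDom.incl _ ε, lam • FracDom.incl _ ε) ∈ A†.graph → adjB B ε = 0 → ε = 0

/-- `𝓔`: the closure in `H*_γ` of the span of the eigenspaces `Ker (conj lam - A*)`,
`lam ∈ σ(A)`. -/
def adjEigClosure (S : C0Semigroup H) (A : H →ₗ.[ℂ] H) (μ γ : ℝ) :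
    Submodule ℂ (S.HStar μ γ) :=
  (Submodule.span ℂ {ε : S.HStar μ γ |
    ∃ lam ∈ spec A, FracDom.incl _ ε ∈ eigSpace A† (conj lam)}).topologicalClosure

/-- The subspace `B* 𝓔` of `U`. -/
def adjBE (A : H →ₗ.[ℂ] H) (B : U →L[ℂ] S.HNeg μ γ) : Submodule ℂ U :=
  (adjEigClosure S A μ γ).map (adjB B)

end Adjoint

/-! ### Families of control vectors -/

section Families

variable {U : Type v} [NormedAddCommGroup U] [InnerProductSpace ℂ U] [CompleteSpace U]

/-- The space `ℓ²(ℕ, U)`. -/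
abbrev EllTwo (U : Type v) [NormedAddCommGroup U] : Type v := lp (fun _ : ℕ => U) 2

/-- The space `U^K` with its Hilbert norm. -/
abbrev UPow (U : Type v) (K : ℕ) : Type v := PiLp 2 (fun _ : Fin K => U)

theorem summable_norm_mul (w : EllTwo ℂ) (v : EllTwo U) :
    (Summable fun l => ‖w l‖ * ‖v l‖) ∧ ∑' l, ‖w l‖ * ‖v l‖ ≤ ‖w‖ * ‖v‖ := by
  have h2 : (0 : ℝ) < (2 : ℝ≥0∞).toReal := by norm_num
  have hpq : (2 : ℝ≥0∞).toReal.HolderConjugate (2 : ℝ≥0∞).toReal := by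
    rw [Real.holderConjugate_iff]
    norm_num
  have hw := lp.hasSum_norm h2 w
  have hv := lp.hasSum_norm h2 v
  obtain ⟨C, -, hC, hs⟩ := Real.inner_le_Lp_mul_Lq_hasSum_of_nonneg hpq (norm_nonneg w)
    (norm_nonneg v) (fun l => norm_nonneg _) (fun l => norm_nonneg _) hw hv
  exact ⟨hs.summable, hs.tsum_eq.le.trans hC⟩

theorem summable_smul (w : EllTwo ℂ) (v : EllTwo U) : Summable fun l => w l • v l :=
  Summable.of_norm (by simpa only [norm_smul] using (summable_norm_mul w v).1)

/-- The operator `w ↦ ∑ₗ wₗ vₗ` from `ℓ²(ℕ)` to `U`, for `v ∈ ℓ²(ℕ, U)`. -/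
def combine (v : EllTwo U) : EllTwo ℂ →L[ℂ] U :=
  LinearMap.mkContinuous
    { toFun := fun w => ∑' l, w l • v l
      map_add' := fun w w' => by
        rw [← (summable_smul w v).tsum_add (summable_smul w' v)]
        simp [add_smul]
      map_smul' := fun c w => by
        rw [RingHom.id_apply, ← (summable_smul w v).tsum_const_smul c]
        simp [mul_smul] }
    ‖v‖ (fun w => by
      refine (norm_tsum_le_tsum_norm ?_).trans ?_
      · simpa only [norm_smul] using (summable_norm_mul w v).1
      · rw [mul_comm]
        simpa only [norm_smul] using (summable_norm_mul w v).2)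

/-- The operator `w ↦ ∑ₗ wₗ vₗ` from `ℂ^K` to `U`, for `v ∈ U^K`. -/
def combineFin {K : ℕ} (v : UPow U K) : EuclideanSpace ℂ (Fin K) →L[ℂ] U :=
  ∑ l, (EuclideanSpace.proj l : EuclideanSpace ℂ (Fin K) →L[ℂ] ℂ).smulRight (v l)

/-- The sequence `((vₗ | w)_U)ₗ ∈ ℓ²(ℕ)`. -/
def coeffSeq (v : EllTwo U) (w : U) : EllTwo ℂ :=
  ⟨fun l => ⟪w, v l⟫_ℂ, by
    have h : Memℓp (fun l => ‖w‖ * ‖v l‖) 2 := (lp.memℓp v).norm.const_mul ‖w‖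
    exact h.mono fun l => norm_inner_le_norm w (v l)⟩

variable (S : C0Semigroup H) (A : H →ₗ.[ℂ] H) (μ γ τ : ℝ)

/-- `v ∈ ℓ²(ℕ, U)` is admissible: the system `y' = A y + V(v) w` with
`V(v) w = ∑ₗ wₗ B vₗ` and control `w ∈ L²(0, τ; ℓ²(ℕ))` is approximately controllable. -/
def Admissible (B : U →L[ℂ] S.HNeg μ γ) (v : EllTwo U) : Prop :=
  ApproxControllable S A μ γ τ (B.comp (combine v))

/-- `v ∈ U^K` is admissible: the system `y' = A y + ∑ₗ wₗ B vₗ` with control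
`w ∈ L²(0, τ; ℂ^K)` is approximately controllable. -/
def AdmissibleFin (B : U →L[ℂ] S.HNeg μ γ) {K : ℕ} (v : UPow U K) : Prop :=
  ApproxControllable S A μ γ τ (B.comp (combineFin v))

variable {S μ γ}

/-- `W(v) : ℂⁿ → ℓ²(ℕ)`, `x ↦ (∑ₖ xₖ (vₗ | B* εₖ)_U)ₗ`. -/
def mapW (B : U →L[ℂ] S.HNeg μ γ) {n : ℕ} (ε : Fin n → H) (v : EllTwo U) :
    (Fin n → ℂ) →ₗ[ℂ] EllTwo ℂ :=
  Fintype.linearCombination ℂ (fun k => coeffSeq v (adjBOn B (ε k)))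

/-- The `K × n` matrix `W(v) = ((vₗ | B* εₖ)_U)`. -/
def matW (B : U →L[ℂ] S.HNeg μ γ) {n K : ℕ} (ε : Fin n → H) (v : UPow U K) :
    Matrix (Fin K) (Fin n) ℂ :=
  Matrix.of fun l k => ⟪adjBOn B (ε k), v l⟫_ℂ

/-- The subspace `ℓ²(ℕ, M)` of `ℓ²(ℕ, U)`. -/
def ellTwoSub (M : Submodule ℂ U) : Submodule ℂ (EllTwo U) where
  carrier := {v | ∀ l, v l ∈ M}
  zero_mem' _ := M.zero_mem
  add_mem' hv hw l := M.add_mem (hv l) (hw l)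
  smul_mem' c _ hv l := M.smul_mem c (hv l)

/-- The subspace `M^K` of `U^K`. -/
def powSub (M : Submodule ℂ U) (K : ℕ) : Submodule ℂ (UPow U K) where
  carrier := {v | ∀ l, v l ∈ M}
  zero_mem' _ := M.zero_mem
  add_mem' hv hw l := M.add_mem (hv l) (hw l)
  smul_mem' c _ hv l := M.smul_mem c (hv l)

/-- The orthogonal projection of `ℓ²(ℕ, U)` onto the closure of `ℓ²(ℕ, B* 𝓔)`. -/
def projBE (A : H →ₗ.[ℂ] H) (B : U →L[ℂ] S.HNeg μ γ) (v : EllTwo U) : EllTwo U :=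
  (ellTwoSub (adjBE A B)).topologicalClosure.starProjection v

/-- The orthogonal projection of `U^K` onto the closure of `(B* 𝓔)^K`. -/
def projBEFin (A : H →ₗ.[ℂ] H) (B : U →L[ℂ] S.HNeg μ γ) {K : ℕ} (v : UPow U K) : UPow U K :=
  (powSub (adjBE A B) K).topologicalClosure.starProjection v

end Families

/-- A residual set: a countable intersection of open dense sets. -/
def IsResidualSet {X : Type v} [TopologicalSpace X] (s : Set X) : Prop :=
  ∃ O : ℕ → Set X, (∀ n, IsOpen (O n) ∧ Dense (O n)) ∧ s = ⋂ n, O n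

end ParabolicControl

end

open ParabolicControl

noncomputable section

namespace ParabolicControl

universe u v

set_option linter.unusedSectionVars false

/-! Approximate controllability with controls in a subspace `W` is a property of the eigenvectors of
`A†` alone (`IsGenerator.approxControllableIn_iff`): no nonzero eigenvector may be annihilated by
all `B e` with `e ∈ W`. The five statements then reduce to linear algebra on each eigenspace and
Baire category. An annihilated eigenvector yields a scalar function of the state solving `g' = conj
lam * g`, `g 0 = 0`, so the state started at 0 never leaves a hyperplane. For the converse, the
power 1/2 of `μ - A` makes the state space `H_{1/2-γ}` isometric to `H`, and it suffices that the
states reached by step controls be dense. If `z` is orthogonal to them, a transformed vector `z'`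
satisfies `⟪z', e^{tA} x⟫ = ⟪z', x⟫ e^{μt}` on `[0, τ]`, where `x` represents `B e`. Analyticity in
time extends this to all `t > 0`, and the growth bound, below `μ`, forces both sides to vanish.
Unique continuation (`IsGenerator.unobservable_eq_bot`) finishes: by Laplace transform `⟪z', (w -
A)⁻¹ x⟫` vanishes for large real `w`, hence on the whole resolvent set, which is connected since the
spectrum is countable. Integration around an eigenvalue shows that the adjoint Riesz projection
preserves the space of such `z'`. Its image of that space is finite-dimensional and invariant under
the adjoint resolvent, so if nonzero it would contain a forbidden eigenvector. Thus `z'` is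
orthogonal to all root vectors, which are complete. Two facts support this. The number `μ₀` only
dominates the spectrum, while the integrals defining `(μ₀ - A)^{-α}` need a growth bound; Gelfand
theory supplies it (`IsGenerator.exists_growth_bound`). Eigenspaces of `A` and `A†` have equal
dimensions because `lam - A` is invertible modulo a commuting finite rank operator
(`finrank_ker_adjoint_eq`). For a family `v` the criterion says that scalar products with `v`
separate each eigenspace, which is the rank condition. For one eigenvalue this is open and dense in
`v` (`isOpen_separates`, `dense_separates`), and there are countably many eigenvalues. The span of
an admissible family in `U^K` is a suitable `K`-dimensional control space. -/

/-! ### Growth of differentiable semigroups in a Banach algebra -/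

section Growth

variable {𝔸 : Type*} [NormedRing 𝔸] [NormedAlgebra ℂ 𝔸] [CompleteSpace 𝔸]

/-- A nonzero multiplicative function on `(0, ∞)`, differentiable there, is an exponential. -/
theorem eq_exp_of_mul_of_hasDerivAt {f f' : ℝ → ℂ} (hf : ∀ t, 0 < t → HasDerivAt f (f' t) t)
    (hmul : ∀ s t, 0 < s → 0 < t → f (s + t) = f s * f t) (h1 : f 1 ≠ 0) :
    f 1 = Complex.exp (f' 1 / f 1) := by
  set a := f' 1 / f 1 with ha
  have hd : ∀ t, 0 < t → f' t = a * f t := by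
    intro t ht
    have e1 : HasDerivAt (fun h => f (t + h) * f 1) (f' (t + 1) * f 1) 1 := by
      simpa using ((hf (t + 1) (by linarith)).comp_const_add t 1).mul_const (f 1)
    have e2 : HasDerivAt (fun h => f t * f (1 + h)) (f t * f' (1 + 1)) 1 := by
      simpa using ((hf (1 + 1) (by norm_num)).comp_const_add 1 1).const_mul (f t)
    have e3 : HasDerivAt (fun h => f (t + h)) (f t * f' 1) 1 := by
      refine ((hf 1 one_pos).const_mul (f t)).congr_of_eventuallyEq ?_
      filter_upwards [lt_mem_nhds (one_pos : (0 : ℝ) < 1)] with h hh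
      exact hmul t h ht hh
    have e4 : HasDerivAt (fun h => f (1 + h)) (f 1 * f' t) t := by
      refine ((hf t ht).const_mul (f 1)).congr_of_eventuallyEq ?_
      filter_upwards [lt_mem_nhds ht] with h hh
      exact hmul 1 h one_pos hh
    have e5 : HasDerivAt (fun h => f (t + h)) (f' (t + 1)) 1 :=
      (hf (t + 1) (by linarith)).comp_const_add t 1
    have e6 : HasDerivAt (fun h => f (1 + h)) (f' (1 + t)) t :=
      (hf (1 + t) (by linarith)).comp_const_add 1 t
    have e7 := e3.unique e5
    have e8 := e4.unique e6
    rw [add_comm t 1] at e7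
    rw [ha, div_mul_eq_mul_div, eq_div_iff h1, mul_comm, e8, ← e7]
    ring
  set k : ℝ → ℂ := fun t => f t * Complex.exp (-(a * t)) with hk
  have hkd : ∀ t, 0 < t → HasDerivAt k 0 t := by
    intro t ht
    have h : HasDerivAt k _ t := (hf t ht).mul (((Complex.ofRealCLM.hasDerivAt (x := t)).const_mul a).neg.cexp)
    refine h.congr_deriv ?_
    simp only [hd t ht, Complex.ofRealCLM_apply, Complex.ofReal_one, Pi.neg_apply]
    ring
  -- Nothing is known of `f` at 0, so the constant value of `k` is found from `k 2 = k 1 ^ 2`, which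
  -- with `k 1 ≠ 0` gives `k 1 = 1`.
  have hconst : k 1 = k 2 := by
    refine (convex_Ioi (0 : ℝ)).is_const_of_fderivWithin_eq_zero (𝕜 := ℝ) (f := k) ?_ ?_
      (by simp : (1 : ℝ) ∈ Ioi 0) (by simp : (2 : ℝ) ∈ Ioi 0)
    · exact fun t ht => (hkd t ht).differentiableAt.differentiableWithinAt
    · intro t ht
      rw [fderivWithin_of_isOpen isOpen_Ioi ht]
      ext
      simp [(hkd t ht).deriv]
  have h2 : f 2 = f 1 * f 1 := by rw [← hmul 1 1 one_pos one_pos]; norm_num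
  simp only [hk, h2] at hconst
  have h3 : Complex.exp (-(a * ((1 : ℝ) : ℂ))) =
      f 1 * (Complex.exp (-(a * ((1 : ℝ) : ℂ))) * Complex.exp (-(a * ((1 : ℝ) : ℂ)))) := by
    have : Complex.exp (-(a * ((2 : ℝ) : ℂ))) =
        Complex.exp (-(a * ((1 : ℝ) : ℂ))) * Complex.exp (-(a * ((1 : ℝ) : ℂ))) := by
      rw [← Complex.exp_add]; congr 1; push_cast; ring
    rw [this] at hconst
    apply mul_left_cancel₀ h1
    rw [hconst]; ring
  have h4 : f 1 * Complex.exp (-(a * ((1 : ℝ) : ℂ))) = 1 := by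
    apply mul_right_cancel₀ (Complex.exp_ne_zero (-(a * ((1 : ℝ) : ℂ))))
    rw [one_mul, mul_assoc]; exact h3.symm
  rw [Complex.ofReal_one, mul_one, Complex.exp_neg] at h4
  rwa [mul_inv_eq_one₀ (Complex.exp_ne_zero _)] at h4

/-- If a differentiable semigroup `F` in a Banach algebra has a generator without spectrum in
the half-plane `Re w > s`, then the spectral radius of `F 1` is at most `exp s`. -/
theorem eventually_norm_pow_le_of_resolvent {F F' : ℝ → 𝔸} {s ω : ℝ} (hsω : s < ω)
    (hF : ∀ t, 0 < t → HasDerivAt F (F' t) t)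
    (hmul : ∀ r t, 0 < r → 0 < t → F (r + t) = F r * F t)
    (R : ℂ → 𝔸) (hRF : ∀ w t, Commute (R w) (F t)) (hRR : ∀ w z, Commute (R w) (R z))
    (hFF : ∀ r t, Commute (F r) (F t))
    (hR : ∀ w : ℂ, s < w.re → R w * F' 1 = w • (R w * F 1) - F 1) :
    ∀ᶠ n : ℕ in atTop, ‖F 1 ^ n‖ ≤ Real.exp (ω * n) := by
  set C : Set 𝔸 := range F ∪ range R with hC
  have hcomm : ∀ x ∈ C, ∀ y ∈ C, x * y = y * x := by
    rintro _ (⟨a, rfl⟩ | ⟨a, rfl⟩) _ (⟨b, rfl⟩ | ⟨b, rfl⟩)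
    · exact hFF a b
    · exact (hRF b a).symm
    · exact hRF a b
    · exact hRR a b
  -- The double centralizer of a commuting set is a closed commutative subalgebra containing it, so
  -- that Gelfand theory applies in it.
  let 𝒜 : Subalgebra ℂ 𝔸 := Subalgebra.centralizer ℂ (Subalgebra.centralizer ℂ C)
  have hcl : IsClosed (𝒜 : Set 𝔸) := Set.isClosed_centralizer _
  have hsub : C ⊆ 𝒜 := Set.subset_centralizer_centralizer
  have hc𝒜 : ∀ x y : 𝒜, x * y = y * x := fun x y => Subtype.ext <|
    Set.centralizer_centralizer_comm_of_comm hcomm _ x.2 _ y.2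
  let _ : NormedCommRing 𝒜 := { (inferInstance : NormedRing 𝒜) with mul_comm := hc𝒜 }
  have : CompleteSpace 𝒜 := hcl.completeSpace_coe
  let FA : ℝ → 𝒜 := fun t => ⟨F t, hsub (Or.inl ⟨t, rfl⟩)⟩
  let RA : ℂ → 𝒜 := fun w => ⟨R w, hsub (Or.inr ⟨w, rfl⟩)⟩
  have hχ : ∀ χ : WeakDual.characterSpace ℂ 𝒜, ‖χ (FA 1)‖ ≤ Real.exp s := by
    intro χ
    by_cases h0 : χ (FA 1) = 0
    · rw [h0, norm_zero]; exact (Real.exp_pos s).le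
    -- The Hahn–Banach extension of `χ` can be evaluated at `F' t` without showing that the
    -- derivative lies in `𝒜`.
    obtain ⟨g, hg, -⟩ := exists_extension_norm_eq (𝕜 := ℂ) (Subalgebra.toSubmodule 𝒜)
      (WeakDual.toStrongDual (χ : WeakDual ℂ 𝒜))
    have hg' : ∀ x : 𝒜, g x = χ x := fun x => hg x
    have hder : ∀ t, 0 < t → HasDerivAt (fun t => χ (FA t)) (g (F' t)) t := by
      intro t ht
      have h := (g.hasFDerivAt.restrictScalars ℝ).comp_hasDerivAt t (hF t ht)
      refine h.congr_of_eventuallyEq (Eventually.of_forall fun r => ?_)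
      exact (hg' (FA r)).symm
    have hm : ∀ r t, 0 < r → 0 < t → χ (FA (r + t)) = χ (FA r) * χ (FA t) := by
      intro r t hr ht
      rw [← map_mul]
      exact congrArg χ (Subtype.ext (hmul r t hr ht))
    have he := eq_exp_of_mul_of_hasDerivAt hder hm h0
    set a := g (F' 1) / χ (FA 1) with ha
    -- Were the exponent `a` in the resolvent half-plane, applying the character to `hR a` would
    -- give `χ (FA 1) = 0`.
    have hre : a.re ≤ s := by
      by_contra hlt
      push Not at hlt
      have h1 := hR a hlt
      have h2 : HasDerivAt (fun t => χ (RA a) * χ (FA t)) (g (R a * F' 1)) 1 := by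
        have h := (g.hasFDerivAt.restrictScalars ℝ).comp_hasDerivAt 1
          ((hF 1 one_pos).const_mul (R a))
        refine h.congr_of_eventuallyEq (Eventually.of_forall fun r => ?_)
        simp only [Function.comp]
        rw [← map_mul]
        exact (hg' (RA a * FA r)).symm
      have h3 := h2.unique ((hder 1 one_pos).const_mul (χ (RA a)))
      have h4 : g (R a * F 1) = χ (RA a) * χ (FA 1) := by
        rw [← map_mul]; exact hg' (RA a * FA 1)
      have h5 : g (F 1) = χ (FA 1) := hg' (FA 1)
      rw [h1, map_sub, map_smul, h4, h5, smul_eq_mul] at h3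
      apply h0
      have h6 : a * χ (FA 1) = g (F' 1) := by rw [ha]; field_simp
      linear_combination -h3 + χ (RA a) * h6
    rw [he, Complex.norm_exp]
    exact Real.exp_le_exp.mpr hre
  have hrad : spectralRadius ℂ (FA 1) < ENNReal.ofReal (Real.exp ω) := by
    refine lt_of_le_of_lt ?_ (ENNReal.ofReal_lt_ofReal_iff (Real.exp_pos _) |>.mpr
      (Real.exp_lt_exp.mpr hsω))
    refine iSup₂_le fun k hk => ?_
    obtain ⟨χ, rfl⟩ := WeakDual.CharacterSpace.mem_spectrum_iff_exists.mp hk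
    rw [← enorm_eq_nnnorm, ← ofReal_norm]
    exact ENNReal.ofReal_le_ofReal (hχ χ)
  -- Gelfand's formula: the `n`-th roots of the norms of the powers converge to the spectral radius,
  -- which is below `exp ω`.
  have ht := (spectrum.pow_norm_pow_one_div_tendsto_nhds_spectralRadius (FA 1)).eventually_lt_const
    hrad
  filter_upwards [ht, eventually_gt_atTop 0] with n hn hn0
  have h1 := (ENNReal.ofReal_lt_ofReal_iff (Real.exp_pos _)).mp hn
  have h2 : ‖FA 1 ^ n‖ = ‖F 1 ^ n‖ := rfl
  rw [h2] at h1
  have hn' : (n : ℝ) ≠ 0 := by positivity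
  calc ‖F 1 ^ n‖ = (‖F 1 ^ n‖ ^ (1 / n : ℝ)) ^ (n : ℝ) := by
        rw [← Real.rpow_mul (norm_nonneg _), one_div, inv_mul_cancel₀ hn', Real.rpow_one]
    _ ≤ Real.exp ω ^ (n : ℝ) := Real.rpow_le_rpow (by positivity) h1.le (by positivity)
    _ = Real.exp (ω * n) := by rw [← Real.exp_mul]

end Growth

/-! ### Resolvents -/

section Resolvent

variable {H : Type u} [NormedAddCommGroup H] [InnerProductSpace ℂ H] {A : H →ₗ.[ℂ] H}

theorem IsResolventAt.eq {z : ℂ} {R R' : H →L[ℂ] H} (h : IsResolventAt A z R)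
    (h' : IsResolventAt A z R') : R = R' := by
  ext x
  exact (h x _).mpr ((h' x _).mp rfl)

theorem IsResolventAt.mem_graph {z : ℂ} {R : H →L[ℂ] H} (h : IsResolventAt A z R) (x : H) :
    (R x, z • R x - x) ∈ A.graph := (h x _).mp rfl

theorem IsResolventAt.apply_eq {z : ℂ} {R : H →L[ℂ] H} (h : IsResolventAt A z R) {x y : H}
    (hxy : (x, y) ∈ A.graph) : R (z • x - y) = x := by
  refine (h _ _).mpr ?_
  simpa using hxy

theorem IsResolventAt.mem_graph_iff {z : ℂ} {R : H →L[ℂ] H} (h : IsResolventAt A z R) {x y : H} :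
    (x, y) ∈ A.graph ↔ R (z • x - y) = x := by
  refine ⟨h.apply_eq, fun hx => ?_⟩
  simpa using (h _ _).mp hx

theorem IsResolventAt.injective {z : ℂ} {R : H →L[ℂ] H} (h : IsResolventAt A z R) :
    Function.Injective R := by
  refine (injective_iff_map_eq_zero R).mpr fun x hx => ?_
  have h1 := h.mem_graph x
  rw [hx, smul_zero, zero_sub] at h1
  simpa using A.graph_fst_eq_zero_snd h1 rfl

theorem isResolventAt_resolventOp {z : ℂ} (hz : z ∉ spec A) :
    IsResolventAt A z (resolventOp A z) := by
  have h : ∃ R, IsResolventAt A z R := by simpa [spec] using hz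
  rw [resolventOp, dif_pos h]
  exact h.choose_spec

theorem IsResolventAt.notMem_spec {z : ℂ} {R : H →L[ℂ] H} (h : IsResolventAt A z R) :
    z ∉ spec A := fun hz => hz ⟨R, h⟩

theorem IsResolventAt.resolventOp_eq {z : ℂ} {R : H →L[ℂ] H} (h : IsResolventAt A z R) :
    resolventOp A z = R := (isResolventAt_resolventOp h.notMem_spec).eq h

theorem resolventOp_of_mem_spec {z : ℂ} (hz : z ∈ spec A) : resolventOp A z = 0 :=
  dif_neg hz

/-- The resolvent identity. -/
theorem IsResolventAt.sub_eq {z w : ℂ} {R Q : H →L[ℂ] H} (hR : IsResolventAt A z R)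
    (hQ : IsResolventAt A w Q) : R - Q = (w - z) • (R * Q) := by
  ext x
  have h := hR.apply_eq (hQ.mem_graph x)
  have h1 : z • Q x - (w • Q x - x) = x - (w - z) • Q x := by module
  rw [h1, map_sub, map_smul] at h
  simp only [sub_apply, smul_apply,
    mul_apply_eq_comp]
  rw [sub_eq_iff_eq_add, ← sub_eq_iff_eq_add']
  exact h

theorem IsResolventAt.commute {z w : ℂ} {R Q : H →L[ℂ] H} (hR : IsResolventAt A z R)
    (hQ : IsResolventAt A w Q) : Commute R Q := by
  rcases eq_or_ne z w with rfl | hzw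
  · rw [hR.eq hQ]
  have h1 := hR.sub_eq hQ
  have h2 := hQ.sub_eq hR
  have h3 : (w - z) • (R * Q) = (w - z) • (Q * R) := by
    rw [← h1, ← neg_sub Q R, h2, ← neg_smul, neg_sub]
  exact smul_right_injective _ (sub_ne_zero.mpr hzw.symm) h3

theorem resolventOp_commute (z w : ℂ) : Commute (resolventOp A z) (resolventOp A w) := by
  by_cases hz : z ∈ spec A
  · rw [resolventOp_of_mem_spec hz]; exact Commute.zero_left _
  by_cases hw : w ∈ spec A
  · rw [resolventOp_of_mem_spec hw]; exact Commute.zero_right _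
  exact (isResolventAt_resolventOp hz).commute (isResolventAt_resolventOp hw)

theorem mem_eigSpace {lam : ℂ} {x : H} : x ∈ eigSpace A lam ↔ (x, lam • x) ∈ A.graph := Iff.rfl

end Resolvent

/-! ### Semigroups on the real half-line -/

namespace C0Semigroup

variable {H : Type u} [NormedAddCommGroup H] [InnerProductSpace ℂ H] [CompleteSpace H]
  {S : C0Semigroup H} {A : H →ₗ.[ℂ] H}

/-- `e^{tA}` for a real parameter `t`, extended by the identity to `t ≤ 0`. -/
def real (S : C0Semigroup H) (t : ℝ) : H →L[ℂ] H := S.op t.toNNReal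

theorem real_of_nonpos {t : ℝ} (ht : t ≤ 0) : S.real t = 1 := by
  rw [real, Real.toNNReal_of_nonpos ht, S.op_zero]; rfl

theorem real_zero : S.real 0 = 1 := real_of_nonpos le_rfl

theorem real_coe (t : ℝ≥0) : S.real t = S.op t := by rw [real, Real.toNNReal_coe]

theorem real_add {s t : ℝ} (hs : 0 ≤ s) (ht : 0 ≤ t) : S.real (s + t) = S.real s * S.real t := by
  rw [real, Real.toNNReal_add hs ht, S.op_add]; rfl

theorem real_commute (s t : ℝ) : Commute (S.real s) (S.real t) := by
  rw [real, real]
  change _ = _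
  have h := S.op_add s.toNNReal t.toNNReal
  rw [add_comm, S.op_add] at h
  exact h.symm

theorem sector_mem_nhds {δ t : ℝ} (hδ : 0 < δ) (ht : 0 < t) : sector δ ∈ 𝓝 (t : ℂ) := by
  have h1 : (t : ℂ) ∈ Complex.slitPlane := by simp [ht]
  have h2 : |(t : ℂ).arg| < δ := by rwa [Complex.arg_ofReal_of_nonneg ht.le, abs_zero]
  have h3 := (Complex.continuousAt_arg h1).abs.eventually_lt_const h2
  filter_upwards [h3, Complex.isOpen_slitPlane.mem_nhds h1] with z hz hz'
  exact ⟨Complex.slitPlane_ne_zero hz', hz⟩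

theorem IsAnalytic.analyticAt (h : S.IsAnalytic) {t : ℝ} (ht : 0 < t) :
    AnalyticAt ℝ S.real t := by
  obtain ⟨δ, hδ, -, T, hTS, hT, -, -⟩ := h
  have h1 : AnalyticAt ℂ T (t : ℂ) := hT.analyticAt (sector_mem_nhds hδ ht)
  have h2 : AnalyticAt ℝ (fun r : ℝ => T (r : ℂ)) t :=
    (h1.restrictScalars (𝕜 := ℝ)).comp (Complex.ofRealCLM.analyticAt t)
  refine h2.congr ?_
  filter_upwards [lt_mem_nhds ht] with r hr
  have := hTS r.toNNReal (Real.toNNReal_pos.mpr hr)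
  rw [Real.coe_toNNReal _ hr.le] at this
  exact this

theorem IsAnalytic.hasDerivAt (h : S.IsAnalytic) {t : ℝ} (ht : 0 < t) :
    HasDerivAt S.real (deriv S.real t) t := (h.analyticAt ht).differentiableAt.hasDerivAt

theorem IsAnalytic.hasDerivAt_apply (h : S.IsAnalytic) {t : ℝ} (ht : 0 < t) (x : H) :
    HasDerivAt (fun t => S.real t x) (deriv S.real t x) t :=
  ((ContinuousLinearMap.apply ℂ H x).hasFDerivAt.restrictScalars ℝ).comp_hasDerivAt t
    (h.hasDerivAt ht)

theorem IsAnalytic.continuousOn (h : S.IsAnalytic) : ContinuousOn S.real (Ioi 0) :=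
  fun _ ht => (h.analyticAt ht).continuousAt.continuousWithinAt

theorem IsAnalytic.continuous_apply (h : S.IsAnalytic) (x : H) :
    Continuous fun t => S.real t x := by
  refine continuous_iff_continuousAt.mpr fun t => ?_
  rcases lt_trichotomy t 0 with ht | rfl | ht
  · refine (continuousAt_const (y := x)).congr ?_
    filter_upwards [gt_mem_nhds ht] with r hr
    rw [real_of_nonpos hr.le]; rfl
  · have h1 : Tendsto Real.toNNReal (𝓝 0) (𝓝 0) := by
      simpa using continuous_real_toNNReal.tendsto 0
    have h2 := (S.tendsto_zero x).comp h1
    rw [ContinuousAt, real_zero]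
    exact h2
  · exact (h.analyticAt ht).continuousAt.clm_apply continuousAt_const

/-- Norm continuity may fail at 0; strong continuity gives pointwise bounds, and the uniform
boundedness principle does the rest. -/
theorem IsAnalytic.exists_norm_le (h : S.IsAnalytic) :
    ∃ M : ℝ, 1 ≤ M ∧ ∀ t ∈ Icc (0 : ℝ) 1, ‖S.real t‖ ≤ M := by
  obtain ⟨C, hC⟩ := banach_steinhaus (g := fun t : Icc (0 : ℝ) 1 => S.real t) fun x => by
    obtain ⟨C, hC⟩ := isCompact_Icc.exists_bound_of_continuousOn
      (s := Icc (0 : ℝ) 1) (h.continuous_apply x).continuousOn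
    exact ⟨C, fun t => hC t t.2⟩
  exact ⟨max C 1, le_max_right _ _, fun t ht => (hC ⟨t, ht⟩).trans (le_max_left _ _)⟩

/-- In this form the difference quotients of the generator are handled by the rules for right
derivatives. -/
theorem IsGenerator.mem_graph_iff (hA : S.IsGenerator A) {x y : H} :
    (x, y) ∈ A.graph ↔ HasDerivWithinAt (fun t => S.real t x) y (Ioi 0) 0 := by
  rw [hA, hasDerivWithinAt_iff_tendsto_slope' (by simp)]
  have h0 : ∀ t : ℝ, slope (fun t => S.real t x) 0 t = ((t : ℝ) : ℂ)⁻¹ • (S.real t x - x) := by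
    intro t
    rw [slope_def_module, real_zero, sub_zero, ← Complex.ofReal_inv, Complex.coe_smul]; rfl
  constructor
  · intro h
    have h1 : Tendsto Real.toNNReal (𝓝[>] 0) (𝓝[>] 0) := by
      refine tendsto_nhdsWithin_iff.mpr ⟨?_, ?_⟩
      · simpa using (continuous_real_toNNReal.tendsto 0).mono_left nhdsWithin_le_nhds
      · filter_upwards [self_mem_nhdsWithin] with t ht
        exact Real.toNNReal_pos.mpr ht
    refine (h.comp h1).congr' ?_
    filter_upwards [self_mem_nhdsWithin] with t ht
    rw [h0, Function.comp, Real.coe_toNNReal _ (le_of_lt ht)]; rfl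
  · intro h
    have h1 : Tendsto ((↑) : ℝ≥0 → ℝ) (𝓝[>] 0) (𝓝[>] 0) := by
      refine tendsto_nhdsWithin_iff.mpr ⟨?_, ?_⟩
      · exact (NNReal.continuous_coe.tendsto 0).mono_left nhdsWithin_le_nhds
      · filter_upwards [self_mem_nhdsWithin] with t ht
        exact NNReal.coe_pos.mpr ht
    refine (h.comp h1).congr fun t => ?_
    rw [Function.comp, h0, real_coe]

theorem IsGenerator.map_graph (hA : S.IsGenerator A) {x y : H} (h : (x, y) ∈ A.graph) (t : ℝ) :
    (S.real t x, S.real t y) ∈ A.graph := by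
  rw [hA.mem_graph_iff] at h ⊢
  refine ((S.real t).hasFDerivAt.restrictScalars ℝ).comp_hasDerivWithinAt 0 h
    |>.congr (fun s _ => ?_) ?_
  · exact congrArg (· x) (real_commute s t)
  · exact congrArg (· x) (real_commute 0 t)

/-- Smoothing: the right derivative at 0 of `s ↦ e^{sA} (e^{tA} x)` is the derivative of the orbit
of `x` at `t`, which exists for every `x`. -/
theorem IsGenerator.deriv_mem_graph (hA : S.IsGenerator A) (h : S.IsAnalytic) {t : ℝ}
    (ht : 0 < t) (x : H) : (S.real t x, deriv S.real t x) ∈ A.graph := by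
  rw [hA.mem_graph_iff]
  have h1 : HasDerivAt (fun s => S.real s x) (deriv S.real t x) (0 + t) := by
    rw [zero_add]
    exact h.hasDerivAt_apply ht x
  have h2 := h1.comp_add_const 0 t
  refine h2.hasDerivWithinAt.congr (fun s hs => ?_) ?_
  · rw [real_add (le_of_lt hs) ht.le]; rfl
  · rw [zero_add, real_zero]; rfl

theorem IsGenerator.deriv_apply (hA : S.IsGenerator A) (h : S.IsAnalytic) {t : ℝ}
    (ht : 0 < t) {x y : H} (hxy : (x, y) ∈ A.graph) : deriv S.real t x = S.real t y :=
  A.mem_graph_snd_inj (hA.deriv_mem_graph h ht x) (hA.map_graph hxy t) rfl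

theorem IsGenerator.dense_domain (hA : S.IsGenerator A) (h : S.IsAnalytic) :
    Dense (A.domain : Set H) := by
  intro x
  have h1 : Tendsto (fun t => S.real t x) (𝓝[>] 0) (𝓝 x) := by
    have := (h.continuous_apply x).tendsto 0
    rw [real_zero] at this
    exact this.mono_left nhdsWithin_le_nhds
  refine mem_closure_of_tendsto h1 ?_
  filter_upwards [self_mem_nhdsWithin] with t ht
  exact LinearPMap.mem_domain_of_mem_graph (hA.deriv_mem_graph h ht x)

theorem IsGenerator.commute_resolvent (hA : S.IsGenerator A) {z : ℂ} {R : H →L[ℂ] H}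
    (hR : IsResolventAt A z R) (t : ℝ) : Commute R (S.real t) := by
  ext x
  refine (hR _ _).mpr ?_
  simpa using hA.map_graph (hR.mem_graph x) t

theorem IsGenerator.commute_resolventOp (hA : S.IsGenerator A) (z : ℂ) (t : ℝ) :
    Commute (resolventOp A z) (S.real t) := by
  by_cases hz : z ∈ spec A
  · rw [resolventOp_of_mem_spec hz]; exact Commute.zero_left _
  · exact hA.commute_resolvent (isResolventAt_resolventOp hz) t

/-- An analytic semigroup has growth bound at most the spectral bound of its generator. -/
theorem IsGenerator.exists_growth_bound (hA : S.IsGenerator A) (h : S.IsAnalytic) {s ω : ℝ}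
    (hs : ∀ lam ∈ spec A, lam.re ≤ s) (hsω : s < ω) :
    ∃ M : ℝ, 0 < M ∧ ∀ t : ℝ, 0 ≤ t → ‖S.real t‖ ≤ M * Real.exp (ω * t) := by
  have h1 := eventually_norm_pow_le_of_resolvent hsω (F := S.real) (F' := deriv S.real)
    (fun t ht => h.hasDerivAt ht) (fun r t hr ht => real_add hr.le ht.le) (resolventOp A)
    hA.commute_resolventOp resolventOp_commute real_commute (by
      intro w hw
      have hw' : w ∉ spec A := fun hmem => (hs w hmem).not_gt hw
      have hR := isResolventAt_resolventOp hw'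
      ext x
      have h2 := hR.apply_eq (hA.deriv_mem_graph h one_pos x)
      rw [map_sub, map_smul, sub_eq_iff_eq_add] at h2
      simp only [sub_apply, smul_apply,
        mul_apply_eq_comp]
      rw [h2]; abel)
  obtain ⟨N, hN⟩ := eventually_atTop.mp h1
  obtain ⟨M, hM1, hM⟩ := h.exists_norm_le
  have hpow : ∀ n : ℕ, S.real n = S.real 1 ^ n := by
    intro n
    induction n with
    | zero => simpa using real_zero
    | succ n ih => rw [Nat.cast_succ, real_add n.cast_nonneg zero_le_one, ih, pow_succ]
  -- The spectral radius controls only large powers; the finitely many others are absorbed by their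
  -- sum.
  obtain ⟨C, hC⟩ : ∃ C : ℝ, ∀ n : ℕ, ‖S.real 1 ^ n‖ * Real.exp (-(ω * n)) ≤ C := by
    refine ⟨max 1 (∑ n ∈ Finset.range N, ‖S.real 1 ^ n‖ * Real.exp (-(ω * n))), fun n => ?_⟩
    by_cases hn : N ≤ n
    · refine le_max_of_le_left ?_
      calc _ ≤ Real.exp (ω * n) * Real.exp (-(ω * n)) :=
            mul_le_mul_of_nonneg_right (hN n hn) (Real.exp_pos _).le
        _ = 1 := by rw [← Real.exp_add]; simp
    · refine le_max_of_le_right ?_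
      exact Finset.single_le_sum (f := fun n : ℕ => ‖S.real 1 ^ n‖ * Real.exp (-(ω * n)))
        (fun i _ => by positivity) (by simpa using hn)
  have hC0 : 0 ≤ C := le_trans (by positivity) (hC 0)
  -- The factor `exp |ω|` pays for replacing `⌊t⌋₊` by `t` in the exponential, whatever the sign of
  -- `ω`.
  refine ⟨(C + 1) * M * Real.exp |ω|, by positivity, fun t ht => ?_⟩
  have hfl : t - ⌊t⌋₊ ∈ Icc (0 : ℝ) 1 :=
    ⟨by linarith [Nat.floor_le ht], by linarith [Nat.lt_floor_add_one t]⟩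
  have hsplit : S.real t = S.real 1 ^ ⌊t⌋₊ * S.real (t - ⌊t⌋₊) := by
    rw [← hpow, ← real_add (Nat.cast_nonneg _) hfl.1]; congr 1; ring
  have h3 : ‖S.real 1 ^ ⌊t⌋₊‖ ≤ C * Real.exp (ω * ⌊t⌋₊) := by
    have := hC ⌊t⌋₊
    rw [Real.exp_neg, ← div_eq_mul_inv, div_le_iff₀ (Real.exp_pos _)] at this
    exact this
  have h4 : Real.exp (ω * ⌊t⌋₊) ≤ Real.exp |ω| * Real.exp (ω * t) := by
    rw [← Real.exp_add, Real.exp_le_exp]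
    have : -(ω * (t - ⌊t⌋₊)) ≤ |ω| := by
      calc -(ω * (t - ⌊t⌋₊)) ≤ |ω * (t - ⌊t⌋₊)| := neg_le_abs _
        _ = |ω| * (t - ⌊t⌋₊) := by rw [abs_mul, abs_of_nonneg hfl.1]
        _ ≤ |ω| * 1 := mul_le_mul_of_nonneg_left hfl.2 (abs_nonneg _)
        _ = |ω| := mul_one _
    linarith
  calc ‖S.real t‖ ≤ ‖S.real 1 ^ ⌊t⌋₊‖ * ‖S.real (t - ⌊t⌋₊)‖ := by
        rw [hsplit]; exact norm_mul_le _ _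
    _ ≤ (C * Real.exp (ω * ⌊t⌋₊)) * M :=
        mul_le_mul h3 (hM _ hfl) (norm_nonneg _) (by positivity)
    _ ≤ ((C + 1) * (Real.exp |ω| * Real.exp (ω * t))) * M := by
        gcongr; linarith
    _ = _ := by ring

end C0Semigroup

/-! ### Fractional powers -/

namespace C0Semigroup

variable {H : Type u} [NormedAddCommGroup H] [InnerProductSpace ℂ H] [CompleteSpace H]
  {S : C0Semigroup H} {A : H →ₗ.[ℂ] H}

/-- The semigroup is analytic, of growth bound at most `ω`. -/
structure AnalyticWithGrowth (S : C0Semigroup H) (ω : ℝ) : Prop where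
  analytic : S.IsAnalytic
  bound : ∃ M : ℝ, 0 < M ∧ ∀ t : ℝ, 0 ≤ t → ‖S.real t‖ ≤ M * Real.exp (ω * t)

variable {ω μ : ℝ}

/-- The dominating function is the Gamma integrand `t ^ (α - 1) * exp (-(μ - ω) t)`. Analyticity
enters through operator norm continuity on `(0, ∞)`, which gives measurability in the space of
operators. -/
theorem AnalyticWithGrowth.integrableOn (h : S.AnalyticWithGrowth ω) (hμ : ω < μ) {α : ℝ}
    (hα : 0 < α) : IntegrableOn
      (fun t : ℝ => ((t ^ (α - 1) * Real.exp (-μ * t) : ℝ) : ℂ) • S.real t) (Ioi 0) := by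
  obtain ⟨M, hM, hbound⟩ := h.bound
  have h1 : IntegrableOn (fun t : ℝ => M * (t ^ (α - 1) * Real.exp (-(μ - ω) * t ^ (1 : ℝ))))
      (Ioi 0) :=
    (integrableOn_rpow_mul_exp_neg_mul_rpow (by linarith) one_pos (by linarith)).const_mul M
  refine h1.mono' ?_ ?_
  · refine ContinuousOn.aestronglyMeasurable ?_ measurableSet_Ioi
    refine ContinuousOn.smul (f := fun t : ℝ => ((t ^ (α - 1) * Real.exp (-μ * t) : ℝ) : ℂ))
      ?_ h.analytic.continuousOn
    refine Complex.continuous_ofReal.comp_continuousOn ?_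
    refine ContinuousOn.mul (fun t ht => ?_) (by fun_prop)
    exact (Real.continuousAt_rpow_const t _ (Or.inl (ne_of_gt ht))).continuousWithinAt
  · refine (ae_restrict_mem measurableSet_Ioi).mono fun t ht => ?_
    have ht' : (0 : ℝ) < t := ht
    rw [norm_smul, Complex.norm_real, Real.norm_of_nonneg (by positivity), Real.rpow_one]
    calc _ ≤ t ^ (α - 1) * Real.exp (-μ * t) * (M * Real.exp (ω * t)) :=
          mul_le_mul_of_nonneg_left (hbound t ht'.le) (by positivity)
      _ = M * (t ^ (α - 1) * (Real.exp (-μ * t) * Real.exp (ω * t))) := by ring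
      _ = _ := by rw [← Real.exp_add]; ring_nf

theorem powNeg_zero : S.powNeg μ 0 = 1 := if_pos rfl

theorem powNeg_of_pos {α : ℝ} (hα : 0 < α) : S.powNeg μ α = ((Real.Gamma α : ℂ))⁻¹ •
    ∫ t in Ioi (0 : ℝ), ((t ^ (α - 1) * Real.exp (-μ * t) : ℝ) : ℂ) • S.real t :=
  if_neg hα.ne'

theorem AnalyticWithGrowth.commute_powNeg (h : S.AnalyticWithGrowth ω) (hμ : ω < μ) {α : ℝ}
    (hα : 0 ≤ α) {X : H →L[ℂ] H} (hX : ∀ t, Commute X (S.real t)) :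
    Commute X (S.powNeg μ α) := by
  rcases hα.eq_or_lt with rfl | hα
  · rw [powNeg_zero]; exact Commute.one_right X
  rw [powNeg_of_pos hα]
  refine Commute.smul_right ?_ _
  have hi := h.integrableOn hμ hα
  have h1 := (ContinuousLinearMap.mul ℂ (H →L[ℂ] H) X).integral_comp_comm hi
  have h2 := ((ContinuousLinearMap.mul ℂ (H →L[ℂ] H)).flip X).integral_comp_comm hi
  simp only [ContinuousLinearMap.mul_apply', ContinuousLinearMap.flip_apply] at h1 h2
  rw [Commute, SemiconjBy, ← h1, ← h2]
  congr 1
  ext1 t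
  rw [mul_smul_comm, smul_mul_assoc, (hX t).eq]

theorem AnalyticWithGrowth.powNeg_commute_real (h : S.AnalyticWithGrowth ω) (hμ : ω < μ) {α : ℝ}
    (hα : 0 ≤ α) (t : ℝ) : Commute (S.powNeg μ α) (S.real t) :=
  (h.commute_powNeg hμ hα fun s => real_commute t s).symm

/-- The product of the two integrals is the integral of a convolution. By the semigroup law the
operator factors out of the convolution, leaving a Beta integral, and `Γ(α) Γ(β) = Γ(α + β) B(α, β)`
adjusts the constants. -/
theorem AnalyticWithGrowth.powNeg_mul_powNeg (h : S.AnalyticWithGrowth ω) (hμ : ω < μ)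
    {α β : ℝ} (hα : 0 ≤ α) (hβ : 0 ≤ β) :
    S.powNeg μ α * S.powNeg μ β = S.powNeg μ (α + β) := by
  rcases hα.eq_or_lt with rfl | hα
  · rw [powNeg_zero, one_mul, zero_add]
  rcases hβ.eq_or_lt with rfl | hβ
  · rw [powNeg_zero, mul_one, add_zero]
  rw [powNeg_of_pos hα, powNeg_of_pos hβ, powNeg_of_pos (add_pos hα hβ), smul_mul_smul_comm]
  have key := integral_posConvolution (h.integrableOn hμ hα) (h.integrableOn hμ hβ)
    (ContinuousLinearMap.mul ℝ (H →L[ℂ] H))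
  simp only [ContinuousLinearMap.mul_apply'] at key
  rw [← key]
  have hin : ∀ x ∈ Ioi (0 : ℝ),
      (∫ t in (0 : ℝ)..x, (((t ^ (α - 1) * Real.exp (-μ * t) : ℝ) : ℂ) • S.real t) *
        ((((x - t) ^ (β - 1) * Real.exp (-μ * (x - t)) : ℝ) : ℂ) • S.real (x - t))) =
      Complex.betaIntegral α β •
        (((x ^ (α + β - 1) * Real.exp (-μ * x) : ℝ) : ℂ) • S.real x) := by
    intro x hx
    have hx0 : (0 : ℝ) < x := hx
    have h1 : ∀ t ∈ Ioc 0 x, (((t ^ (α - 1) * Real.exp (-μ * t) : ℝ) : ℂ) • S.real t) *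
        ((((x - t) ^ (β - 1) * Real.exp (-μ * (x - t)) : ℝ) : ℂ) • S.real (x - t)) =
        ((t : ℂ) ^ ((α : ℂ) - 1) * ((x : ℂ) - t) ^ ((β : ℂ) - 1)) •
          (((Real.exp (-μ * x) : ℝ) : ℂ) • S.real x) := by
      intro t ht
      rw [smul_mul_smul_comm, ← real_add ht.1.le (by linarith [ht.2]), add_sub_cancel, smul_smul]
      congr 1
      have e1 : ((t ^ (α - 1) : ℝ) : ℂ) = (t : ℂ) ^ ((α : ℂ) - 1) := by
        rw [Complex.ofReal_cpow ht.1.le]; push_cast; rfl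
      have e2 : (((x - t) ^ (β - 1) : ℝ) : ℂ) = ((x : ℂ) - t) ^ ((β : ℂ) - 1) := by
        rw [Complex.ofReal_cpow (by linarith [ht.2])]; push_cast; rfl
      have e3 : Real.exp (-μ * x) = Real.exp (-μ * t) * Real.exp (-μ * (x - t)) := by
        rw [← Real.exp_add]; ring_nf
      rw [e3, Complex.ofReal_mul, Complex.ofReal_mul, Complex.ofReal_mul, e1, e2]
      ring
    rw [intervalIntegral.integral_of_le hx0.le, setIntegral_congr_fun measurableSet_Ioc h1,
      integral_smul_const, ← intervalIntegral.integral_of_le hx0.le,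
      Complex.betaIntegral_scaled _ _ hx0, smul_smul, smul_smul]
    congr 1
    rw [Complex.ofReal_mul, Complex.ofReal_cpow hx0.le]
    push_cast
    ring
  rw [setIntegral_congr_fun measurableSet_Ioi hin, integral_smul, smul_smul]
  congr 1
  have hG := Complex.Gamma_mul_Gamma_eq_betaIntegral (s := α) (t := β) (by simpa) (by simpa)
  rw [← Complex.ofReal_add, Complex.Gamma_ofReal, Complex.Gamma_ofReal, Complex.Gamma_ofReal]
    at hG
  have g1 : (Real.Gamma α : ℂ) ≠ 0 := Complex.ofReal_ne_zero.mpr (Real.Gamma_pos_of_pos hα).ne'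
  have g2 : (Real.Gamma β : ℂ) ≠ 0 := Complex.ofReal_ne_zero.mpr (Real.Gamma_pos_of_pos hβ).ne'
  have g3 : (Real.Gamma (α + β) : ℂ) ≠ 0 :=
    Complex.ofReal_ne_zero.mpr (Real.Gamma_pos_of_pos (add_pos hα hβ)).ne'
  field_simp
  linear_combination -hG

theorem AnalyticWithGrowth.integrableOn_apply (h : S.AnalyticWithGrowth ω) (hμ : ω < μ) (x : H) :
    IntegrableOn (fun t : ℝ => (Real.exp (-μ * t)) • S.real t x) (Ioi 0) := by
  have h1 := (ContinuousLinearMap.apply ℂ H x).integrable_comp (h.integrableOn hμ one_pos)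
  refine h1.congr (Eventually.of_forall fun t => ?_)
  simp only [sub_self, Real.rpow_zero, one_mul]
  exact Complex.coe_smul _ _

theorem AnalyticWithGrowth.powNeg_one_apply (h : S.AnalyticWithGrowth ω) (hμ : ω < μ) (x : H) :
    S.powNeg μ 1 x = ∫ t in Ioi (0 : ℝ), (Real.exp (-μ * t)) • S.real t x := by
  rw [powNeg_of_pos one_pos, Real.Gamma_one, Complex.ofReal_one, inv_one, one_smul,
    ContinuousLinearMap.integral_apply (h.integrableOn hμ one_pos)]
  refine integral_congr_ae (Eventually.of_forall fun t => ?_)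
  simp only [sub_self, Real.rpow_zero, one_mul]
  exact Complex.coe_smul _ _

/-- Translating the Laplace integral gives `e^{tA} ∫₀^∞ φ = e^{μt} ∫ₜ^∞ φ`, and the right-hand side
is differentiable at 0 by the product rule. -/
theorem AnalyticWithGrowth.hasDerivWithinAt_powNeg_one (h : S.AnalyticWithGrowth ω) (hμ : ω < μ)
    (x : H) : HasDerivWithinAt (fun t => S.real t (S.powNeg μ 1 x))
      ((μ : ℂ) • S.powNeg μ 1 x - x) (Ioi 0) 0 := by
  set φ : ℝ → H := fun t => (Real.exp (-μ * t)) • S.real t x with hφ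
  have hc : Continuous φ := by
    have := h.analytic.continuous_apply x
    fun_prop
  have hi := h.integrableOn_apply hμ x
  have h1 : ∀ t : ℝ, 0 ≤ t → S.real t (S.powNeg μ 1 x) =
      Real.exp (μ * t) • (S.powNeg μ 1 x - ∫ s in (0 : ℝ)..t, φ s) := by
    intro t ht
    have e1 : S.powNeg μ 1 x - ∫ s in (0 : ℝ)..t, φ s = ∫ s in Ioi t, φ s := by
      rw [h.powNeg_one_apply hμ, intervalIntegral.integral_of_le ht, sub_eq_iff_eq_add',
        ← setIntegral_union Ioc_disjoint_Ioi_same measurableSet_Ioi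
        (hi.mono_set Ioc_subset_Ioi_self) (hi.mono_set (Ioi_subset_Ioi ht)),
        Ioc_union_Ioi_eq_Ioi ht]
    have e2 : ∫ s in Ioi t, φ s = ∫ s in Ioi (0 : ℝ), φ (s + t) := by
      have := (measurePreserving_add_right volume t).setIntegral_preimage_emb
        (measurableEmbedding_addRight t) φ (Ioi t)
      rw [preimage_add_const_Ioi, sub_self] at this
      exact this.symm
    rw [e1, e2, ← integral_smul, h.powNeg_one_apply hμ, ← (S.real t).integral_comp_comm hi]
    refine setIntegral_congr_fun measurableSet_Ioi fun s hs => ?_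
    have e3 : S.real (s + t) x = S.real t (S.real s x) := by
      rw [add_comm, real_add ht (le_of_lt hs)]; rfl
    simp only [hφ, e3, smul_smul, ← Real.exp_add]
    rw [← Complex.coe_smul, map_smul, Complex.coe_smul]
    congr 2
    ring
  have h2 : HasDerivAt (fun t => ∫ s in (0 : ℝ)..t, φ s) (φ 0) 0 :=
    intervalIntegral.integral_hasDerivAt_right (hc.intervalIntegrable _ _)
      (hc.stronglyMeasurableAtFilter _ _) hc.continuousAt
  have h3 : HasDerivAt (fun t : ℝ => Real.exp (μ * t)) μ 0 := by
    simpa using ((hasDerivAt_id (0 : ℝ)).const_mul μ).exp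
  have h4 := h3.smul ((hasDerivAt_const 0 (S.powNeg μ 1 x)).sub h2)
  refine (h4.hasDerivWithinAt.congr (fun t ht => h1 t (le_of_lt ht)) (h1 0 le_rfl)).congr_deriv ?_
  simp only [hφ, real_zero, Pi.sub_apply, intervalIntegral.integral_same, mul_zero, Real.exp_zero,
    one_smul, sub_zero, zero_sub]
  rw [Complex.coe_smul, add_comm, sub_eq_add_neg]
  rfl

theorem IsGenerator.isResolventAt_powNeg_one (hA : S.IsGenerator A)
    (h : S.AnalyticWithGrowth ω) (hμ : ω < μ) : IsResolventAt A μ (S.powNeg μ 1) := by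
  have h1 : ∀ x, (S.powNeg μ 1 x, (μ : ℂ) • S.powNeg μ 1 x - x) ∈ A.graph := fun x =>
    hA.mem_graph_iff.mpr (h.hasDerivWithinAt_powNeg_one hμ x)
  intro x y
  refine ⟨fun hxy => hxy ▸ h1 x, fun hy => ?_⟩
  -- For the left inverse, the derivative of `e^{tA} (μ - A)⁻¹ y` at 0 is computed twice, once by
  -- commuting the resolvent with the semigroup.
  have h2 := ((S.powNeg μ 1).hasFDerivAt.restrictScalars ℝ).comp_hasDerivWithinAt 0
    (hA.mem_graph_iff.mp hy)
  have h3 : HasDerivWithinAt (fun t => S.real t (S.powNeg μ 1 y))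
      (S.powNeg μ 1 ((μ : ℂ) • y - x)) (Ioi 0) 0 := by
    refine h2.congr (fun t _ => ?_) ?_
    · exact (congrArg (· y) (h.powNeg_commute_real hμ zero_le_one t)).symm
    · exact (congrArg (· y) (h.powNeg_commute_real hμ zero_le_one 0)).symm
  have h5 := (uniqueDiffWithinAt_Ioi (0 : ℝ)).eq_deriv _ h3 (h.hasDerivWithinAt_powNeg_one hμ y)
  rw [map_sub, map_smul, sub_right_inj] at h5
  exact h5

/-- The adjoint is a continuous conjugate-linear map and the weights are real, so it passes through
the integral. -/
theorem AnalyticWithGrowth.powNegAdj_eq (h : S.AnalyticWithGrowth ω) (hμ : ω < μ) {α : ℝ}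
    (hα : 0 ≤ α) : S.powNegAdj μ α = ContinuousLinearMap.adjoint (S.powNeg μ α) := by
  rcases hα.eq_or_lt with rfl | hα
  · rw [powNeg_zero, powNegAdj, fracPowNeg, if_pos rfl]
    exact ContinuousLinearMap.adjoint_id.symm
  have h1 := ContinuousLinearMap.integral_comp_commSL (σ := starRingEnd ℂ)
    (fun r x => by simp) (ContinuousLinearMap.adjoint (𝕜 := ℂ) (E := H) (F := H)
      |>.toContinuousLinearEquiv.toContinuousLinearMap) (h.integrableOn hμ hα)
  rw [powNeg_of_pos hα, powNegAdj, fracPowNeg, if_neg hα.ne', map_smulₛₗ, map_inv₀,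
    Complex.conj_ofReal]
  congr 1
  refine Eq.trans ?_ h1
  refine integral_congr_ae (Eventually.of_forall fun t => ?_)
  change _ = ContinuousLinearMap.adjoint (_ • S.real t)
  rw [map_smulₛₗ, Complex.conj_ofReal]
  rfl

end C0Semigroup

/-! ### The adjoint operator -/

section AdjointGraph

variable {H : Type u} [NormedAddCommGroup H] [InnerProductSpace ℂ H] [CompleteSpace H]
  {A : H →ₗ.[ℂ] H}

theorem mem_adjoint_graph_iff (hd : Dense (A.domain : Set H)) {x y : H} :
    (x, y) ∈ A†.graph ↔ ∀ a b, (a, b) ∈ A.graph → ⟪y, a⟫_ℂ = ⟪x, b⟫_ℂ := by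
  constructor
  · intro h a b hab
    obtain ⟨⟨x', hx⟩, rfl, rfl⟩ := (LinearPMap.mem_graph_iff _).mp h
    obtain ⟨a', rfl, rfl⟩ := (LinearPMap.mem_graph_iff _).mp hab
    exact LinearPMap.adjoint_isFormalAdjoint hd ⟨x', hx⟩ a'
  · intro h
    have h1 : ∀ a : A.domain, ⟪y, (a : H)⟫_ℂ = ⟪x, A a⟫_ℂ := fun a => h a (A a) (A.mem_graph a)
    have hx : x ∈ A†.domain := LinearPMap.mem_adjoint_domain_of_exists x ⟨y, h1⟩
    exact (LinearPMap.mem_graph_iff _).mpr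
      ⟨⟨x, hx⟩, rfl, LinearPMap.adjoint_apply_eq hd ⟨x, hx⟩ h1⟩

theorem IsResolventAt.adjoint (hd : Dense (A.domain : Set H)) {z : ℂ} {R : H →L[ℂ] H}
    (hR : IsResolventAt A z R) : IsResolventAt A† (conj z) (ContinuousLinearMap.adjoint R) := by
  have key : ∀ x y : H, (x, y) ∈ A†.graph ↔
      ContinuousLinearMap.adjoint R (conj z • x - y) = x := by
    intro x y
    have h1 : ∀ c, (⟪y, R c⟫_ℂ = ⟪x, z • R c - c⟫_ℂ ↔
        ⟪ContinuousLinearMap.adjoint R (conj z • x - y), c⟫_ℂ = ⟪x, c⟫_ℂ) := by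
      intro c
      rw [ContinuousLinearMap.adjoint_inner_left, inner_sub_left, inner_sub_right, inner_smul_left,
        inner_smul_right, Complex.conj_conj]
      constructor <;> intro h <;> linear_combination -h
    rw [mem_adjoint_graph_iff hd]
    constructor
    · intro h
      exact ext_inner_right ℂ fun c => (h1 c).mp (h _ _ (hR.mem_graph c))
    · intro h a b hab
      have h2 := (h1 (z • a - b)).mpr (by rw [h])
      rw [hR.apply_eq hab] at h2
      simpa using h2
  intro x y
  rw [key]
  simp

end AdjointGraph

/-! ### Adjoint powers: injectivity and compatibility with `A†` -/

namespace C0Semigroup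

variable {H : Type u} [NormedAddCommGroup H] [InnerProductSpace ℂ H] [CompleteSpace H]
  {S : C0Semigroup H} {A : H →ₗ.[ℂ] H} {ω μ : ℝ}

theorem IsGenerator.isResolventAt_adjoint_powNeg_one (hA : S.IsGenerator A)
    (h : S.AnalyticWithGrowth ω) (hμ : ω < μ) :
    IsResolventAt A† μ (ContinuousLinearMap.adjoint (S.powNeg μ 1)) := by
  simpa using (hA.isResolventAt_powNeg_one h hμ).adjoint (hA.dense_domain h.analytic)

/-- Composition with the complementary power is the resolvent, which is injective. -/
theorem IsGenerator.powNeg_injective (hA : S.IsGenerator A) (h : S.AnalyticWithGrowth ω)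
    (hμ : ω < μ) {α : ℝ} (hα : α ∈ Icc (0 : ℝ) 1) : Function.Injective (S.powNeg μ α) := by
  have h1 := h.powNeg_mul_powNeg hμ (sub_nonneg.mpr hα.2) hα.1
  rw [sub_add_cancel] at h1
  have h2 := (hA.isResolventAt_powNeg_one h hμ).injective
  rw [← h1] at h2
  exact Function.Injective.of_comp (f := S.powNeg μ (1 - α)) h2

theorem IsGenerator.adjoint_powNeg_injective (hA : S.IsGenerator A) (h : S.AnalyticWithGrowth ω)
    (hμ : ω < μ) {α : ℝ} (hα : α ∈ Icc (0 : ℝ) 1) :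
    Function.Injective (ContinuousLinearMap.adjoint (S.powNeg μ α)) := by
  have h1 := h.powNeg_mul_powNeg hμ hα.1 (sub_nonneg.mpr hα.2)
  rw [add_sub_cancel] at h1
  have h2 := (hA.isResolventAt_adjoint_powNeg_one h hμ).injective
  rw [← h1, ContinuousLinearMap.mul_def, ContinuousLinearMap.adjoint_comp] at h2
  exact Function.Injective.of_comp
    (f := ContinuousLinearMap.adjoint (S.powNeg μ (1 - α))) h2

theorem AnalyticWithGrowth.powNeg_commute_powNeg (h : S.AnalyticWithGrowth ω) (hμ : ω < μ)
    {α β : ℝ} (hα : 0 ≤ α) (hβ : 0 ≤ β) : Commute (S.powNeg μ α) (S.powNeg μ β) := by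
  rw [Commute, SemiconjBy, h.powNeg_mul_powNeg hμ hα hβ, h.powNeg_mul_powNeg hμ hβ hα, add_comm]

/-- The graph of `A†` is invariant under the powers `(μ - A*)^{-α}`, and this characterizes it. -/
theorem IsGenerator.adjoint_powNeg_mem_graph_iff (hA : S.IsGenerator A)
    (h : S.AnalyticWithGrowth ω) (hμ : ω < μ) {α : ℝ} (hα : α ∈ Icc (0 : ℝ) 1) {x y : H} :
    (ContinuousLinearMap.adjoint (S.powNeg μ α) x,
      ContinuousLinearMap.adjoint (S.powNeg μ α) y) ∈ A†.graph ↔ (x, y) ∈ A†.graph := by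
  have hR := hA.isResolventAt_adjoint_powNeg_one h hμ
  have hc : ∀ z, ContinuousLinearMap.adjoint (S.powNeg μ 1)
      (ContinuousLinearMap.adjoint (S.powNeg μ α) z) =
      ContinuousLinearMap.adjoint (S.powNeg μ α)
        (ContinuousLinearMap.adjoint (S.powNeg μ 1) z) := by
    intro z
    have := congrArg ContinuousLinearMap.adjoint (h.powNeg_commute_powNeg hμ hα.1 zero_le_one).eq
    rw [ContinuousLinearMap.mul_def, ContinuousLinearMap.mul_def, ContinuousLinearMap.adjoint_comp,
      ContinuousLinearMap.adjoint_comp] at this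
    exact congrArg (· z) this
  -- Membership in the graph is an equation in the bounded adjoint resolvent, from which the
  -- commuting injective power cancels.
  rw [hR.mem_graph_iff, hR.mem_graph_iff, ← map_smul, ← map_sub, hc]
  exact (hA.adjoint_powNeg_injective h hμ hα).eq_iff

/-! ### Integrals of orbits -/

/-- The integral `∫₀ᵗ e^{sA} x ds`. -/
def orbitIntegral (S : C0Semigroup H) (x : H) (t : ℝ) : H := ∫ s in (0 : ℝ)..t, S.real s x

/-- The element `(μ - A) ∫₀ᵗ e^{sA} x ds`. -/
def orbitLift (S : C0Semigroup H) (μ : ℝ) (x : H) (t : ℝ) : H :=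
  (μ : ℂ) • S.orbitIntegral x t - S.real t x + x

theorem orbitIntegral_zero (x : H) : S.orbitIntegral x 0 = 0 := intervalIntegral.integral_same

theorem orbitLift_zero (x : H) : S.orbitLift μ x 0 = 0 := by
  rw [orbitLift, orbitIntegral_zero, real_zero]; simp

theorem IsAnalytic.hasDerivAt_orbitIntegral (h : S.IsAnalytic) (x : H) (t : ℝ) :
    HasDerivAt (S.orbitIntegral x) (S.real t x) t :=
  intervalIntegral.integral_hasDerivAt_right ((h.continuous_apply x).intervalIntegrable _ _)
    ((h.continuous_apply x).stronglyMeasurableAtFilter _ _) (h.continuous_apply x).continuousAt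

theorem IsAnalytic.continuous_orbitIntegral (h : S.IsAnalytic) (x : H) :
    Continuous (S.orbitIntegral x) :=
  continuous_iff_continuousAt.mpr fun t => (h.hasDerivAt_orbitIntegral x t).continuousAt

theorem IsAnalytic.continuous_orbitLift (h : S.IsAnalytic) (x : H) :
    Continuous (S.orbitLift μ x) := by
  have h1 := h.continuous_apply x
  have h2 := h.continuous_orbitIntegral x
  unfold orbitLift
  fun_prop

theorem IsGenerator.real_sub_eq_integral (hA : S.IsGenerator A) (h : S.IsAnalytic) {x y : H}
    (hxy : (x, y) ∈ A.graph) {t : ℝ} (ht : 0 ≤ t) :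
    S.real t x - x = ∫ s in (0 : ℝ)..t, S.real s y := by
  rw [intervalIntegral.integral_eq_sub_of_hasDerivAt_of_le ht
    (h.continuous_apply x).continuousOn (fun s hs => ?_)
    ((h.continuous_apply y).intervalIntegrable _ _), real_zero]
  · rfl
  · exact (h.hasDerivAt_apply hs.1 x).congr_deriv (hA.deriv_apply h hs.1 hxy)

/-- The identity `A ∫₀ᵗ e^{sA} x ds = e^{tA} x - x` is used only after applying `R`: since `R x`
lies in the domain, the fundamental theorem of calculus applies to its orbit, and `x` may be
arbitrary. -/
theorem IsGenerator.resolvent_orbitLift (hA : S.IsGenerator A) (h : S.IsAnalytic)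
    {R : H →L[ℂ] H} (hR : IsResolventAt A μ R) (x : H) {t : ℝ} (ht : 0 ≤ t) :
    R (S.orbitLift μ x t) = S.orbitIntegral x t := by
  have h1 := hA.real_sub_eq_integral h (hR.mem_graph x) ht
  have hi : ∀ y, IntervalIntegrable (fun s => S.real s y) volume 0 t :=
    fun y => (h.continuous_apply y).intervalIntegrable _ _
  have h2 : ∫ s in (0 : ℝ)..t, S.real s ((μ : ℂ) • R x - x) =
      (μ : ℂ) • R (S.orbitIntegral x t) - S.orbitIntegral x t := by
    have e1 : R (S.orbitIntegral x t) = ∫ s in (0 : ℝ)..t, S.real s (R x) := by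
      rw [orbitIntegral, ← R.intervalIntegral_comp_comm (hi x)]
      refine intervalIntegral.integral_congr fun s _ => ?_
      exact congrArg (· x) (hA.commute_resolvent hR s)
    rw [e1, orbitIntegral, ← intervalIntegral.integral_smul,
      ← intervalIntegral.integral_sub (f := fun s => (μ : ℂ) • S.real s (R x))
        ((hi _).smul _) (hi _)]
    simp
  rw [h2, show S.real t (R x) = R (S.real t x) from
    (congrArg (· x) (hA.commute_resolvent hR t)).symm] at h1
  rw [orbitLift, map_add, map_sub, map_smul]
  rw [sub_eq_iff_eq_add] at h1
  rw [h1]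
  abel

/-- The weak equation for an arbitrary `x`: the vector `z` is written as a value of the adjoint
resolvent, which moves to the other side. The resolvent point `ω + 1` is auxiliary. -/
theorem IsGenerator.inner_real_sub (hA : S.IsGenerator A) (h : S.AnalyticWithGrowth ω) {z z' : H}
    (hz : (z, z') ∈ A†.graph) (x : H) {t : ℝ} (ht : 0 ≤ t) :
    ⟪z, S.real t x⟫_ℂ - ⟪z, x⟫_ℂ = ⟪z', S.orbitIntegral x t⟫_ℂ := by
  have hμ : ω < ω + 1 := by linarith
  have h1 := (hA.isResolventAt_adjoint_powNeg_one h hμ).apply_eq hz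
  have h2 := hA.resolvent_orbitLift h.analytic (hA.isResolventAt_powNeg_one h hμ) x ht
  have h3 : ⟪z, S.orbitLift (ω + 1) x t⟫_ℂ =
      ⟪((ω + 1 : ℝ) : ℂ) • z - z', S.orbitIntegral x t⟫_ℂ := by
    rw [← h2, ← ContinuousLinearMap.adjoint_inner_left, h1]
  rw [orbitLift, inner_add_right, inner_sub_right, inner_smul_right, inner_sub_left,
    inner_smul_left, Complex.conj_ofReal] at h3
  linear_combination -h3

end C0Semigroup

/-! ### The resolvent as a holomorphic function -/

section Holomorphic

variable {H : Type u} [NormedAddCommGroup H] [InnerProductSpace ℂ H] [CompleteSpace H]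
  {A : H →ₗ.[ℂ] H} {μ : ℂ} {R : H →L[ℂ] H}

/-- The bounded operator `(z - A)(μ - A)⁻¹`, where `R = (μ - A)⁻¹`. -/
def shiftOp (R : H →L[ℂ] H) (μ z : ℂ) : H →L[ℂ] H := 1 - (μ - z) • R

/-- The second factor is `(μ - A)(z - A)⁻¹`. Invertibility of `z - A` thus becomes invertibility of
a bounded operator affine in `z`, whence openness of the resolvent set and holomorphy of the
resolvent. -/
theorem IsResolventAt.shiftOp_mul {z : ℂ} {Q : H →L[ℂ] H} (hR : IsResolventAt A μ R)
    (hQ : IsResolventAt A z Q) : shiftOp R μ z * (1 + (μ - z) • Q) = 1 := by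
  have h1 : Q - R = (μ - z) • (R * Q) := by
    rw [(hR.commute hQ).eq]; exact hQ.sub_eq hR
  have h2 : shiftOp R μ z * (1 + (μ - z) • Q) =
      1 + (μ - z) • (Q - R - (μ - z) • (R * Q)) := by
    rw [shiftOp, sub_mul, mul_add, mul_add, smul_mul_smul_comm]
    simp only [one_mul, mul_one, smul_sub, smul_smul]
    abel
  rw [h2, h1, sub_self, smul_zero, add_zero]

theorem IsResolventAt.isUnit_shiftOp {z : ℂ} (hR : IsResolventAt A μ R) (hz : z ∉ spec A) :
    IsUnit (shiftOp R μ z) := by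
  have hQ := isResolventAt_resolventOp hz
  have h1 := hR.shiftOp_mul hQ
  have hc : Commute (shiftOp R μ z) (1 + (μ - z) • resolventOp A z) :=
    ((Commute.one_left _).sub_left
      (((Commute.one_right _).add_right ((hR.commute hQ).smul_right _)).smul_left _))
  exact ⟨⟨_, _, h1, hc.eq ▸ h1⟩, rfl⟩

theorem IsResolventAt.isResolventAt_inverse {z : ℂ} (hR : IsResolventAt A μ R)
    (hu : IsUnit (shiftOp R μ z)) :
    IsResolventAt A z (R * Ring.inverse (shiftOp R μ z)) := by
  set Q := Ring.inverse (shiftOp R μ z) with hQ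
  have hQ1 : Q * shiftOp R μ z = 1 := Ring.inverse_mul_cancel _ hu
  have hQ2 : shiftOp R μ z * Q = 1 := Ring.mul_inverse_cancel _ hu
  have hc : Commute R (shiftOp R μ z) :=
    (Commute.one_right R).sub_right ((Commute.refl R).smul_right _)
  have hcQ : R * Q = Q * R := by
    calc R * Q = Q * shiftOp R μ z * (R * Q) := by rw [hQ1, one_mul]
      _ = Q * (R * shiftOp R μ z) * Q := by rw [hc.eq]; simp only [mul_assoc]
      _ = Q * R := by rw [mul_assoc, mul_assoc, hQ2, mul_one]
  intro x y
  have e1 : (y, z • y - x) ∈ A.graph ↔ R x = shiftOp R μ z y := by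
    rw [hR.mem_graph_iff, show μ • y - (z • y - x) = (μ - z) • y + x by module, map_add, map_smul,
      shiftOp, sub_apply, smul_apply, one_apply_eq_self, eq_sub_iff_add_eq']
  rw [e1, hcQ]
  constructor
  · rintro rfl
    exact (congrArg (fun X : H →L[ℂ] H => X (R x)) hQ2).symm
  · intro h
    rw [mul_apply_eq_comp, h]
    exact congrArg (fun X : H →L[ℂ] H => X y) hQ1

theorem IsResolventAt.notMem_spec_iff {z : ℂ} (hR : IsResolventAt A μ R) :
    z ∉ spec A ↔ IsUnit (shiftOp R μ z) :=
  ⟨hR.isUnit_shiftOp, fun h => (hR.isResolventAt_inverse h).notMem_spec⟩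

theorem IsResolventAt.isOpen_compl_spec (hR : IsResolventAt A μ R) : IsOpen (spec A)ᶜ := by
  have h : (spec A)ᶜ = shiftOp R μ ⁻¹' {X | IsUnit X} := by
    ext z; exact hR.notMem_spec_iff
  rw [h]
  refine Units.isOpen.preimage ?_
  unfold shiftOp
  fun_prop

theorem IsResolventAt.differentiableOn_resolventOp (hR : IsResolventAt A μ R) :
    DifferentiableOn ℂ (resolventOp A) (spec A)ᶜ := by
  have h : ∀ z ∈ (spec A)ᶜ, resolventOp A z = R * Ring.inverse (shiftOp R μ z) := fun z hz =>
    (hR.isResolventAt_inverse (hR.notMem_spec_iff.mp hz)).resolventOp_eq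
  refine DifferentiableOn.congr (fun z hz => DifferentiableAt.differentiableWithinAt ?_) h
  have h1 : DifferentiableAt ℂ (shiftOp R μ) z := by unfold shiftOp; fun_prop
  have h2 : DifferentiableAt ℂ Ring.inverse (shiftOp R μ z) :=
    differentiableAt_inverse (hR.notMem_spec_iff.mp hz)
  exact (h2.comp z h1).const_mul R

/-- Isolated points form a discrete subspace of the plane, and a separable discrete space is
countable. -/
theorem HasIsolatedEigenvalues.countable_spec (h : HasIsolatedEigenvalues A) :
    (spec A).Countable := by
  have : DiscreteTopology (spec A) := by
    refine discreteTopology_subtype_iff'.mpr fun lam hlam => ?_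
    obtain ⟨-, δ, hδ, hs, -⟩ := h lam hlam
    refine ⟨Metric.ball lam δ, Metric.isOpen_ball, Subset.antisymm ?_ ?_⟩
    · rw [← hs, inter_comm]
      exact inter_subset_inter_right _ Metric.ball_subset_closedBall
    · rintro _ rfl
      exact ⟨Metric.mem_ball_self hδ, hlam⟩
  exact countable_coe_iff.mp (TopologicalSpace.separableSpace_iff_countable.mp inferInstance)

/-- Removing a countable set does not disconnect the plane. This lets the identity theorem reach
every eigenvalue from the half-line where the Laplace transform converges. -/
theorem HasIsolatedEigenvalues.isPreconnected_compl_spec (h : HasIsolatedEigenvalues A) :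
    IsPreconnected (spec A)ᶜ :=
  (h.countable_spec.isPathConnected_compl_of_one_lt_rank
    (by rw [Complex.rank_real_complex]; norm_num)).isConnected.isPreconnected

end Holomorphic

/-! ### Operators invertible up to a commuting finite rank operator -/

section FiniteRank

variable {H : Type u} [NormedAddCommGroup H] [InnerProductSpace ℂ H] [CompleteSpace H]
  {T C P : H →L[ℂ] H}

/-- The range of the adjoint is orthogonal to `P.ker`, and `P` is injective on that orthogonal
complement. -/
theorem finiteDimensional_range_adjoint [FiniteDimensional ℂ P.range] :
    FiniteDimensional ℂ (ContinuousLinearMap.adjoint P).range := by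
  have hle : (ContinuousLinearMap.adjoint P).range ≤ P.kerᗮ := by
    rintro _ ⟨z, rfl⟩
    refine (Submodule.mem_orthogonal' _ _).mpr fun k hk => ?_
    have hk' : P k = 0 := hk
    exact (ContinuousLinearMap.adjoint_inner_left P k z).trans (by rw [hk', inner_zero_right])
  let f : P.kerᗮ →ₗ[ℂ] P.range := P.toLinearMap.rangeRestrict.comp P.kerᗮ.subtype
  have hf : Function.Injective f := by
    refine (injective_iff_map_eq_zero f).mpr fun x hx => ?_
    have h1 : P (x : H) = 0 := congrArg Subtype.val hx
    have h2 : ⟪(x : H), x⟫_ℂ = 0 := (Submodule.mem_orthogonal' _ _).mp x.2 _ h1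
    exact Subtype.ext (inner_self_eq_zero.mp h2)
  have : FiniteDimensional ℂ P.kerᗮ := FiniteDimensional.of_injective f hf
  exact Submodule.finiteDimensional_of_le hle

theorem ker_le_range_of_mul_eq (hCT : C * T = 1 - P) : T.ker ≤ P.range := by
  intro x hx
  have h1 : C (T x) = x - P x := congrArg (· x) hCT
  rw [show T x = 0 from hx, map_zero] at h1
  exact ⟨x, (sub_eq_zero.mp h1.symm).symm⟩

theorem finiteDimensional_ker (hCT : C * T = 1 - P) [FiniteDimensional ℂ P.range] :
    FiniteDimensional ℂ T.ker :=
  Submodule.finiteDimensional_of_le (ker_le_range_of_mul_eq hCT)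

/-- `T` preserves the range of `P`, and the kernel of its adjoint embeds in the cokernel of this
finite-dimensional restriction by orthogonal projection: a vector of that kernel orthogonal to
`P.range` is orthogonal to every `x = T (C x) + P x`. Rank-nullity for the restriction bounds the
cokernel by `T.ker`. -/
theorem finrank_ker_adjoint_le (hTC : T * C = 1 - P) (hCT : C * T = 1 - P)
    [FiniteDimensional ℂ P.range] :
    Module.finrank ℂ (ContinuousLinearMap.adjoint T).ker ≤ Module.finrank ℂ T.ker := by
  have hcomm : T * P = P * T := by
    have h1 : P = 1 - T * C := by rw [hTC]; abel
    have h2 : P = 1 - C * T := by rw [hCT]; abel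
    calc T * P = T - T * (C * T) := by rw [h2, mul_sub, mul_one]
      _ = P * T := by rw [h1, sub_mul, one_mul, mul_assoc]
  have hinv : ∀ x ∈ P.range, T x ∈ P.range := by
    rintro _ ⟨y, rfl⟩
    exact ⟨T y, (congrArg (· y) hcomm).symm⟩
  let T₀ : P.range →ₗ[ℂ] P.range := T.toLinearMap.restrict hinv
  have hfdT := finiteDimensional_ker hCT
  let f : (ContinuousLinearMap.adjoint T).ker →ₗ[ℂ] T₀.rangeᗮ :=
    LinearMap.codRestrict _ ((P.range.orthogonalProjectionOnto.toLinearMap).comp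
      (ContinuousLinearMap.adjoint T).ker.subtype) (by
      intro z
      refine (Submodule.mem_orthogonal' _ _).mpr ?_
      rintro _ ⟨w, rfl⟩
      have hz : ContinuousLinearMap.adjoint T (z : H) = 0 := z.2
      have h1 : ⟪(z : H), T w⟫_ℂ = 0 := by
        rw [← ContinuousLinearMap.adjoint_inner_left, hz, inner_zero_left]
      have h2 := Submodule.inner_orthogonalProjectionOnto_eq_of_mem_left (T₀ w) (z : H)
      rw [← inner_conj_symm]
      exact (congrArg conj h2).trans ((inner_conj_symm _ _).trans h1))
  have hf : Function.Injective f := by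
    refine (injective_iff_map_eq_zero f).mpr fun z hz => ?_
    have h0 : P.range.orthogonalProjectionOnto (z : H) = 0 := congrArg Subtype.val hz
    have h1 : ∀ w, ⟪(z : H), P w⟫_ℂ = 0 := by
      intro w
      have h2 := Submodule.inner_orthogonalProjectionOnto_eq_of_mem_left
        (⟨P w, w, rfl⟩ : P.range) (z : H)
      rw [h0, inner_zero_right] at h2
      rw [← inner_conj_symm, show ⟪P w, (z : H)⟫_ℂ = 0 from h2.symm, map_zero]
    have hz' : ContinuousLinearMap.adjoint T (z : H) = 0 := z.2
    refine Subtype.ext (ext_inner_right ℂ fun x => ?_)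
    have h3 : x = T (C x) + P x := by
      have : T (C x) = x - P x := congrArg (· x) hTC
      rw [this]; abel
    rw [h3, inner_add_right, h1, ← ContinuousLinearMap.adjoint_inner_left, hz']
    simp
  have h1 := LinearMap.finrank_le_finrank_of_injective hf
  have h2 := Submodule.finrank_add_finrank_orthogonal T₀.range
  have h3 := T₀.finrank_range_add_finrank_ker
  let g : T₀.ker →ₗ[ℂ] T.ker := LinearMap.codRestrict _
    (P.range.subtype.comp T₀.ker.subtype) (fun w => congrArg Subtype.val w.2)
  have hg : Function.Injective g := by
    refine (injective_iff_map_eq_zero g).mpr fun w hw => ?_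
    exact Subtype.ext (Subtype.ext (congrArg (fun y : T.ker => (y : H)) hw))
  have h4 := LinearMap.finrank_le_finrank_of_injective hg
  omega

theorem finrank_ker_adjoint_eq (hTC : T * C = 1 - P) (hCT : C * T = 1 - P)
    [FiniteDimensional ℂ P.range] :
    FiniteDimensional ℂ (ContinuousLinearMap.adjoint T).ker ∧
      Module.finrank ℂ (ContinuousLinearMap.adjoint T).ker = Module.finrank ℂ T.ker := by
  have := finiteDimensional_range_adjoint (P := P)
  have e : ∀ X Y : H →L[ℂ] H, X * Y = 1 - P → ContinuousLinearMap.adjoint Y *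
      ContinuousLinearMap.adjoint X = 1 - ContinuousLinearMap.adjoint P := by
    intro X Y h
    rw [ContinuousLinearMap.mul_def, ← ContinuousLinearMap.adjoint_comp,
      ← ContinuousLinearMap.mul_def, h, map_sub]
    congr 1
    exact ContinuousLinearMap.adjoint_id
  refine ⟨finiteDimensional_ker (e _ _ hTC), (finrank_ker_adjoint_le hTC hCT).antisymm ?_⟩
  have h1 := finrank_ker_adjoint_le (e _ _ hCT) (e _ _ hTC)
  rwa [ContinuousLinearMap.adjoint_adjoint] at h1

/-- `(1 - P) ^ n = C ^ n * T ^ n` kills `x`, while `(1 - P) ^ n` is the identity modulo the range of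
`P`. Root vectors are thereby caught without proving that `P` is idempotent. -/
theorem mem_range_of_pow_apply_eq_zero (hTC : T * C = 1 - P) (hCT : C * T = 1 - P) {n : ℕ} {x : H}
    (hx : (T ^ n) x = 0) : x ∈ P.range := by
  have h1 : (1 - P) ^ n = C ^ n * T ^ n := by
    rw [← hCT, (show Commute C T from hCT.trans hTC.symm).mul_pow]
  have h2 : ((1 - P) ^ n) x = 0 := by
    rw [h1, mul_apply_eq_comp, hx, map_zero]
  have h3 : ∀ m : ℕ, ∀ y : H, y - ((1 - P) ^ m) y ∈ P.range := by
    intro m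
    induction m with
    | zero => intro y; simp
    | succ m ih =>
      intro y
      have e1 : y - ((1 - P) ^ (m + 1)) y =
          (y - ((1 - P) ^ m) y) + P (((1 - P) ^ m) y) := by
        rw [pow_succ', mul_apply_eq_comp, sub_apply, one_apply_eq_self]
        abel
      rw [e1]
      exact P.range.add_mem (ih y) ⟨_, rfl⟩
  simpa [h2] using h3 n x

end FiniteRank

/-! ### Riesz projections and eigenspaces -/

theorem circleIntegral_comp_comm {E F : Type*} [NormedAddCommGroup E] [NormedSpace ℂ E]
    [CompleteSpace E] [NormedAddCommGroup F] [NormedSpace ℂ F] [CompleteSpace F] (L : E →L[ℂ] F)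
    {f : ℂ → E} {c : ℂ} {r : ℝ} (hf : CircleIntegrable f c r) :
    (∮ z in C(c, r), L (f z)) = L (∮ z in C(c, r), f z) := by
  rw [circleIntegral, circleIntegral, ← L.intervalIntegral_comp_comm hf.out]
  simp

section Riesz

variable {H : Type u} [NormedAddCommGroup H] [InnerProductSpace ℂ H] [CompleteSpace H]
  {A : H →ₗ.[ℂ] H} {μ : ℂ} {R : H →L[ℂ] H}

/-- Formally, `(lam - A)(μ - A)⁻¹ (μ - A)(z - A)⁻¹ = (lam - A)(z - A)⁻¹`. -/
theorem IsResolventAt.shiftOp_mul' {lam z : ℂ} {Q : H →L[ℂ] H} (hR : IsResolventAt A μ R)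
    (hQ : IsResolventAt A z Q) :
    shiftOp R μ lam * (1 + (μ - z) • Q) = 1 - (z - lam) • Q := by
  have h1 : Q - R = (μ - z) • (R * Q) := by
    rw [(hR.commute hQ).eq]; exact hQ.sub_eq hR
  have h2 : shiftOp R μ lam = shiftOp R μ z - (z - lam) • R := by
    rw [shiftOp, shiftOp]; module
  rw [h2, sub_mul, hR.shiftOp_mul hQ, smul_mul_assoc, mul_add, mul_one, mul_smul_comm, ← h1]
  congr 2
  abel

theorem eigSpace_eq_ker_shiftOp (hR : IsResolventAt A μ R) (z : ℂ) :
    eigSpace A z = (shiftOp R μ z).ker := by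
  ext x
  rw [mem_eigSpace, hR.mem_graph_iff, ← sub_smul, map_smul]
  change _ ↔ shiftOp R μ z x = 0
  rw [shiftOp, sub_apply, smul_apply, one_apply_eq_self, sub_eq_zero, eq_comm]

theorem pow_shiftOp_apply_of_mem_kerPow (hR : IsResolventAt A μ R) {lam : ℂ} {n : ℕ} {x : H}
    (hx : x ∈ kerPow A lam n) : (shiftOp R μ lam ^ n) x = 0 := by
  induction n generalizing x with
  | zero => simpa [kerPow] using hx
  | succ n ih =>
    obtain ⟨y, hy, hxy⟩ := hx
    have h1 : shiftOp R μ lam x = R y := by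
      have h2 := hR.apply_eq hxy
      rw [show μ • x - (lam • x - y) = (μ - lam) • x + y by module, map_add, map_smul] at h2
      rw [shiftOp, sub_apply, smul_apply, one_apply_eq_self, sub_eq_iff_eq_add']
      exact h2.symm
    have hc : Commute (shiftOp R μ lam ^ n) R :=
      ((Commute.one_left R).sub_left ((Commute.refl R).smul_left _)).pow_left n
    rw [pow_succ, mul_apply_eq_comp, h1]
    have h3 : (shiftOp R μ lam ^ n) (R y) = R ((shiftOp R μ lam ^ n) y) := congrArg (· y) hc.eq
    rw [h3, ih hy, map_zero]

/-- An isolated eigenvalue of finite algebraic multiplicity has a finite rank operator (its Riesz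
projection) modulo which `lam - A` is invertible. -/
theorem HasIsolatedEigenvalues.exists_riesz (h : HasIsolatedEigenvalues A)
    (hR : IsResolventAt A μ R) {lam : ℂ} (hlam : lam ∈ spec A) :
    ∃ P C : H →L[ℂ] H, FiniteDimensional ℂ P.range ∧
      shiftOp R μ lam * C = 1 - P ∧ C * shiftOp R μ lam = 1 - P ∧ Commute P R ∧
      ∀ z x : H, (∀ w ∉ spec A, ⟪z, resolventOp A w x⟫_ℂ = 0) → ⟪z, P x⟫_ℂ = 0 := by
  obtain ⟨-, δ, hδ, hs, hfin⟩ := h lam hlam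
  have hlamS : lam ∉ Metric.sphere lam δ := by
    rw [Metric.mem_sphere, dist_self]; exact hδ.ne
  have hsph : Metric.sphere lam δ ⊆ (spec A)ᶜ := by
    intro z hz hzs
    have h1 : z ∈ spec A ∩ Metric.closedBall lam δ := ⟨hzs, Metric.sphere_subset_closedBall hz⟩
    rw [hs] at h1
    exact hlamS (mem_singleton_iff.mp h1 ▸ hz)
  have hcont : ContinuousOn (resolventOp A) (Metric.sphere lam δ) :=
    hR.differentiableOn_resolventOp.continuousOn.mono hsph
  have hint : CircleIntegrable (resolventOp A) lam δ := hcont.circleIntegrable hδ.le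
  have hinv : ContinuousOn (fun z => (z - lam)⁻¹) (Metric.sphere lam δ) :=
    ContinuousOn.inv₀ (by fun_prop) fun z hz => by
      rw [sub_ne_zero]; rintro rfl
      exact hlamS hz
  -- `g z` is `(μ - A)(z - A)⁻¹ / (z - lam)`. Its product with `shiftOp R μ lam` is `1 / (z - lam)`
  -- minus the resolvent, whose contour integral is `2πi (1 - P)`; hence the normalized integral of
  -- `g` is the required `C`.
  set g : ℂ → H →L[ℂ] H := fun z => (z - lam)⁻¹ • (1 + (μ - z) • resolventOp A z) with hg
  have hgint : CircleIntegrable g lam δ := by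
    refine ContinuousOn.circleIntegrable hδ.le (hinv.smul (continuousOn_const.add ?_))
    exact ContinuousOn.smul (f := fun z : ℂ => μ - z) (by fun_prop) hcont
  have hπ : (2 * Real.pi * Complex.I : ℂ) ≠ 0 := Complex.two_pi_I_ne_zero
  have h1int : CircleIntegrable (fun z => (z - lam)⁻¹ • (1 : H →L[ℂ] H)) lam δ :=
    (hinv.smul continuousOn_const).circleIntegrable hδ.le
  have key : (∮ z in C(lam, δ), (z - lam)⁻¹ • (1 : H →L[ℂ] H) - resolventOp A z) =
      (2 * Real.pi * Complex.I : ℂ) • (1 - rieszProj A lam δ) := by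
    rw [circleIntegral.integral_sub h1int hint, circleIntegral.integral_smul_const,
      circleIntegral.integral_sub_center_inv _ hδ.ne', smul_sub, rieszProj, smul_smul,
      mul_inv_cancel₀ hπ, one_smul]
  have hpt : ∀ z ∈ Metric.sphere lam δ, shiftOp R μ lam * g z =
      (z - lam)⁻¹ • (1 : H →L[ℂ] H) - resolventOp A z ∧
      g z * shiftOp R μ lam = (z - lam)⁻¹ • (1 : H →L[ℂ] H) - resolventOp A z := by
    intro z hz
    have hQ := isResolventAt_resolventOp (hsph hz)
    have hzl : z - lam ≠ 0 := by
      rw [sub_ne_zero]; rintro rfl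
      exact hlamS hz
    have e1 : shiftOp R μ lam * g z =
        (z - lam)⁻¹ • (1 : H →L[ℂ] H) - resolventOp A z := by
      rw [hg, mul_smul_comm, hR.shiftOp_mul' hQ, smul_sub, smul_smul, inv_mul_cancel₀ hzl,
        one_smul]
    have hc : Commute (shiftOp R μ lam) (g z) :=
      ((Commute.one_left _).sub_left
        (((Commute.one_right _).add_right
          ((hR.commute hQ).smul_right _)).smul_left _)).smul_right _
    exact ⟨e1, hc.eq ▸ e1⟩
  refine ⟨rieszProj A lam δ, (2 * Real.pi * Complex.I : ℂ)⁻¹ • ∮ z in C(lam, δ), g z, hfin,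
    ?_, ?_, ?_, ?_⟩
  · have h1 := circleIntegral_comp_comm (ContinuousLinearMap.mul ℂ _ (shiftOp R μ lam)) hgint
    replace h1 := ((circleIntegral.integral_congr hδ.le fun z hz => (hpt z hz).1).symm.trans h1)
    rw [key] at h1
    rw [mul_smul_comm]
    refine (congrArg _ h1.symm).trans ?_
    rw [smul_smul, inv_mul_cancel₀ hπ, one_smul]
  · have h1 := circleIntegral_comp_comm
      ((ContinuousLinearMap.mul ℂ _).flip (shiftOp R μ lam)) hgint
    replace h1 := ((circleIntegral.integral_congr hδ.le fun z hz => (hpt z hz).2).symm.trans h1)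
    rw [key] at h1
    rw [smul_mul_assoc]
    refine (congrArg _ h1.symm).trans ?_
    rw [smul_smul, inv_mul_cancel₀ hπ, one_smul]
  · have h1 := circleIntegral_comp_comm (ContinuousLinearMap.mul ℂ _ R) hint
    have h2 := circleIntegral_comp_comm ((ContinuousLinearMap.mul ℂ _).flip R) hint
    refine Commute.smul_left ?_ _
    refine h2.symm.trans (Eq.trans ?_ h1)
    refine circleIntegral.integral_congr hδ.le fun z hz => ?_
    exact ((isResolventAt_resolventOp (hsph hz)).commute hR).eq
  · intro z x hzx
    have h1 := circleIntegral_comp_comm ((innerSL ℂ z).comp (ContinuousLinearMap.apply ℂ H x)) hint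
    have h2 : ⟪z, (∮ w in C(lam, δ), resolventOp A w) x⟫_ℂ = 0 := by
      refine h1.symm.trans ?_
      refine (circleIntegral.integral_congr hδ.le (g := fun _ => (0 : ℂ))
        fun w hw => hzx w (hsph hw)).trans ?_
      simp [circleIntegral]
    rw [rieszProj, smul_apply, inner_smul_right, h2, mul_zero]

end Riesz

section Eigen

variable {H : Type u} [NormedAddCommGroup H] [InnerProductSpace ℂ H] [CompleteSpace H]
  {A : H →ₗ.[ℂ] H} {μ : ℝ} {R : H →L[ℂ] H}

theorem adjoint_shiftOp (R : H →L[ℂ] H) (μ : ℝ) (z : ℂ) :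
    ContinuousLinearMap.adjoint (shiftOp R μ z) =
      shiftOp (ContinuousLinearMap.adjoint R) μ (conj z) := by
  rw [shiftOp, shiftOp, map_sub, map_smulₛₗ, map_sub, Complex.conj_ofReal]
  congr 1
  exact ContinuousLinearMap.adjoint_id

theorem HasIsolatedEigenvalues.finrank_eigSpace_adjoint (h : HasIsolatedEigenvalues A)
    (hd : Dense (A.domain : Set H)) (hR : IsResolventAt A μ R) {lam : ℂ} (hlam : lam ∈ spec A) :
    FiniteDimensional ℂ (eigSpace A† (conj lam)) ∧
      Module.finrank ℂ (eigSpace A† (conj lam)) = geomMult A lam := by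
  obtain ⟨P, C, hfin, h1, h2, -⟩ := h.exists_riesz hR hlam
  have hRa : IsResolventAt A† μ (ContinuousLinearMap.adjoint R) := by simpa using hR.adjoint hd
  have h3 := finrank_ker_adjoint_eq h1 h2
  rw [adjoint_shiftOp, ← eigSpace_eq_ker_shiftOp hRa] at h3
  rw [geomMult, eigSpace_eq_ker_shiftOp hR]
  exact h3

/-- At a resolvent point `shiftOp` is surjective, so its adjoint is injective and admits no
eigenvector. -/
theorem conj_mem_spec_of_mem_adjoint_graph (hd : Dense (A.domain : Set H))
    (hR : IsResolventAt A μ R) {lam : ℂ} {x : H} (hx : (x, lam • x) ∈ A†.graph) (hx0 : x ≠ 0) :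
    conj lam ∈ spec A := by
  by_contra hl
  have hu := hR.isUnit_shiftOp hl
  have hRa : IsResolventAt A† μ (ContinuousLinearMap.adjoint R) := by simpa using hR.adjoint hd
  obtain ⟨Q, hQ⟩ := hu.exists_right_inv
  have h1 : ContinuousLinearMap.adjoint (shiftOp R μ (conj lam)) x = 0 := by
    rw [adjoint_shiftOp, Complex.conj_conj]
    have : x ∈ eigSpace A† lam := hx
    rw [eigSpace_eq_ker_shiftOp hRa] at this
    exact this
  apply hx0
  refine ext_inner_right ℂ fun y => ?_
  have h2 : y = shiftOp R μ (conj lam) (Q y) := (congrArg (· y) hQ).symm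
  rw [h2, ← ContinuousLinearMap.adjoint_inner_left, h1, inner_zero_left, inner_zero_left]

end Eigen

/-! ### Unique continuation -/

namespace C0Semigroup

variable {H : Type u} [NormedAddCommGroup H] [InnerProductSpace ℂ H] [CompleteSpace H]
  {S : C0Semigroup H} {A : H →ₗ.[ℂ] H} {ω : ℝ}

/-- On the real half-line beyond `ω` the resolvent is the Laplace transform of the semigroup; the
identity theorem extends the vanishing to the connected resolvent set. -/
theorem IsGenerator.inner_resolventOp_eq_zero (hA : S.IsGenerator A)
    (h : S.AnalyticWithGrowth ω) (h₁ : HasIsolatedEigenvalues A) {z x : H}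
    (hzx : ∀ t, 0 ≤ t → ⟪z, S.real t x⟫_ℂ = 0) {w : ℂ} (hw : w ∉ spec A) :
    ⟪z, resolventOp A w x⟫_ℂ = 0 := by
  have hR := hA.isResolventAt_powNeg_one h (lt_add_one ω)
  have h0 : ∀ c : ℝ, ω < c → ⟪z, resolventOp A c x⟫_ℂ = 0 := by
    intro c hc
    rw [(hA.isResolventAt_powNeg_one h hc).resolventOp_eq, h.powNeg_one_apply hc]
    refine ((innerSL ℂ z).integral_comp_comm (h.integrableOn_apply hc x)).symm.trans ?_
    refine (setIntegral_congr_fun measurableSet_Ioi fun t ht => ?_).trans (integral_zero _ _)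
    change ⟪z, _⟫_ℂ = 0
    rw [← Complex.coe_smul, inner_smul_right, hzx t (le_of_lt ht), mul_zero]
  have hdiff : DifferentiableOn ℂ (fun w => ⟪z, resolventOp A w x⟫_ℂ) (spec A)ᶜ :=
    (((innerSL ℂ z).comp (ContinuousLinearMap.apply ℂ H x)).differentiable.comp_differentiableOn
      hR.differentiableOn_resolventOp)
  refine (hdiff.analyticOnNhd hR.isOpen_compl_spec).eqOn_zero_of_preconnected_of_frequently_eq_zero
    h₁.isPreconnected_compl_spec hR.notMem_spec ?_ hw
  have ht : Tendsto (fun c : ℝ => (c : ℂ)) (𝓝[>] (ω + 1)) (𝓝[≠] ((ω + 1 : ℝ) : ℂ)) := by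
    refine tendsto_nhdsWithin_iff.mpr
      ⟨(Complex.continuous_ofReal.tendsto _).mono_left nhdsWithin_le_nhds, ?_⟩
    filter_upwards [self_mem_nhdsWithin] with c hc
    exact fun hcc => (ne_of_gt hc) (Complex.ofReal_injective hcc)
  refine ht.frequently (Eventually.frequently ?_)
  filter_upwards [self_mem_nhdsWithin] with c hc
  exact h0 c ((lt_add_one ω).trans hc)

/-- The vectors whose orbits under the adjoint semigroup stay orthogonal to `𝓑`. -/
def unobservable (S : C0Semigroup H) (𝓑 : Set H) : Submodule ℂ H where
  carrier := {z | ∀ t, 0 ≤ t → ∀ x ∈ 𝓑, ⟪z, S.real t x⟫_ℂ = 0}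
  zero_mem' _ _ _ _ := inner_zero_left _
  add_mem' ha hb t ht x hx := by rw [inner_add_left, ha t ht x hx, hb t ht x hx, add_zero]
  smul_mem' c _ ha t ht x hx := by rw [inner_smul_left, ha t ht x hx, mul_zero]

theorem IsGenerator.inner_resolventOp_real_eq_zero (hA : S.IsGenerator A)
    (h : S.AnalyticWithGrowth ω) (h₁ : HasIsolatedEigenvalues A) {𝓑 : Set H} {z x : H}
    (hz : z ∈ S.unobservable 𝓑) (hx : x ∈ 𝓑) {t : ℝ} (ht : 0 ≤ t) {w : ℂ} (hw : w ∉ spec A) :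
    ⟪z, resolventOp A w (S.real t x)⟫_ℂ = 0 := by
  refine hA.inner_resolventOp_eq_zero h h₁ (fun s hs => ?_) hw
  have h1 := hz (s + t) (by positivity) x hx
  rwa [real_add hs ht] at h1

/-- If no eigenvector of `A†` is orthogonal to `𝓑`, then no orbit of the adjoint semigroup is. -/
theorem IsGenerator.unobservable_eq_bot (hA : S.IsGenerator A) (h : S.AnalyticWithGrowth ω)
    (h₁ : HasIsolatedEigenvalues A) (h₂ : RootVectorsComplete A) {𝓑 : Set H}
    (hUC : ∀ (ε : H) (lam : ℂ), (ε, lam • ε) ∈ A†.graph → (∀ x ∈ 𝓑, ⟪ε, x⟫_ℂ = 0) → ε = 0) :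
    S.unobservable 𝓑 = ⊥ := by
  have hR := hA.isResolventAt_powNeg_one h (lt_add_one ω)
  have hRa := hA.isResolventAt_adjoint_powNeg_one h (lt_add_one ω)
  set R := S.powNeg (ω + 1) 1
  set Ra := ContinuousLinearMap.adjoint R with hRadef
  have hroot : ∀ z ∈ S.unobservable 𝓑, ∀ lam ∈ spec A, ∀ n, ∀ x ∈ kerPow A lam n,
      ⟪z, x⟫_ℂ = 0 := by
    intro z hz lam hlam n x hx
    obtain ⟨P, C, hfin, hTC, hCT, hPR, hP⟩ := h₁.exists_riesz hR hlam
    set Pa := ContinuousLinearMap.adjoint P with hPa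
    have hfd : FiniteDimensional ℂ Pa.range := finiteDimensional_range_adjoint
    -- The finite-dimensional image of the unobservable space under the adjoint Riesz projection
    -- stays unobservable and is invariant under the adjoint resolvent.
    set N := (S.unobservable 𝓑).map Pa.toLinearMap with hN
    have hNfd : FiniteDimensional ℂ N :=
      Submodule.finiteDimensional_of_le (S₂ := Pa.range) (by
        rintro _ ⟨y, -, rfl⟩; exact ⟨y, rfl⟩)
    have hNM : N ≤ S.unobservable 𝓑 := by
      rintro _ ⟨y, hy, rfl⟩ t ht b hb
      refine (ContinuousLinearMap.adjoint_inner_left P _ y).trans ?_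
      exact hP _ _ fun w hw => hA.inner_resolventOp_real_eq_zero h h₁ hy hb ht hw
    have hNR : ∀ y ∈ N, Ra y ∈ N := by
      rintro _ ⟨y, hy, rfl⟩
      refine ⟨Ra y, ?_, ?_⟩
      · intro t ht b hb
        rw [hRadef, ContinuousLinearMap.adjoint_inner_left, ← hR.resolventOp_eq]
        exact hA.inner_resolventOp_real_eq_zero h h₁ hy hb ht hR.notMem_spec
      · have h3 := congrArg ContinuousLinearMap.adjoint hPR.eq
        rw [ContinuousLinearMap.mul_def, ContinuousLinearMap.mul_def,
          ContinuousLinearMap.adjoint_comp, ContinuousLinearMap.adjoint_comp] at h3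
        exact (congrArg (· y) h3).symm
    have hNbot : N = ⊥ := by
      by_contra hne
      have : Nontrivial N := Submodule.nontrivial_iff_ne_bot.mpr hne
      -- An eigenvector of the adjoint resolvent with eigenvalue `c` is one of `A†` with eigenvalue
      -- `ω + 1 - c⁻¹`; unobservability at time 0 puts it under `hUC`.
      obtain ⟨c, hc⟩ := Module.End.exists_eigenvalue (Ra.toLinearMap.restrict hNR)
      obtain ⟨e, he⟩ := hc.exists_hasEigenvector
      have he1 : Ra (e : H) = c • (e : H) := congrArg Subtype.val he.apply_eq_smul
      have he0 : (e : H) ≠ 0 := fun h0 => he.2 (Subtype.ext h0)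
      have hc0 : c ≠ 0 := by
        rintro rfl
        rw [zero_smul] at he1
        exact he0 (hRa.injective (he1.trans (map_zero Ra).symm))
      refine he0 (hUC e (((ω + 1 : ℝ) : ℂ) - c⁻¹) ?_ fun b hb => ?_)
      · rw [hRa.mem_graph_iff, ← sub_smul, sub_sub_cancel, map_smul, he1, smul_smul,
          inv_mul_cancel₀ hc0, one_smul]
      · have h4 := hNM e.2 0 le_rfl b hb
        rwa [real_zero] at h4
    have hPz : Pa z = 0 := by
      have h5 : Pa z ∈ N := ⟨z, hz, rfl⟩
      rw [hNbot] at h5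
      exact h5
    obtain ⟨y, rfl⟩ := mem_range_of_pow_apply_eq_zero hTC hCT
      (pow_shiftOp_apply_of_mem_kerPow hR hx)
    exact (ContinuousLinearMap.adjoint_inner_left P y z).symm.trans
      ((congrArg (⟪·, y⟫_ℂ) hPz).trans (inner_zero_left _))
  refine (Submodule.eq_bot_iff _).mpr fun z hz => ?_
  refine h₂.eq_zero_of_inner_left ℂ fun v hv => ?_
  have hle : Submodule.span ℂ (⋃ lam ∈ spec A, ⋃ n : ℕ, kerPow A lam n) ≤
      (innerSL ℂ z).ker := by
    refine Submodule.span_le.mpr fun x hx => ?_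
    simp only [mem_iUnion] at hx
    obtain ⟨lam, hlam, n, hx⟩ := hx
    exact hroot z hz lam hlam n x hx
  exact hle hv

end C0Semigroup

/-! ### Riesz representation in the scale of spaces -/

namespace FracDom

variable {H : Type u} [NormedAddCommGroup H] [InnerProductSpace ℂ H] [CompleteSpace H]
  (P : H →L[ℂ] H)

theorem mk_surjective : Function.Surjective (mk P) := by
  rintro ⟨_, z, rfl⟩
  exact ⟨z, rfl⟩

theorem norm_mk_le (z : H) : ‖mk P z‖ ≤ ‖z‖ := by
  have h1 : toQuot P (mk P z) = Submodule.Quotient.mk z :=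
    (P.toLinearMap.quotKerEquivRange.symm_apply_eq).mpr rfl
  have h2 : ‖mk P z‖ = ‖toQuot P (mk P z)‖ := rfl
  rw [h2, h1]
  exact Submodule.Quotient.norm_mk_le _ z

/-- `FracDom.mk` as a bounded operator. -/
def mkL : H →L[ℂ] FracDom P :=
  LinearMap.mkContinuous
    { toFun := mk P
      map_add' := fun x y => Subtype.ext (map_add P x y)
      map_smul' := fun c x => Subtype.ext (map_smul P c x) } 1
    fun z => by rw [one_mul]; exact norm_mk_le P z

theorem mk_smul (c : ℂ) (z : H) : mk P (c • z) = c • mk P z := map_smul (mkL P) c z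

variable {P}

/-- For an injective operator `P`, the isometry `z ↦ P z` onto `FracDom P`. -/
def equiv (hP : Function.Injective P) : H ≃ₗᵢ[ℂ] FracDom P :=
  LinearIsometryEquiv.ofSurjective ⟨(mkL P).toLinearMap, norm_mk P hP⟩ (mk_surjective P)

theorem equiv_symm_mk (hP : Function.Injective P) (z : H) : (equiv hP).symm (mk P z) = z :=
  (equiv hP).symm_apply_apply z

/-- The vector `w` such that `φ (P z) = ⟪z, w⟫`. -/
def rieszVec (φ : FracDom P →L⋆[ℂ] ℂ) : H :=
  (InnerProductSpace.toDual ℂ H).symm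
    { toFun := fun z => conj (φ (mkL P z))
      map_add' := fun x y => by rw [map_add, map_add, map_add]
      map_smul' := fun c x => by
        rw [map_smul, map_smulₛₗ, smul_eq_mul, map_mul, Complex.conj_conj]; rfl
      cont := by fun_prop }

theorem apply_mk (φ : FracDom P →L⋆[ℂ] ℂ) (z : H) : φ (mk P z) = ⟪z, rieszVec φ⟫_ℂ := by
  rw [← inner_conj_symm, rieszVec, InnerProductSpace.toDual_symm_apply]
  exact (Complex.conj_conj _).symm

theorem rieszVec_eq {φ : FracDom P →L⋆[ℂ] ℂ} {w : H} (h : ∀ z, φ (mk P z) = ⟪z, w⟫_ℂ) :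
    rieszVec φ = w :=
  ext_inner_left ℂ fun z => by rw [← apply_mk, h]

theorem rieszVec_sub (φ ψ : FracDom P →L⋆[ℂ] ℂ) :
    rieszVec (φ - ψ) = rieszVec φ - rieszVec ψ :=
  rieszVec_eq fun z => by rw [inner_sub_right, ← apply_mk, ← apply_mk]; rfl

/-- The functional `P z ↦ ⟪z, w⟫`. -/
def ofVec (hP : Function.Injective P) (w : H) : FracDom P →L⋆[ℂ] ℂ :=
  ((innerSL ℂ).flip w).comp ((equiv hP).symm.toContinuousLinearEquiv : FracDom P →L[ℂ] H)

theorem ofVec_mk (hP : Function.Injective P) (w z : H) : ofVec hP w (mk P z) = ⟪z, w⟫_ℂ := by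
  change ⟪(equiv hP).symm (mk P z), w⟫_ℂ = _
  rw [equiv_symm_mk]

theorem rieszVec_ofVec (hP : Function.Injective P) (w : H) : rieszVec (ofVec hP w) = w :=
  rieszVec_eq (ofVec_mk hP w)

theorem ofVec_rieszVec (hP : Function.Injective P) (φ : FracDom P →L⋆[ℂ] ℂ) :
    ofVec hP (rieszVec φ) = φ := by
  ext ε
  obtain ⟨z, rfl⟩ := mk_surjective P ε
  rw [ofVec_mk, apply_mk]

theorem norm_rieszVec (hP : Function.Injective P) (φ : FracDom P →L⋆[ℂ] ℂ) :
    ‖rieszVec φ‖ = ‖φ‖ := by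
  refine le_antisymm ?_ (φ.opNorm_le_bound (norm_nonneg _) fun ε => ?_)
  · set w := rieszVec φ with hw
    rcases eq_or_ne ‖w‖ 0 with h0 | h0
    · rw [h0]; exact norm_nonneg _
    have h1 : ‖φ (mk P w)‖ ≤ ‖φ‖ * ‖w‖ := by
      rw [← norm_mk P hP w]; exact φ.le_opNorm _
    rw [apply_mk, ← hw, inner_self_eq_norm_sq_to_K, norm_pow, RCLike.norm_ofReal,
      abs_norm, pow_two] at h1
    exact le_of_mul_le_mul_right h1 ((norm_nonneg w).lt_of_ne' h0)
  · obtain ⟨z, rfl⟩ := mk_surjective P ε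
    rw [apply_mk, norm_mk P hP, mul_comm]
    exact norm_inner_le_norm _ _

end FracDom

namespace C0Semigroup

open FracDom

variable {H : Type u} [NormedAddCommGroup H] [InnerProductSpace ℂ H] [CompleteSpace H]
  {S : C0Semigroup H} {A : H →ₗ.[ℂ] H} {ω μ γ : ℝ}

theorem IsGenerator.powNegAdj_injective (hA : S.IsGenerator A) (h : S.AnalyticWithGrowth ω)
    (hμ : ω < μ) {α : ℝ} (hα : α ∈ Icc (0 : ℝ) 1) : Function.Injective (S.powNegAdj μ α) := by
  rw [h.powNegAdj_eq hμ hα.1]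
  exact hA.adjoint_powNeg_injective h hμ hα

theorem AnalyticWithGrowth.powNegAdj_inner_left (h : S.AnalyticWithGrowth ω) (hμ : ω < μ)
    {α : ℝ} (hα : 0 ≤ α) (x y : H) : ⟪S.powNegAdj μ α x, y⟫_ℂ = ⟪x, S.powNeg μ α y⟫_ℂ := by
  rw [h.powNegAdj_eq hμ hα, ContinuousLinearMap.adjoint_inner_left]

theorem AnalyticWithGrowth.powNegAdj_powNegAdj (h : S.AnalyticWithGrowth ω) (hμ : ω < μ)
    {α β : ℝ} (hα : 0 ≤ α) (hβ : 0 ≤ β) (x : H) :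
    S.powNegAdj μ α (S.powNegAdj μ β x) = S.powNegAdj μ (α + β) x := by
  refine ext_inner_right ℂ fun y => ?_
  rw [h.powNegAdj_inner_left hμ hα, h.powNegAdj_inner_left hμ hβ,
    h.powNegAdj_inner_left hμ (by positivity), add_comm α, ← h.powNeg_mul_powNeg hμ hβ hα]
  rfl

/-- The elements of `H_{1/2-γ}` in `H_{-γ}` are those represented by `(μ - A)^{-1/2} w`, and
their norm is `‖w‖`. -/
theorem IsGenerator.scaleNorm_spec (hA : S.IsGenerator A) (h : S.AnalyticWithGrowth ω)
    (hμ : ω < μ) (hγ : γ ∈ Ico (0 : ℝ) 1) (φ : S.HNeg μ γ) :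
    (∀ w, rieszVec φ = S.powNeg μ (1 / 2) w → S.scaleNorm μ γ (1 / 2 - γ) φ ≤ ‖w‖ₑ) ∧
    (∀ c, S.scaleNorm μ γ (1 / 2 - γ) φ < c →
      ∃ w, rieszVec φ = S.powNeg μ (1 / 2) w ∧ ‖w‖ₑ < c) := by
  have henorm : ∀ {F F' : Type u} [NormedAddCommGroup F] [NormedAddCommGroup F'] {x : F}
      {y : F'}, ‖x‖ = ‖y‖ → ‖x‖ₑ = ‖y‖ₑ := by
    intro F F' _ _ x y hxy
    rw [← ofReal_norm, ← ofReal_norm, hxy]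
  unfold scaleNorm
  split_ifs with hα
  · have hP := hA.powNeg_injective h hμ (α := 1 / 2 - γ) ⟨hα, by linarith [hγ.1]⟩
    have hmul := h.powNeg_mul_powNeg hμ hγ.1 hα
    rw [add_sub_cancel] at hmul
    -- In the pairing, the power `γ` moves from the test vector to the other side and adds up with
    -- `1 / 2 - γ` to `1 / 2`.
    have hiff : ∀ w, (∀ ε : S.HStar μ γ,
        φ ε = ⟪incl _ ε, incl _ (FracDom.mk (S.powNeg μ (1 / 2 - γ)) w)⟫_ℂ) ↔
        rieszVec φ = S.powNeg μ (1 / 2) w := by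
      intro w
      have e : ∀ z, ⟪incl _ (FracDom.mk (S.powNegAdj μ γ) z),
          incl _ (FracDom.mk (S.powNeg μ (1 / 2 - γ)) w)⟫_ℂ = ⟪z, S.powNeg μ (1 / 2) w⟫_ℂ := by
        intro z
        rw [incl_mk, incl_mk, h.powNegAdj_inner_left hμ hγ.1, ← hmul]; rfl
      constructor
      · intro h1
        exact rieszVec_eq fun z => (h1 _).trans (e z)
      · intro h1 ε
        obtain ⟨z, rfl⟩ := mk_surjective _ ε
        rw [e, apply_mk, h1]
    constructor
    · intro w hw
      exact (iInf₂_le (FracDom.mk _ w) ((hiff w).mpr hw)).trans_eq (henorm (norm_mk _ hP w))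
    · intro c hc
      obtain ⟨x, hx'⟩ := iInf_lt_iff.mp hc
      obtain ⟨hx, hxc⟩ := iInf_lt_iff.mp hx'
      obtain ⟨w, rfl⟩ := mk_surjective _ x
      exact ⟨w, (hiff w).mp hx, (henorm (norm_mk _ hP w)) ▸ hxc⟩
  · rw [not_le] at hα
    have hα' : (0 : ℝ) ≤ -(1 / 2 - γ) := by linarith
    have hQ := hA.powNegAdj_injective h hμ (α := -(1 / 2 - γ)) ⟨hα', by linarith [hγ.2]⟩
    -- Here `γ > 1 / 2`, and the inclusion of `H*_γ` in `H*_{γ-1/2}` acts on the representing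
    -- vectors as the adjoint power `1 / 2`.
    have hmul : ∀ z, S.powNegAdj μ γ z =
        S.powNegAdj μ (-(1 / 2 - γ)) (S.powNegAdj μ (1 / 2) z) := by
      intro z
      rw [h.powNegAdj_powNegAdj hμ hα' (by norm_num)]
      congr 2
      ring
    have hhalf : (0 : ℝ) ≤ 1 / 2 := by norm_num
    constructor
    · intro w hw
      refine (iInf₂_le (ofVec hQ w) fun ε η hεη => ?_).trans_eq
        (henorm ((norm_rieszVec hQ _).symm.trans (by rw [rieszVec_ofVec])))
      obtain ⟨z, rfl⟩ := mk_surjective _ ε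
      obtain ⟨z', rfl⟩ := mk_surjective _ η
      rw [incl_mk, incl_mk, hmul] at hεη
      rw [ofVec_mk, ← hQ hεη, h.powNegAdj_inner_left hμ hhalf, ← hw, apply_mk]
    · intro c hc
      obtain ⟨ψ, hψ'⟩ := iInf_lt_iff.mp hc
      obtain ⟨hψ, hψc⟩ := iInf_lt_iff.mp hψ'
      refine ⟨rieszVec ψ, rieszVec_eq fun z => ?_, (henorm (norm_rieszVec hQ ψ)).trans_lt hψc⟩
      rw [hψ _ (FracDom.mk _ (S.powNegAdj μ (1 / 2) z)) (hmul z), apply_mk,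
        h.powNegAdj_inner_left hμ hhalf]

theorem IsGenerator.scaleNorm_eq (hA : S.IsGenerator A) (h : S.AnalyticWithGrowth ω)
    (hμ : ω < μ) (hγ : γ ∈ Ico (0 : ℝ) 1) {φ : S.HNeg μ γ} {w : H}
    (hw : rieszVec φ = S.powNeg μ (1 / 2) w) : S.scaleNorm μ γ (1 / 2 - γ) φ = ‖w‖ₑ := by
  obtain ⟨h1, h2⟩ := hA.scaleNorm_spec h hμ hγ φ
  refine le_antisymm (h1 w hw) (not_lt.mp fun hlt => ?_)
  obtain ⟨w', hw', hlt'⟩ := h2 _ hlt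
  rw [hA.powNeg_injective h hμ (by norm_num) (hw'.symm.trans hw)] at hlt'
  exact lt_irrefl _ hlt'

theorem IsGenerator.exists_of_scaleNorm_lt_top (hA : S.IsGenerator A)
    (h : S.AnalyticWithGrowth ω) (hμ : ω < μ) (hγ : γ ∈ Ico (0 : ℝ) 1) {φ : S.HNeg μ γ}
    (hφ : S.scaleNorm μ γ (1 / 2 - γ) φ < ∞) : ∃ w, rieszVec φ = S.powNeg μ (1 / 2) w :=
  ((hA.scaleNorm_spec h hμ hγ φ).2 _ hφ).imp fun _ hw => hw.1

/-- Graph of `A†` on `H*_γ`. -/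
theorem IsGenerator.incl_mk_mem_adjoint_graph_iff (hA : S.IsGenerator A)
    (h : S.AnalyticWithGrowth ω) (hμ : ω < μ) (hγ : γ ∈ Ico (0 : ℝ) 1) {x y : H} :
    (incl _ (FracDom.mk (S.powNegAdj μ γ) x), incl _ (FracDom.mk (S.powNegAdj μ γ) y)) ∈ A†.graph ↔
      (x, y) ∈ A†.graph := by
  rw [incl_mk, incl_mk, h.powNegAdj_eq hμ hγ.1]
  exact hA.adjoint_powNeg_mem_graph_iff h hμ ⟨hγ.1, hγ.2.le⟩

end C0Semigroup

/-! ### Approximate controllability and eigenvectors of the adjoint -/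

theorem eq_mul_exp_of_eq_integral {g : ℝ → ℂ} {a c : ℂ} {τ : ℝ} (hg : ContinuousOn g (Icc 0 τ))
    (h : ∀ t ∈ Icc 0 τ, g t = a + ∫ s in (0 : ℝ)..t, c * g s) :
    ∀ t ∈ Icc 0 τ, g t = a * Complex.exp (c * t) := by
  intro t₀ ht₀
  have hτ : 0 ≤ τ := ht₀.1.trans ht₀.2
  -- A continuous extension to the whole line makes the integral differentiable at the endpoints
  -- too.
  set G : ℝ → ℂ := IccExtend hτ ((Icc 0 τ).domRestrict g) with hG
  have hGc : Continuous G := (continuousOn_iff_continuous_domRestrict.mp hg).Icc_extend'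
  have hGg : ∀ t ∈ Icc 0 τ, G t = g t := fun t ht => by
    rw [hG, IccExtend_of_mem hτ _ ht]; rfl
  have hGi : ∀ t ∈ Icc 0 τ, G t = a + ∫ s in (0 : ℝ)..t, c * G s := by
    intro t ht
    rw [hGg t ht, h t ht]
    congr 1
    refine intervalIntegral.integral_congr fun s hs => ?_
    rw [uIcc_of_le ht.1] at hs
    simp only [hGg s ⟨hs.1, hs.2.trans ht.2⟩]
  have hcc : Continuous fun s => c * G s := hGc.const_mul c
  have hd : ∀ t, HasDerivAt (fun t : ℝ => (a + ∫ s in (0 : ℝ)..t, c * G s) *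
      Complex.exp (-(c * t))) (c * G t * Complex.exp (-(c * t)) +
        (a + ∫ s in (0 : ℝ)..t, c * G s) * (Complex.exp (-(c * t)) * -(c * 1))) t := by
    intro t
    refine HasDerivAt.mul ?_ ?_
    · exact (intervalIntegral.integral_hasDerivAt_right (hcc.intervalIntegrable _ _)
        (hcc.stronglyMeasurableAtFilter _ _) hcc.continuousAt).const_add a
    · exact ((Complex.ofRealCLM.hasDerivAt (x := t)).const_mul c).neg.cexp
  have hconst := constant_of_has_deriv_right_zero (a := 0) (b := τ)
    (fun t _ => (hd t).continuousAt.continuousWithinAt) (fun t ht => by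
      refine (hd t).hasDerivWithinAt.congr_deriv ?_
      rw [← hGi t ⟨ht.1, ht.2.le⟩]
      ring) t₀ ht₀
  simp only [intervalIntegral.integral_same, Complex.ofReal_zero, mul_zero, neg_zero,
    Complex.exp_zero, add_zero, mul_one] at hconst
  rw [← hGi t₀ ht₀, hGg t₀ ht₀, Complex.exp_neg] at hconst
  rw [← hconst, mul_assoc, inv_mul_cancel₀ (Complex.exp_ne_zero _), mul_one]

namespace C0Semigroup

open FracDom

/-! ### From a finite time interval to all times -/

section Continuation

variable {H : Type u} [NormedAddCommGroup H] [InnerProductSpace ℂ H] [CompleteSpace H]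
  {S : C0Semigroup H} {ω μ τ : ℝ}

/-- With `f t = ⟪z, e^{tA} x⟫` the hypothesis reads `f = f 0 + μ ∫ f` on `[0, τ]`, so `f` is `f 0 *
exp (μ t)` there, and for all `t > 0` by analyticity. Since `f` grows at most like `exp (ω t)` with
`ω < μ`, `f 0 = 0`. -/
theorem AnalyticWithGrowth.inner_real_eq_zero (h : S.AnalyticWithGrowth ω) (hμ : ω < μ)
    (hτ : 0 < τ) {z x : H} (hs : ∀ s ∈ Icc 0 τ, ⟪z, S.orbitLift μ x s⟫_ℂ = 0) {t : ℝ}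
    (ht : 0 ≤ t) : ⟪z, S.real t x⟫_ℂ = 0 := by
  set f : ℝ → ℂ := fun t => ⟪z, S.real t x⟫_ℂ with hf
  have hfc : Continuous f := continuous_const.inner (h.analytic.continuous_apply x)
  have h1 : ∀ s ∈ Icc 0 τ, f s = ⟪z, x⟫_ℂ * Complex.exp (μ * s) := by
    refine eq_mul_exp_of_eq_integral hfc.continuousOn fun s hsτ => ?_
    have e1 := hs s hsτ
    have e2 : ⟪z, S.orbitIntegral x s⟫_ℂ = ∫ r in (0 : ℝ)..s, f r :=
      ((innerSL ℂ z).intervalIntegral_comp_comm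
        ((h.analytic.continuous_apply x).intervalIntegrable _ _)).symm
    rw [orbitLift, inner_add_right, inner_sub_right, inner_smul_right, e2,
      ← intervalIntegral.integral_const_mul] at e1
    linear_combination -e1
  have han : AnalyticOnNhd ℝ (fun s => f s - ⟪z, x⟫_ℂ * Complex.exp (μ * s)) (Ioi 0) := by
    intro s hs
    refine AnalyticAt.sub ?_ (analyticAt_const.mul ?_)
    · exact ((((innerSL ℂ z).comp (ContinuousLinearMap.apply ℂ H x)).restrictScalars
        ℝ).analyticAt _).comp (h.analytic.analyticAt hs)
    · exact (analyticAt_cexp.restrictScalars (𝕜 := ℝ)).comp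
        (analyticAt_const.mul (Complex.ofRealCLM.analyticAt s))
  have h2 : ∀ s : ℝ, 0 < s → f s = ⟪z, x⟫_ℂ * Complex.exp (μ * s) := by
    intro s hs
    refine sub_eq_zero.mp (han.eqOn_zero_of_preconnected_of_eventuallyEq_zero
      isPreconnected_Ioi (z₀ := τ / 2) (half_pos hτ) ?_ hs)
    filter_upwards [Icc_mem_nhds (half_pos hτ) (half_lt_self hτ)] with r hr
    exact sub_eq_zero.mpr (h1 r hr)
  obtain ⟨M, hM, hbound⟩ := h.bound
  have h3 : ⟪z, x⟫_ℂ = 0 := by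
    have h4 : ∀ s : ℝ, 0 < s → ‖⟪z, x⟫_ℂ‖ ≤ ‖z‖ * (M * ‖x‖) * Real.exp (-((μ - ω) * s)) := by
      intro s hs
      have e1 : ‖f s‖ ≤ ‖z‖ * (M * Real.exp (ω * s) * ‖x‖) :=
        (norm_inner_le_norm _ _).trans (mul_le_mul_of_nonneg_left
          ((S.real s).le_of_opNorm_le (hbound s hs.le) x) (norm_nonneg z))
      rw [h2 s hs, norm_mul, ← Complex.ofReal_mul, ← Complex.ofReal_exp, Complex.norm_real,
        Real.norm_of_nonneg (Real.exp_pos _).le, ← le_div_iff₀ (Real.exp_pos _)] at e1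
      refine e1.trans_eq ?_
      have e2 : Real.exp (-((μ - ω) * s)) = Real.exp (ω * s) / Real.exp (μ * s) := by
        rw [← Real.exp_sub]; ring_nf
      rw [e2]
      ring
    have h5 : Tendsto (fun s : ℝ => ‖z‖ * (M * ‖x‖) * Real.exp (-((μ - ω) * s))) atTop
        (𝓝 (‖z‖ * (M * ‖x‖) * 0)) := by
      refine Tendsto.const_mul _ (Real.tendsto_exp_neg_atTop_nhds_zero.comp ?_)
      exact tendsto_id.const_mul_atTop (sub_pos.mpr hμ)
    rw [mul_zero] at h5
    exact norm_le_zero_iff.mp (ge_of_tendsto h5 ((eventually_gt_atTop 0).mono h4))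
  rcases ht.eq_or_lt with rfl | ht
  · rw [real_zero]; exact h3
  · exact (h2 t ht).trans (by rw [h3, zero_mul])

end Continuation

/-! ### Lifted solutions, reachable states and the controllability criterion -/

variable {H : Type u} [NormedAddCommGroup H] [InnerProductSpace ℂ H] [CompleteSpace H]
  {S : C0Semigroup H} {A : H →ₗ.[ℂ] H} {ω μ γ τ : ℝ}
  {E : Type v} [NormedAddCommGroup E] [NormedSpace ℂ E] {B : E →L[ℂ] S.HNeg μ γ}

/-- `t ↦ (μ - A)^{1/2} w(t)` solves `Y' = A Y + (μ - A)^{-γ} B u` in the weak sense. -/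
structure IsLift (S : C0Semigroup H) (A : H →ₗ.[ℂ] H) (μ γ τ : ℝ) (B : E →L[ℂ] S.HNeg μ γ)
    (u : ℝ → E) (w : ℝ → H) : Prop where
  memLp : MemLp u 2 (volume.restrict (Ioo 0 τ))
  cont : ContinuousOn w (Icc 0 τ)
  eqn : ∀ z z' : H, (z, z') ∈ A†.graph → ∀ t ∈ Icc 0 τ,
    ⟪z, S.powNeg μ (1 / 2) (w t)⟫_ℂ = ⟪z, S.powNeg μ (1 / 2) (w 0)⟫_ℂ +
      ∫ s in (0 : ℝ)..t, (⟪z', S.powNeg μ (1 / 2) (w s)⟫_ℂ +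
        B (u s) (FracDom.mk (S.powNegAdj μ γ) z))

theorem intervalIntegrable_weak {u : ℝ → E} {w : ℝ → H}
    (hu : MemLp u 2 (volume.restrict (Ioo 0 τ))) (hw : ContinuousOn w (Icc 0 τ)) (P : H →L[ℂ] H)
    (z' : H) (ε : S.HStar μ γ) {t : ℝ} (ht : t ∈ Icc 0 τ) :
    IntervalIntegrable (fun s => ⟪z', P (w s)⟫_ℂ + B (u s) ε) volume 0 t := by
  refine IntervalIntegrable.add ?_ ?_
  · refine ContinuousOn.intervalIntegrable ?_
    rw [uIcc_of_le ht.1]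
    exact continuousOn_const.inner
      (P.continuous.comp_continuousOn (hw.mono (Icc_subset_Icc_right ht.2)))
  · rw [intervalIntegrable_iff_integrableOn_Ioo_of_le ht.1]
    have h1 : IntegrableOn u (Ioo 0 τ) := hu.integrable (by norm_num)
    have h2 : IntegrableOn (fun s => B (u s) ε) (Ioo 0 τ) :=
      ((ContinuousLinearMap.apply' ℂ (starRingEnd ℂ) ε).comp B).integrable_comp h1
    exact h2.mono_set (Ioo_subset_Ioo_right ht.2)

theorem IsLift.add_smul {u₁ u₂ : ℝ → E} {w₁ w₂ : ℝ → H} (h₁ : IsLift S A μ γ τ B u₁ w₁)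
    (h₂ : IsLift S A μ γ τ B u₂ w₂) (c : ℂ) :
    IsLift S A μ γ τ B (fun t => u₁ t + c • u₂ t) (fun t => w₁ t + c • w₂ t) where
  memLp := h₁.memLp.add (h₂.memLp.const_smul c)
  cont := h₁.cont.add (h₂.cont.const_smul c)
  eqn z z' hz t ht := by
    have i₁ := intervalIntegrable_weak (B := B) h₁.memLp h₁.cont (S.powNeg μ (1 / 2)) z'
      (FracDom.mk _ z) ht
    have i₂ := intervalIntegrable_weak (B := B) h₂.memLp h₂.cont (S.powNeg μ (1 / 2)) z'
      (FracDom.mk _ z) ht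
    have e₁ := h₁.eqn z z' hz t ht
    have e₂ := h₂.eqn z z' hz t ht
    have e₃ := intervalIntegral.integral_add i₁ (i₂.const_mul c)
    rw [intervalIntegral.integral_const_mul] at e₃
    simp only [map_add, map_smul, inner_add_right, inner_smul_right, e₁, e₂, add_apply, smul_apply,
      smul_eq_mul]
    rw [mul_add, add_add_add_comm, ← e₃]
    congr 1
    refine intervalIntegral.integral_congr fun s _ => ?_
    ring

theorem IsGenerator.isLift_real (hA : S.IsGenerator A) (h : S.AnalyticWithGrowth ω) (hμ : ω < μ)
    (w₀ : H) : IsLift S A μ γ τ B (fun _ => 0) (fun t => S.real t w₀) where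
  memLp := MemLp.zero
  cont := (h.analytic.continuous_apply w₀).continuousOn
  eqn z z' hz t ht := by
    have hc : ∀ s, S.powNeg μ (1 / 2) (S.real s w₀) = S.real s (S.powNeg μ (1 / 2) w₀) :=
      fun s => congrArg (· w₀) (h.powNeg_commute_real hμ (by norm_num) s).eq
    have h1 := hA.inner_real_sub h hz (S.powNeg μ (1 / 2) w₀) ht.1
    simp only [hc, map_zero, zero_apply, add_zero, real_zero]
    rw [← sub_eq_iff_eq_add']
    refine h1.trans ?_
    exact ((innerSL ℂ z').intervalIntegral_comp_comm
      ((h.analytic.continuous_apply _).intervalIntegrable _ _)).symm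

/-- The response to a control which is constant on `[0, b]`, and then vanishes. -/
theorem IsGenerator.isLift_step (hA : S.IsGenerator A) (h : S.AnalyticWithGrowth ω) (hμ : ω < μ)
    {b : ℝ} (hb : b ∈ Icc 0 τ) (e : E) :
    IsLift S A μ γ τ B (fun s => if s ≤ b then e else 0) (fun t => S.powNeg μ (1 / 2)
      (S.orbitLift μ (rieszVec (B e)) t - S.orbitLift μ (rieszVec (B e)) (max (t - b) 0))) := by
  set x := rieszVec (B e) with hx
  have hmul : ∀ y, S.powNeg μ (1 / 2) (S.powNeg μ (1 / 2) y) = S.powNeg μ 1 y := by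
    intro y
    have := h.powNeg_mul_powNeg hμ (α := 1 / 2) (β := 1 / 2) (by norm_num) (by norm_num)
    rw [add_halves] at this
    exact congrArg (· y) this
  have hR := hA.isResolventAt_powNeg_one h hμ
  -- Two half powers make the resolvent, which undoes the lift: what remains is Duhamel's formula
  -- for a step control.
  have hP : ∀ t, 0 ≤ t → S.powNeg μ (1 / 2) (S.powNeg μ (1 / 2)
      (S.orbitLift μ x t - S.orbitLift μ x (max (t - b) 0))) =
      S.orbitIntegral x t - S.orbitIntegral x (max (t - b) 0) := by
    intro t ht
    rw [hmul, map_sub, hA.resolvent_orbitLift h.analytic hR x ht,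
      hA.resolvent_orbitLift h.analytic hR x (le_max_right _ _)]
  have hmem : MemLp (fun s : ℝ => if s ≤ b then e else 0) 2 (volume.restrict (Ioo 0 τ)) := by
    have : (fun s : ℝ => if s ≤ b then e else 0) = (Iic b).indicator fun _ => e := by
      ext s; simp [indicator]
    rw [this]
    exact (memLp_const e).indicator measurableSet_Iic
  have hcont : ContinuousOn (fun t => S.powNeg μ (1 / 2)
      (S.orbitLift μ x t - S.orbitLift μ x (max (t - b) 0))) (Icc 0 τ) := by
    have := h.analytic.continuous_orbitLift (μ := μ) x
    exact Continuous.continuousOn (by fun_prop)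
  refine ⟨hmem, hcont, fun z z' hz t ht => ?_⟩
  have hint := fun {t : ℝ} (ht : t ∈ Icc 0 τ) => intervalIntegrable_weak (B := B) hmem hcont
    (S.powNeg μ (1 / 2)) z' (FracDom.mk _ z) ht
  set f : ℝ → ℂ := fun s => ⟪z, S.real s x⟫_ℂ with hf
  have hfc : Continuous f := continuous_const.inner (h.analytic.continuous_apply x)
  have hV : ∀ t, ⟪z, S.orbitIntegral x t⟫_ℂ = ∫ s in (0 : ℝ)..t, f s := fun t =>
    ((innerSL ℂ z).intervalIntegral_comp_comm
      ((h.analytic.continuous_apply x).intervalIntegrable _ _)).symm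
  set k : ℝ → ℂ := fun s => ⟪z', S.powNeg μ (1 / 2) (S.powNeg μ (1 / 2)
      (S.orbitLift μ x s - S.orbitLift μ x (max (s - b) 0)))⟫_ℂ +
        B (if s ≤ b then e else 0) (FracDom.mk (S.powNegAdj μ γ) z) with hk
  -- The integrand of the weak equation is `f s` while the control acts and `f s - f (s - b)`
  -- afterwards; a translation in the integral then closes the computation.
  have hk1 : ∀ s, 0 ≤ s → s ≤ b → k s = f s := by
    intro s hs hsb
    have e1 := hA.inner_real_sub h hz x hs
    simp only [hk]
    rw [hP s hs, if_pos hsb, max_eq_right (by linarith), orbitIntegral_zero, sub_zero, apply_mk,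
      ← e1, ← hx]
    simp [hf]
  have hk2 : ∀ s, b < s → k s = f s - f (s - b) := by
    intro s hs
    have hs0 : 0 ≤ s - b := by linarith
    have e1 := hA.inner_real_sub h hz x (hb.1.trans hs.le)
    have e2 := hA.inner_real_sub h hz x hs0
    simp only [hk]
    rw [hP s (hb.1.trans hs.le), if_neg hs.not_ge, max_eq_left hs0, map_zero, inner_sub_right,
      ← e1, ← e2]
    simp [hf]
  rw [hP t ht.1]
  have h0 : S.powNeg μ (1 / 2) (S.powNeg μ (1 / 2)
      (S.orbitLift μ x 0 - S.orbitLift μ x (max (0 - b) 0))) = 0 := by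
    rw [hP 0 le_rfl, max_eq_right (by linarith [hb.1]), sub_self]
  rw [h0, inner_zero_right, zero_add, inner_sub_right, hV, hV]
  rcases le_or_gt t b with htb | htb
  · rw [max_eq_right (by linarith), intervalIntegral.integral_same, sub_zero]
    refine intervalIntegral.integral_congr fun s hs => ?_
    rw [uIcc_of_le ht.1] at hs
    exact (hk1 s hs.1 (hs.2.trans htb)).symm
  · rw [max_eq_left (by linarith)]
    have e1 : ∫ s in (0 : ℝ)..b, k s = ∫ s in (0 : ℝ)..b, f s := by
      refine intervalIntegral.integral_congr fun s hs => ?_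
      rw [uIcc_of_le hb.1] at hs
      exact hk1 s hs.1 hs.2
    have e2 : ∫ s in b..t, k s = ∫ s in b..t, (f s - f (s - b)) := by
      rw [intervalIntegral.integral_of_le htb.le, intervalIntegral.integral_of_le htb.le]
      exact setIntegral_congr_fun measurableSet_Ioc fun s hs => hk2 s hs.1
    have hfb : Continuous fun s => f (s - b) := by fun_prop
    rw [← intervalIntegral.integral_add_adjacent_intervals (hint hb)
      ((hint hb).symm.trans (hint ht))]
    refine Eq.trans ?_ (congrArg₂ (· + ·) e1.symm e2.symm)
    rw [intervalIntegral.integral_sub (hfc.intervalIntegrable _ _) (hfb.intervalIntegrable _ _),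
      intervalIntegral.integral_comp_sub_right, sub_self, ← add_sub_assoc,
      intervalIntegral.integral_add_adjacent_intervals (hfc.intervalIntegrable _ _)
        (hfc.intervalIntegrable _ _)]

/-- The lifted states that can be reached from `0` by controls with values in `W`. -/
def reachable (S : C0Semigroup H) (A : H →ₗ.[ℂ] H) (μ γ τ : ℝ) (B : E →L[ℂ] S.HNeg μ γ)
    (W : Submodule ℂ E) (h0 : IsLift S A μ γ τ B (fun _ => 0) (fun _ => 0)) :
    Submodule ℂ H where
  carrier := {v | ∃ u w, IsLift S A μ γ τ B u w ∧ (∀ t, u t ∈ W) ∧ w 0 = 0 ∧ w τ = v}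
  zero_mem' := ⟨_, _, h0, fun _ => W.zero_mem, rfl, rfl⟩
  add_mem' := by
    rintro _ _ ⟨u₁, w₁, h₁, hu₁, h₁', rfl⟩ ⟨u₂, w₂, h₂, hu₂, h₂', rfl⟩
    refine ⟨_, _, h₁.add_smul h₂ 1, fun t => W.add_mem (hu₁ t) (W.smul_mem _ (hu₂ t)), ?_, ?_⟩
    · simp [h₁', h₂']
    · simp
  smul_mem' := by
    rintro c _ ⟨u₁, w₁, h₁, hu₁, h₁', rfl⟩
    refine ⟨_, _, h0.add_smul h₁ c, fun t => W.add_mem W.zero_mem (W.smul_mem _ (hu₁ t)), ?_, ?_⟩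
    · simp [h₁']
    · simp

/-- Density of the reachable states. -/
theorem IsGenerator.reachable_dense (hA : S.IsGenerator A) (h : S.AnalyticWithGrowth ω)
    (hμ : ω < μ) (h₁ : HasIsolatedEigenvalues A) (h₂ : RootVectorsComplete A) (hτ : 0 < τ)
    {W : Submodule ℂ E}
    (hUC : ∀ (z : H) (lam : ℂ), (z, lam • z) ∈ A†.graph →
      (∀ e ∈ W, B e (FracDom.mk (S.powNegAdj μ γ) z) = 0) → z = 0)
    (h0 : IsLift S A μ γ τ B (fun _ => 0) (fun _ => 0)) :
    (S.reachable A μ γ τ B W h0).topologicalClosure = ⊤ := by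
  rw [Submodule.topologicalClosure_eq_top_iff]
  refine (Submodule.eq_bot_iff _).mpr fun z hz => ?_
  rw [Submodule.mem_orthogonal'] at hz
  set z' := ContinuousLinearMap.adjoint (S.powNeg μ (1 / 2)) z with hz'
  -- Orthogonality to the step control of length `b`. The choice `b = τ` shows that the common value
  -- is 0, and then `b = τ - s` covers every `s` in `[0, τ]`.
  have h3 : ∀ e ∈ W, ∀ b ∈ Icc 0 τ, ⟪z', S.orbitLift μ (rieszVec (B e)) τ⟫_ℂ =
      ⟪z', S.orbitLift μ (rieszVec (B e)) (τ - b)⟫_ℂ := by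
    intro e he b hb
    have h4 := hz _ ⟨_, _, hA.isLift_step h hμ hb e, fun t => ?_, ?_, rfl⟩
    · rw [max_eq_left (by linarith [hb.2]), ← ContinuousLinearMap.adjoint_inner_left,
        inner_sub_right, sub_eq_zero] at h4
      exact h4
    · split_ifs
      exacts [he, W.zero_mem]
    · rw [max_eq_right (by linarith [hb.1]), sub_self, map_zero]
  have h5 : z' ∈ S.unobservable ((fun e => rieszVec (B e)) '' W) := by
    rintro t ht _ ⟨e, he, rfl⟩
    refine h.inner_real_eq_zero hμ hτ (fun s hs => ?_) ht
    have h6 := h3 e he τ ⟨hτ.le, le_rfl⟩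
    rw [sub_self, orbitLift_zero, inner_zero_right] at h6
    have h7 := h3 e he (τ - s) ⟨by linarith [hs.2], by linarith [hs.1]⟩
    rw [sub_sub_cancel, h6] at h7
    exact h7.symm
  rw [hA.unobservable_eq_bot h h₁ h₂ fun ε lam hε hε' => hUC ε lam hε fun e he => by
    rw [apply_mk]; exact hε' _ ⟨e, he, rfl⟩] at h5
  exact hA.adjoint_powNeg_injective h hμ (by norm_num)
    ((show z' = 0 from h5).trans (map_zero _).symm)

/-- Lifts turn the scale norm into the norm of `H`, so continuity of `w` is exactly the continuity
asked of a solution. -/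
theorem IsLift.isSolution {u : ℝ → E} {w : ℝ → H} (hw : IsLift S A μ γ τ B u w)
    (hA : S.IsGenerator A) (h : S.AnalyticWithGrowth ω) (hμ : ω < μ) (hγ : γ ∈ Ico (0 : ℝ) 1)
    (hQ : Function.Injective (S.powNegAdj μ γ)) :
    IsSolution S A μ γ τ B u (ofVec hQ (S.powNeg μ (1 / 2) (w 0)))
      (fun t => ofVec hQ (S.powNeg μ (1 / 2) (w t))) where
  mem t _ := by
    rw [hA.scaleNorm_eq h hμ hγ (rieszVec_ofVec hQ _)]
    exact enorm_lt_top
  cont t₀ ht₀ := by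
    have h1 : ∀ t, S.scaleNorm μ γ (1 / 2 - γ) (ofVec hQ (S.powNeg μ (1 / 2) (w t)) -
        ofVec hQ (S.powNeg μ (1 / 2) (w t₀))) = edist (w t) (w t₀) := by
      intro t
      rw [hA.scaleNorm_eq h hμ hγ (w := w t - w t₀), edist_eq_enorm_sub]
      rw [rieszVec_sub, rieszVec_ofVec, rieszVec_ofVec, map_sub]
    simp only [h1]
    exact tendsto_iff_edist_tendsto_0.mp (hw.cont t₀ ht₀)
  init := rfl
  eqn ε η hεη t ht := by
    obtain ⟨z, rfl⟩ := mk_surjective _ ε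
    obtain ⟨z', rfl⟩ := mk_surjective _ η
    rw [hA.incl_mk_mem_adjoint_graph_iff h hμ hγ] at hεη
    simp only [ofVec_mk]
    exact hw.eqn z z' hεη t ht

theorem IsGenerator.approxControllableIn_of_unique (hA : S.IsGenerator A)
    (h : S.AnalyticWithGrowth ω) (hμ : ω < μ) (h₁ : HasIsolatedEigenvalues A)
    (h₂ : RootVectorsComplete A) (hγ : γ ∈ Ico (0 : ℝ) 1) (hτ : 0 < τ) {W : Submodule ℂ E}
    (hUC : ∀ (z : H) (lam : ℂ), (z, lam • z) ∈ A†.graph →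
      (∀ e ∈ W, B e (FracDom.mk (S.powNegAdj μ γ) z) = 0) → z = 0) :
    ApproxControllableIn S A μ γ τ B W := by
  intro y₀ y₁ hy₀ hy₁ r hr
  have hQ := hA.powNegAdj_injective h hμ ⟨hγ.1, hγ.2.le⟩
  obtain ⟨w₀, hw₀⟩ := hA.exists_of_scaleNorm_lt_top h hμ hγ hy₀
  obtain ⟨w₁, hw₁⟩ := hA.exists_of_scaleNorm_lt_top h hμ hγ hy₁
  have h0 : IsLift S A μ γ τ B (fun _ => 0) (fun _ => 0) := by
    simpa using hA.isLift_real (B := B) (τ := τ) h hμ 0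
  -- By linearity, only the difference between the target and the free evolution has to be reached
  -- from 0.
  have hd : w₁ - S.real τ w₀ ∈ (S.reachable A μ γ τ B W h0).topologicalClosure := by
    rw [hA.reachable_dense h hμ h₁ h₂ hτ hUC h0]
    exact Submodule.mem_top
  obtain ⟨v, ⟨u, w, huw, huW, hw0, rfl⟩, hv⟩ := Metric.mem_closure_iff.mp hd r hr
  have hl := (hA.isLift_real (B := B) (τ := τ) h hμ w₀).add_smul huw 1
  have hs := hl.isSolution hA h hμ hγ hQ
  simp only [one_smul, zero_add, hw0, add_zero, real_zero] at hs
  refine ⟨u, huw.memLp, Eventually.of_forall huW,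
    fun t => ofVec hQ (S.powNeg μ (1 / 2) (S.real t w₀ + w t)), ?_, ?_⟩
  · convert hs using 1
    change y₀ = ofVec hQ (S.powNeg μ (1 / 2) w₀)
    rw [← hw₀, ofVec_rieszVec]
  · rw [hA.scaleNorm_eq h hμ hγ (w := S.real τ w₀ + w τ - w₁), ← ofReal_norm,
      ENNReal.ofReal_lt_ofReal_iff hr, ← norm_neg]
    · rw [dist_eq_norm] at hv
      rwa [neg_sub, ← sub_sub]
    · rw [rieszVec_sub, rieszVec_ofVec, hw₁, map_sub]

/-- Tested against an eigenvector invisible from `W`, the equation loses its control term and a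
solution started at 0 keeps a zero coordinate along `w₁`. Its final lift is orthogonal to `w₁`,
hence at distance at least `‖w₁‖` from the target `w₁`. -/
theorem IsGenerator.unique_of_approxControllableIn (hA : S.IsGenerator A)
    (h : S.AnalyticWithGrowth ω) (hμ : ω < μ) (hγ : γ ∈ Ico (0 : ℝ) 1) (hτ : 0 < τ)
    {W : Submodule ℂ E} (hc : ApproxControllableIn S A μ γ τ B W) {z : H} {lam : ℂ}
    (hz : (z, lam • z) ∈ A†.graph)
    (hzW : ∀ e ∈ W, B e (FracDom.mk (S.powNegAdj μ γ) z) = 0) : z = 0 := by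
  by_contra hz0
  have hQ := hA.powNegAdj_injective h hμ ⟨hγ.1, hγ.2.le⟩
  set P := S.powNeg μ (1 / 2) with hP
  set w₁ := ContinuousLinearMap.adjoint P z with hw₁
  have hw₁0 : w₁ ≠ 0 := fun h0 => hz0 (hA.adjoint_powNeg_injective h hμ (α := 1 / 2)
    (by norm_num) (h0.trans (map_zero _).symm))
  obtain ⟨u, hu, huW, y, hy, hyr⟩ := hc 0 (ofVec hQ (P w₁))
    (by
      rw [hA.scaleNorm_eq h hμ hγ (w := 0)]
      · exact enorm_lt_top
      · rw [map_zero]; exact rieszVec_eq fun z => (inner_zero_right z).symm)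
    (by rw [hA.scaleNorm_eq h hμ hγ (rieszVec_ofVec hQ _)]; exact enorm_lt_top)
    ‖w₁‖ (norm_pos_iff.mpr hw₁0)
  have hex : ∀ t, ∃ w, t ∈ Icc 0 τ → rieszVec (y t) = P w := by
    intro t
    by_cases ht : t ∈ Icc 0 τ
    · exact (hA.exists_of_scaleNorm_lt_top h hμ hγ (hy.mem t ht)).imp fun _ hw _ => hw
    · exact ⟨0, fun h => absurd h ht⟩
  choose w hw using hex
  have hwc : ContinuousOn w (Icc 0 τ) := by
    intro t₀ ht₀
    refine tendsto_iff_edist_tendsto_0.mpr ((hy.cont t₀ ht₀).congr' ?_)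
    filter_upwards [self_mem_nhdsWithin] with t ht
    rw [hA.scaleNorm_eq h hμ hγ (w := w t - w t₀), edist_eq_enorm_sub]
    rw [rieszVec_sub, hw t ht, hw t₀ ht₀, map_sub]
  have hτm : τ ∈ Icc 0 τ := ⟨hτ.le, le_rfl⟩
  have hg : ∀ t ∈ Icc 0 τ, y t (FracDom.mk _ z) = ⟪w₁, w t⟫_ℂ := by
    intro t ht
    rw [apply_mk, hw t ht, ContinuousLinearMap.adjoint_inner_left]
  have hgraph := (hA.incl_mk_mem_adjoint_graph_iff h hμ hγ).mpr hz
  have hzero := eq_mul_exp_of_eq_integral (g := fun t => ⟪w₁, w t⟫_ℂ) (a := 0) (c := conj lam)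
    (continuousOn_const.inner hwc) (fun t ht => by
      rw [← hg t ht, hy.eqn _ _ hgraph t ht]
      congr 1
      rw [intervalIntegral.integral_of_le ht.1, intervalIntegral.integral_of_le ht.1,
        integral_Ioc_eq_integral_Ioo, integral_Ioc_eq_integral_Ioo]
      refine integral_congr_ae ?_
      have hae := ae_mono (Measure.restrict_mono (Ioo_subset_Ioo_right ht.2) le_rfl) huW
      filter_upwards [hae, ae_restrict_mem measurableSet_Ioo] with s hs hs'
      rw [hzW _ hs, add_zero, FracDom.mk_smul, map_smulₛₗ, smul_eq_mul,
        hg s ⟨hs'.1.le, hs'.2.le.trans ht.2⟩]) τ hτm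
  rw [zero_mul] at hzero
  rw [hA.scaleNorm_eq h hμ hγ (w := w τ - w₁), ← ofReal_norm,
    ENNReal.ofReal_lt_ofReal_iff (norm_pos_iff.mpr hw₁0)] at hyr
  · have h1 : ‖⟪w₁, w τ - w₁⟫_ℂ‖ = ‖w₁‖ * ‖w₁‖ := by
      rw [inner_sub_right, hzero, zero_sub, norm_neg, inner_self_eq_norm_sq_to_K, norm_pow,
        RCLike.norm_ofReal, abs_norm, pow_two]
    have h2 := norm_inner_le_norm (𝕜 := ℂ) w₁ (w τ - w₁)
    rw [h1] at h2
    exact absurd (le_of_mul_le_mul_left h2 (norm_pos_iff.mpr hw₁0)) hyr.not_ge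
  · rw [rieszVec_sub, hw τ hτm, rieszVec_ofVec, map_sub]

/-- Approximate controllability in `W` is equivalent to a unique continuation property of the
eigenvectors of `A†`. -/
theorem IsGenerator.approxControllableIn_iff (hA : S.IsGenerator A)
    (h : S.AnalyticWithGrowth ω) (hμ : ω < μ) (h₁ : HasIsolatedEigenvalues A)
    (h₂ : RootVectorsComplete A) (hγ : γ ∈ Ico (0 : ℝ) 1) (hτ : 0 < τ) (W : Submodule ℂ E) :
    ApproxControllableIn S A μ γ τ B W ↔
      ∀ (z : H) (lam : ℂ), (z, lam • z) ∈ A†.graph →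
        (∀ e ∈ W, B e (FracDom.mk (S.powNegAdj μ γ) z) = 0) → z = 0 :=
  ⟨fun hc _ _ hz hzW => hA.unique_of_approxControllableIn h hμ hγ hτ hc hz hzW,
    hA.approxControllableIn_of_unique h hμ h₁ h₂ hγ hτ⟩

end C0Semigroup

/-! ### Families separating a finite-dimensional space -/

section Separating

variable {V : Type*} [NormedAddCommGroup V] [InnerProductSpace ℂ V]
  {U : Type*} [NormedAddCommGroup U] [InnerProductSpace ℂ U] {ι : Type*}

/-- The family `c` separates the points of `V` through the functionals `z ↦ ⟪b z, c l⟫`. -/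
def Separates (b : V →ₗ[ℂ] U) (c : ι → U) : Prop := ∀ z : V, (∀ l, ⟪b z, c l⟫_ℂ = 0) → z = 0

theorem sum_mul_inner_basis {n : ℕ} (e : Module.Basis (Fin n) ℂ V) (b : V →ₗ[ℂ] U) (x : Fin n → ℂ)
    (u : U) : ∑ k, x k * ⟪b (e k), u⟫_ℂ = ⟪b (e.equivFun.symm (star x)), u⟫_ℂ := by
  rw [e.equivFun_symm_apply, map_sum, sum_inner]
  refine Finset.sum_congr rfl fun k _ => ?_
  rw [map_smul, inner_smul_left, Pi.star_apply, Complex.star_def, Complex.conj_conj]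

theorem separates_iff_basis {n : ℕ} (e : Module.Basis (Fin n) ℂ V) (b : V →ₗ[ℂ] U) (c : ι → U) :
    Separates b c ↔ ∀ x : Fin n → ℂ, (∀ l, ∑ k, x k * ⟪b (e k), c l⟫_ℂ = 0) → x = 0 := by
  simp only [sum_mul_inner_basis]
  constructor
  · intro h x hx
    have h1 := h _ hx
    rw [LinearEquiv.map_eq_zero_iff] at h1
    exact star_eq_zero.mp h1
  · intro h z hz
    have h1 := h (star (e.equivFun z)) fun l => by
      rw [star_star, LinearEquiv.symm_apply_apply]; exact hz l
    rwa [star_eq_zero, LinearEquiv.map_eq_zero_iff] at h1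

variable [FiniteDimensional ℂ V] {X : Type*} [NormedAddCommGroup X] [NormedSpace ℂ X]

/-- The complement is the projection of a closed subset of `X × sphere` along the compact unit
sphere of `V`, hence closed, even for infinitely many functionals. -/
theorem isOpen_separates (b : V →ₗ[ℂ] U) (π : ι → X →L[ℂ] U) :
    IsOpen {x | Separates b fun l => π l x} := by
  have : ProperSpace V := FiniteDimensional.proper ℂ V
  have : CompactSpace (Metric.sphere (0 : V) 1) := isCompact_iff_compactSpace.mp (isCompact_sphere _ _)
  have hb : Continuous b := b.continuous_of_finiteDimensional
  let C : Set (X × Metric.sphere (0 : V) 1) := ⋂ l, {p | ⟪b (p.2 : V), π l p.1⟫_ℂ = 0}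
  have hC : IsClosed C := isClosed_iInter fun l => isClosed_eq
    ((hb.comp (continuous_subtype_val.comp continuous_snd)).inner
      ((π l).continuous.comp continuous_fst)) continuous_const
  have h := (isClosedMap_fst_of_compactSpace _ hC).isOpen_compl
  convert h using 1
  ext x
  simp only [mem_ofPred_eq, mem_compl_iff, mem_image, not_exists, not_and]
  constructor
  · rintro hx ⟨x', z, hz⟩ hp rfl
    have h0 := hx z fun l => mem_iInter.mp hp l
    rw [h0, mem_sphere_zero_iff_norm, norm_zero] at hz
    exact zero_ne_one hz
  · intro hx z hz
    by_contra hz0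
    refine hx (x, ⟨((‖z‖ : ℂ)⁻¹) • z, ?_⟩) (mem_iInter.mpr fun l => ?_) rfl
    · rw [mem_sphere_zero_iff_norm, norm_smul, norm_inv, Complex.norm_real, norm_norm,
        inv_mul_cancel₀ (norm_ne_zero_iff.mpr hz0)]
    · rw [mem_ofPred_eq, map_smul, inner_smul_left, hz l, mul_zero]

/-- For `x₀` with chosen coordinates `b (e k)` the matrix of scalar products is a Gram matrix,
invertible as `b` is injective. Along `x + s • x₀` the determinant is a polynomial in `s` with
leading coefficient `det (M x₀)`, so arbitrarily small `s` avoid its zeros. -/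
theorem dense_separates {b : V →ₗ[ℂ] U} (hb : ∀ z, b z = 0 → z = 0) (π : ι → X →L[ℂ] U)
    {n : ℕ} (hn : Module.finrank ℂ V = n) (j : Fin n → ι)
    (hj : ∀ c : Fin n → U, ∃ x, ∀ k, π (j k) x = c k) :
    Dense {x | Separates b fun l => π l x} := by
  let e : Module.Basis (Fin n) ℂ V := Module.finBasisOfFinrankEq ℂ V hn
  obtain ⟨x₀, hx₀⟩ := hj fun k => b (e k)
  let M : X → Matrix (Fin n) (Fin n) ℂ := fun x => Matrix.of fun l k => ⟪b (e k), π (j l) x⟫_ℂ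
  have hMadd : ∀ (x : X) (s : ℂ), M (x + s • x₀) = s • M x₀ + M x := by
    intro x s
    ext l k
    simp only [M, Matrix.of_apply, Matrix.add_apply, Matrix.smul_apply, map_add, map_smul,
      inner_add_right, inner_smul_right, smul_eq_mul]
    ring
  have hM : ∀ x v l, (M x).mulVec v l = ⟪b (e.equivFun.symm (star v)), π (j l) x⟫_ℂ := by
    intro x v l
    rw [← sum_mul_inner_basis]
    simp only [Matrix.mulVec, dotProduct, M, Matrix.of_apply]
    exact Finset.sum_congr rfl fun k _ => mul_comm _ _
  have hsep : ∀ x, (M x).det ≠ 0 → Separates b fun l => π l x := by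
    intro x hx z hz
    have h1 := Matrix.eq_zero_of_mulVec_eq_zero hx (v := star (e.equivFun z)) (funext fun l => by
      rw [hM, star_star, LinearEquiv.symm_apply_apply]; exact hz _)
    rwa [star_eq_zero, LinearEquiv.map_eq_zero_iff] at h1
  have hdet : (M x₀).det ≠ 0 := by
    intro h0
    obtain ⟨v, hv0, hv⟩ := Matrix.exists_mulVec_eq_zero_iff.mpr h0
    set z := e.equivFun.symm (star v) with hz
    have h1 : ∀ l, ⟪b z, b (e l)⟫_ℂ = 0 := by
      intro l
      have := congrFun hv l
      rwa [hM, hx₀] at this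
    have h2 : ⟪b z, b z⟫_ℂ = 0 := by
      have h3 : b z = ∑ l, e.equivFun z l • b (e l) := by
        conv_lhs => rw [← e.sum_equivFun z, map_sum]
        simp only [map_smul]
      conv_lhs => rw [h3, inner_sum]
      rw [← h3]
      exact Finset.sum_eq_zero fun l _ => by rw [inner_smul_right, h1, mul_zero]
    have h4 := hb z (inner_self_eq_zero.mp h2)
    rw [hz, LinearEquiv.map_eq_zero_iff, star_eq_zero] at h4
    exact hv0 h4
  intro x
  let p : Polynomial ℂ := Matrix.det ((Polynomial.X : Polynomial ℂ) • (M x₀).map Polynomial.C +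
    (M x).map Polynomial.C)
  have hp : p ≠ 0 := by
    intro h0
    have h1 := Polynomial.coeff_det_X_add_C_card (M x₀) (M x)
    rw [show Matrix.det ((Polynomial.X : Polynomial ℂ) • (M x₀).map Polynomial.C +
      (M x).map Polynomial.C) = 0 from h0, Polynomial.coeff_zero] at h1
    exact hdet h1.symm
  have heval : ∀ s, p.eval s = (M (x + s • x₀)).det := by
    intro s
    rw [hMadd, ← Polynomial.coe_evalRingHom, RingHom.map_det]
    congr 1
    ext l k
    simp
    ring
  have hfin : {s | p.IsRoot s}.Finite := Polynomial.finite_setOfPred_isRoot hp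
  have hd : (0 : ℂ) ∈ closure {s | p.IsRoot s}ᶜ := (hfin.countable.dense_compl ℂ) 0
  have hc : Continuous fun s : ℂ => x + s • x₀ := by fun_prop
  have := map_mem_closure hc hd (t := {x | Separates b fun l => π l x}) fun s hs =>
    hsep _ (by rw [← heval]; exact hs)
  simpa using this

end Separating

theorem isResidualSet_iInter {X : Type v} [TopologicalSpace X] {ι : Type*} [Countable ι]
    {O : ι → Set X} (h : ∀ i, IsOpen (O i) ∧ Dense (O i)) : IsResidualSet (⋂ i, O i) := by
  -- `Option ι` adds the whole space as one more set, so that an enumeration exists even if `ι` is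
  -- empty.
  obtain ⟨f, hf⟩ := exists_surjective_nat (Option ι)
  refine ⟨fun n => (f n).elim univ O, fun n => ?_, ?_⟩
  · change IsOpen ((f n).elim univ O) ∧ Dense ((f n).elim univ O)
    rcases f n with _ | i
    · exact ⟨isOpen_univ, dense_univ⟩
    · exact h i
  · rw [hf.iInter_comp fun o : Option ι => o.elim univ O, iInter_option]
    simp

theorem IsResidualSet.dense {X : Type v} [TopologicalSpace X] [BaireSpace X] {s : Set X}
    (h : IsResidualSet s) : Dense s := by
  obtain ⟨O, hO, rfl⟩ := h
  exact dense_iInter_of_isOpen (fun n => (hO n).1) fun n => (hO n).2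

/-! ### Admissible families -/

section Admissible

open FracDom

variable {H : Type u} [NormedAddCommGroup H] [InnerProductSpace ℂ H] [CompleteSpace H]
  {U : Type v} [NormedAddCommGroup U] [InnerProductSpace ℂ U] [CompleteSpace U]
  {S : C0Semigroup H} {A : H →ₗ.[ℂ] H} {ω μ γ τ : ℝ} {B : U →L[ℂ] S.HNeg μ γ}

/-- The operator `z ↦ B* (μ - A*)^{-γ} z`. -/
def obs (B : U →L[ℂ] S.HNeg μ γ) : H →ₗ[ℂ] U := (adjB B).comp (mkL (S.powNegAdj μ γ)).toLinearMap

theorem inner_obs (B : U →L[ℂ] S.HNeg μ γ) (z : H) (w : U) :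
    ⟪obs B z, w⟫_ℂ = B w (FracDom.mk (S.powNegAdj μ γ) z) := inner_adjB B _ w

theorem adjBOn_incl (B : U →L[ℂ] S.HNeg μ γ) (ε : S.HStar μ γ) :
    adjBOn B (incl _ ε) = adjB B ε := by
  have h : ∃ η : S.HStar μ γ, incl _ η = incl _ ε := ⟨ε, rfl⟩
  rw [adjBOn, dif_pos h]
  exact congrArg _ (Subtype.ext h.choose_spec)

/-- The restriction of `obs B` to an eigenspace of `A†`. -/
def obsEig (A : H →ₗ.[ℂ] H) (B : U →L[ℂ] S.HNeg μ γ) (lam : ℂ) : eigSpace A† (conj lam) →ₗ[ℂ] U :=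
  (obs B).comp (eigSpace A† (conj lam)).subtype

theorem combine_single (v : EllTwo U) (l : ℕ) : combine v (lp.single 2 l (1 : ℂ)) = v l := by
  change ∑' k, (lp.single 2 l (1 : ℂ) : EllTwo ℂ) k • v k = v l
  rw [tsum_eq_single l fun k hk => by rw [lp.single_apply_ne _ _ _ hk, zero_smul],
    lp.single_apply_self, one_smul]

theorem forall_inner_combine_eq_zero_iff (u : U) (v : EllTwo U) :
    (∀ w, ⟪u, combine v w⟫_ℂ = 0) ↔ ∀ l, ⟪u, v l⟫_ℂ = 0 := by
  constructor
  · intro h l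
    rw [← combine_single v l]
    exact h _
  · intro h w
    have h1 : HasSum (fun l => ⟪u, w l • v l⟫_ℂ) ⟪u, combine v w⟫_ℂ :=
      (innerSL ℂ u).hasSum (summable_smul w v).hasSum
    simp only [inner_smul_right, h, mul_zero] at h1
    exact h1.unique hasSum_zero

theorem combineFin_apply {K : ℕ} (v : UPow U K) (w : EuclideanSpace ℂ (Fin K)) :
    combineFin v w = ∑ l, w l • v l := by
  simp [combineFin, sum_apply]

theorem forall_inner_combineFin_eq_zero_iff {K : ℕ} (u : U) (v : UPow U K) :
    (∀ w, ⟪u, combineFin v w⟫_ℂ = 0) ↔ ∀ l, ⟪u, v l⟫_ℂ = 0 := by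
  constructor
  · intro h l
    have h1 := h (EuclideanSpace.single l 1)
    rw [combineFin_apply, Finset.sum_eq_single l] at h1
    · simpa using h1
    · intro k _ hk
      simp [hk]
    · simp
  · intro h w
    rw [combineFin_apply, inner_sum]
    exact Finset.sum_eq_zero fun l _ => by rw [inner_smul_right, h, mul_zero]

/-- The assumptions on `A` and on the parameters which the criteria below depend on. -/
structure Setting (S : C0Semigroup H) (A : H →ₗ.[ℂ] H) (ω μ γ τ : ℝ) : Prop where
  gen : S.IsGenerator A
  growth : S.AnalyticWithGrowth ω
  lt : ω < μ
  isolated : HasIsolatedEigenvalues A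
  complete : RootVectorsComplete A
  mem : γ ∈ Ico (0 : ℝ) 1
  pos : 0 < τ

namespace Setting

theorem injective (h : Setting S A ω μ γ τ) : Function.Injective (S.powNegAdj μ γ) :=
  h.gen.powNegAdj_injective h.growth h.lt ⟨h.mem.1, h.mem.2.le⟩

theorem finrank_eigSpace (h : Setting S A ω μ γ τ) {lam : ℂ} (hlam : lam ∈ spec A) :
    FiniteDimensional ℂ (eigSpace A† (conj lam)) ∧
      Module.finrank ℂ (eigSpace A† (conj lam)) = geomMult A lam :=
  h.isolated.finrank_eigSpace_adjoint (h.gen.dense_domain h.growth.analytic)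
    (h.gen.isResolventAt_powNeg_one h.growth h.lt) hlam

/-- Every eigenvalue of `A†` is the conjugate of a spectral value of `A`, so conditions on
eigenvectors can be indexed by the countable set `spec A`. -/
theorem forall_eigenvector_iff (h : Setting S A ω μ γ τ) (p : H → Prop) :
    (∀ (z : H) (lam : ℂ), (z, lam • z) ∈ A†.graph → p z → z = 0) ↔
      ∀ lam ∈ spec A, ∀ z : eigSpace A† (conj lam), p z → z = 0 := by
  constructor
  · intro h1 lam _ z hz
    exact Subtype.ext (h1 z (conj lam) z.2 hz)
  · intro h1 z lam hz hp
    by_contra hz0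
    have hlam := conj_mem_spec_of_mem_adjoint_graph (h.gen.dense_domain h.growth.analytic)
      (h.gen.isResolventAt_powNeg_one h.growth h.lt) hz hz0
    have hz' : z ∈ eigSpace A† (conj (conj lam)) := by rwa [Complex.conj_conj]
    exact hz0 (congrArg Subtype.val (h1 _ hlam ⟨z, hz'⟩ hp))

/-- In the coordinate `z` of `ε = (μ - A*)^{-γ} z` the eigenvalue equation is unchanged, since the
power commutes with `A†`. -/
theorem fattoriniHautus_iff (h : Setting S A ω μ γ τ) :
    FattoriniHautus A B ↔
      ∀ (z : H) (lam : ℂ), (z, lam • z) ∈ A†.graph → obs B z = 0 → z = 0 := by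
  have hg := fun (z : H) (lam : ℂ) =>
    h.gen.incl_mk_mem_adjoint_graph_iff h.growth h.lt h.mem (x := z) (y := lam • z)
  constructor
  · intro hF z lam hz hz0
    have h1 := hF (FracDom.mk _ z) lam (by
      have := (hg z lam).mpr hz
      rwa [mk_smul, map_smul] at this) hz0
    exact (equiv h.injective).injective (h1.trans (map_zero _).symm)
  · intro h1 ε lam hε hε0
    obtain ⟨z, rfl⟩ := mk_surjective _ ε
    rw [← map_smul, ← mk_smul] at hε
    rw [h1 z lam ((hg z lam).mp hε) hε0]
    exact map_zero (mkL _)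

theorem fattoriniHautus_iff_eigSpace (h : Setting S A ω μ γ τ) :
    FattoriniHautus A B ↔ ∀ lam ∈ spec A, ∀ z, obsEig A B lam z = 0 → z = 0 :=
  h.fattoriniHautus_iff.trans (h.forall_eigenvector_iff fun z => obs B z = 0)

theorem approxControllableIn_iff (h : Setting S A ω μ γ τ) (W : Submodule ℂ U) :
    ApproxControllableIn S A μ γ τ B W ↔
      ∀ lam ∈ spec A, ∀ z, (∀ e ∈ W, ⟪obsEig A B lam z, e⟫_ℂ = 0) → z = 0 := by
  rw [h.gen.approxControllableIn_iff h.growth h.lt h.isolated h.complete h.mem h.pos]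
  simp only [← inner_obs]
  exact h.forall_eigenvector_iff fun z => ∀ e ∈ W, ⟪obs B z, e⟫_ℂ = 0

theorem approxControllable_iff (h : Setting S A ω μ γ τ) :
    ApproxControllable S A μ γ τ B ↔ FattoriniHautus A B := by
  rw [ApproxControllable, h.approxControllableIn_iff, h.fattoriniHautus_iff_eigSpace]
  refine forall₂_congr fun lam _ => forall_congr' fun z => imp_congr_left ?_
  exact ⟨fun h1 => inner_self_eq_zero.mp (h1 _ Submodule.mem_top),
    fun h1 e _ => by rw [h1, inner_zero_left]⟩

theorem admissible_iff (h : Setting S A ω μ γ τ) (v : EllTwo U) :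
    Admissible S A μ γ τ B v ↔ ∀ lam ∈ spec A, Separates (obsEig A B lam) fun l => v l := by
  rw [Admissible, ApproxControllable,
    h.gen.approxControllableIn_iff h.growth h.lt h.isolated h.complete h.mem h.pos]
  refine Iff.trans ?_ (h.forall_eigenvector_iff fun z => ∀ l, ⟪obs B z, v l⟫_ℂ = 0)
  refine forall₂_congr fun z lam => imp_congr_right fun _ => imp_congr_left ?_
  rw [← forall_inner_combine_eq_zero_iff]
  simp only [inner_obs, Submodule.mem_top, true_imp_iff]
  rfl

theorem admissibleFin_iff (h : Setting S A ω μ γ τ) {K : ℕ} (v : UPow U K) :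
    AdmissibleFin S A μ γ τ B v ↔ ∀ lam ∈ spec A, Separates (obsEig A B lam) fun l => v l := by
  rw [AdmissibleFin, ApproxControllable,
    h.gen.approxControllableIn_iff h.growth h.lt h.isolated h.complete h.mem h.pos]
  refine Iff.trans ?_ (h.forall_eigenvector_iff fun z => ∀ l, ⟪obs B z, v l⟫_ℂ = 0)
  refine forall₂_congr fun z lam => imp_congr_right fun _ => imp_congr_left ?_
  rw [← forall_inner_combineFin_eq_zero_iff]
  simp only [inner_obs, Submodule.mem_top, true_imp_iff]
  rfl

/-! ### Rank conditions -/

/-- Separation of an eigenspace, in terms of the vectors `B* εₖ` for a basis `ε` of it. -/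
theorem separates_iff_adjBOn (h : Setting S A ω μ γ τ) {lam : ℂ} (hlam : lam ∈ spec A) {n : ℕ}
    (ε : Module.Basis (Fin n) ℂ (eigSpace A† (conj lam))) {ι : Type*} (c : ι → U) :
    Separates (obsEig A B lam) c ↔
      ∀ x : Fin n → ℂ, (∀ l, ∑ k, x k * ⟪adjBOn B (ε k : H), c l⟫_ℂ = 0) → x = 0 := by
  have := (h.finrank_eigSpace hlam).1
  -- The power maps the eigenspace injectively into itself, hence bijectively by finite dimension.
  -- Pulling the basis back by it turns the values of `obs` into the vectors `B* εₖ`.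
  have hQ : ∀ z ∈ eigSpace A† (conj lam), S.powNegAdj μ γ z ∈ eigSpace A† (conj lam) := by
    intro z hz
    rw [mem_eigSpace, ← map_smul, h.growth.powNegAdj_eq h.lt h.mem.1,
      h.gen.adjoint_powNeg_mem_graph_iff h.growth h.lt ⟨h.mem.1, h.mem.2.le⟩]
    exact hz
  let q : eigSpace A† (conj lam) →ₗ[ℂ] eigSpace A† (conj lam) :=
    (S.powNegAdj μ γ).toLinearMap.restrict hQ
  have hq : Function.Injective q := fun z z' hz =>
    Subtype.ext (h.injective (congrArg Subtype.val hz))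
  let e := LinearEquiv.ofInjectiveEndo q hq
  have he : ∀ z, (e z : H) = S.powNegAdj μ γ z := fun z => rfl
  have h1 : ∀ k, obsEig A B lam ((ε.map e.symm) k) = adjBOn B (ε k : H) := by
    intro k
    set z := e.symm (ε k) with hz
    have h2 : (ε k : H) = incl _ (FracDom.mk (S.powNegAdj μ γ) (z : H)) := by
      rw [incl_mk, ← he, hz, LinearEquiv.apply_symm_apply]
    rw [h2, adjBOn_incl, Module.Basis.map_apply]
    rfl
  rw [separates_iff_basis (ε.map e.symm)]
  simp only [h1]

theorem finrank_range_mapW_iff {n : ℕ} (B : U →L[ℂ] S.HNeg μ γ) (ε : Fin n → H) (v : EllTwo U) :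
    Module.finrank ℂ (mapW B ε v).range = n ↔
      ∀ x : Fin n → ℂ, (∀ l, ∑ k, x k * ⟪adjBOn B (ε k), v l⟫_ℂ = 0) → x = 0 := by
  have h1 := (mapW B ε v).finrank_range_add_finrank_ker
  rw [Module.finrank_fin_fun] at h1
  have h2 : Module.finrank ℂ (mapW B ε v).range = n ↔ (mapW B ε v).ker = ⊥ := by
    rw [← Submodule.finrank_eq_zero (R := ℂ)]; omega
  have h3 : ∀ x l, mapW B ε v x l = ∑ k, x k * ⟪adjBOn B (ε k), v l⟫_ℂ := by
    intro x l
    rw [mapW, Fintype.linearCombination_apply, lp.coeFn_sum, Finset.sum_apply]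
    rfl
  rw [h2, LinearMap.ker_eq_bot']
  refine forall_congr' fun x => imp_congr_left ?_
  simp only [← h3]
  exact ⟨fun h l => by rw [h]; rfl, fun h => lp.ext (funext h)⟩

theorem rank_matW_iff {n K : ℕ} (B : U →L[ℂ] S.HNeg μ γ) (ε : Fin n → H) (v : UPow U K) :
    (matW B ε v).rank = n ↔
      ∀ x : Fin n → ℂ, (∀ l, ∑ k, x k * ⟪adjBOn B (ε k), v l⟫_ℂ = 0) → x = 0 := by
  have h1 := (matW B ε v).mulVecLin.finrank_range_add_finrank_ker
  rw [Module.finrank_fin_fun] at h1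
  have h2 : (matW B ε v).rank = n ↔ (matW B ε v).mulVecLin.ker = ⊥ := by
    rw [← Submodule.finrank_eq_zero (R := ℂ), Matrix.rank]; omega
  have h3 : ∀ x l, (matW B ε v).mulVecLin x l = ∑ k, x k * ⟪adjBOn B (ε k), v l⟫_ℂ :=
    fun x l => by
      rw [Matrix.mulVecLin_apply, Matrix.mulVec, dotProduct]
      exact Finset.sum_congr rfl fun k _ => mul_comm (matW B ε v l k) (x k)
  rw [h2, LinearMap.ker_eq_bot']
  refine forall_congr' fun x => imp_congr_left ?_
  simp only [← h3]
  exact ⟨fun h l => by rw [h]; rfl, funext⟩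

/-! ### Genericity -/

/-- Each of the countably many eigenvalues contributes an open dense set. `hj` asks that as many
coordinates as the multiplicity can be prescribed freely, which for `U^K` is where `geomMult A lam ≤
K` enters. -/
theorem isResidualSet_separates (h : Setting S A ω μ γ τ) (hF : FattoriniHautus A B)
    {X : Type v} [NormedAddCommGroup X] [NormedSpace ℂ X] {ι : Type*} (π : ι → X →L[ℂ] U)
    (hj : ∀ lam ∈ spec A, ∃ j : Fin (geomMult A lam) → ι,
      ∀ c : Fin (geomMult A lam) → U, ∃ x, ∀ k, π (j k) x = c k) :
    IsResidualSet {x : X | ∀ lam ∈ spec A, Separates (obsEig A B lam) fun l => π l x} := by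
  have hc := h.isolated.countable_spec.to_subtype
  have h1 : {x : X | ∀ lam ∈ spec A, Separates (obsEig A B lam) fun l => π l x} =
      ⋂ lam : spec A, {x | Separates (obsEig A B lam) fun l => π l x} := by
    ext x; simp
  rw [h1]
  refine isResidualSet_iInter fun lam => ?_
  obtain ⟨hfd, hrank⟩ := h.finrank_eigSpace lam.2
  obtain ⟨j, hj⟩ := hj lam lam.2
  exact ⟨isOpen_separates _ π, dense_separates (h.fattoriniHautus_iff_eigSpace.mp hF lam lam.2) π
    hrank j hj⟩

theorem isResidualSet_admissible (h : Setting S A ω μ γ τ) (hF : FattoriniHautus A B) :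
    IsResidualSet {v : EllTwo U | Admissible S A μ γ τ B v} := by
  simp only [h.admissible_iff]
  refine h.isResidualSet_separates hF (fun l => lp.evalCLM ℂ (fun _ : ℕ => U) 2 l) fun lam _ =>
    ⟨fun k => (k : ℕ), fun c =>
      ⟨∑ k : Fin (geomMult A _), lp.single 2 (k : ℕ) (c k), fun k => ?_⟩⟩
  rw [map_sum, Finset.sum_eq_single k]
  · exact lp.single_apply_self 2 _ _
  · intro k' _ hk'
    exact lp.single_apply_ne 2 _ _ fun he => hk' (Fin.ext he.symm)
  · simp

theorem isResidualSet_admissibleFin (h : Setting S A ω μ γ τ) (hF : FattoriniHautus A B) {K : ℕ}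
    (hK : ∀ lam ∈ spec A, geomMult A lam ≤ K) :
    IsResidualSet {v : UPow U K | AdmissibleFin S A μ γ τ B v} := by
  simp only [h.admissibleFin_iff]
  refine h.isResidualSet_separates hF
    (fun l => (PiLp.proj 2 (fun _ : Fin K => U) l : UPow U K →L[ℂ] U)) fun lam hlam =>
    ⟨Fin.castLE (hK lam hlam), fun c => ⟨∑ k, PiLp.single 2 (Fin.castLE (hK lam hlam) k) (c k),
      fun k => ?_⟩⟩
  rw [map_sum, Finset.sum_eq_single k]
  · simp
  · intro k' _ hk'
    have : Fin.castLE (hK lam hlam) k ≠ Fin.castLE (hK lam hlam) k' := fun he =>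
      hk' (Fin.castLE_injective _ he).symm
    simp [this]
  · simp

/-- If `W` suffices, projecting the `B*`-image of an eigenspace orthogonally onto `W` loses nothing,
so the multiplicity is at most the dimension of `W`. Conversely Baire's theorem provides an
admissible family of `K` vectors, and its span is the control space. -/
theorem approxControllableByDim_iff (h : Setting S A ω μ γ τ) (K : ℕ) :
    ApproxControllableByDim S A μ γ τ B K ↔
      FattoriniHautus A B ∧ ∀ lam ∈ spec A, geomMult A lam ≤ K := by
  constructor
  · rintro ⟨W, hW, hWK, hc⟩
    rw [h.approxControllableIn_iff] at hc
    refine ⟨h.fattoriniHautus_iff_eigSpace.mpr fun lam hlam z hz => hc lam hlam z fun e _ => by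
      rw [hz, inner_zero_left], fun lam hlam => ?_⟩
    obtain ⟨hfd, hrank⟩ := h.finrank_eigSpace hlam
    rw [← hrank]
    refine le_trans ?_ hWK
    refine LinearMap.finrank_le_finrank_of_injective
      (f := W.orthogonalProjectionOnto.toLinearMap.comp (obsEig A B lam)) ?_
    refine (injective_iff_map_eq_zero _).mpr fun z hz => hc lam hlam z fun e he => ?_
    have h1 := Submodule.inner_orthogonalProjectionOnto_eq_of_mem_left (⟨e, he⟩ : W)
      (obsEig A B lam z)
    rw [show W.orthogonalProjectionOnto (obsEig A B lam z) = 0 from hz, inner_zero_right] at h1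
    rw [← inner_conj_symm, show ⟪e, obsEig A B lam z⟫_ℂ = 0 from h1.symm, map_zero]
  · rintro ⟨hF, hK⟩
    obtain ⟨v, hv⟩ := (h.isResidualSet_admissibleFin hF hK).dense.nonempty
    refine ⟨Submodule.span ℂ (range v), FiniteDimensional.span_of_finite ℂ (finite_range _),
      (finrank_range_le_card v).trans_eq (Fintype.card_fin K), ?_⟩
    rw [h.approxControllableIn_iff]
    intro lam hlam z hz
    exact h.admissibleFin_iff v |>.mp hv lam hlam z fun l =>
      hz _ (Submodule.subset_span (mem_range_self l))

/-! ### Projections -/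

theorem obsEig_mem_adjBE (h : Setting S A ω μ γ τ) {lam : ℂ} (hlam : lam ∈ spec A)
    (z : eigSpace A† (conj lam)) : obsEig A B lam z ∈ adjBE A B := by
  refine ⟨FracDom.mk _ (z : H), subset_closure (Submodule.subset_span ⟨lam, hlam, ?_⟩), rfl⟩
  have h1 := (h.gen.incl_mk_mem_adjoint_graph_iff h.growth h.lt h.mem).mpr
    (show ((z : H), conj lam • (z : H)) ∈ A†.graph from z.2)
  rwa [mk_smul, map_smul] at h1

/-- The error of the projection is orthogonal to the sequences with a single nonzero entry in `B*
𝓔`. All scalar products in the separation criterion are therefore unchanged. -/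
theorem admissible_projBE (h : Setting S A ω μ γ τ) {v : EllTwo U}
    (hv : Admissible S A μ γ τ B v) : Admissible S A μ γ τ B (projBE A B v) := by
  rw [h.admissible_iff] at hv ⊢
  intro lam hlam z hz
  refine hv lam hlam z fun l => ?_
  have h1 : (lp.single 2 l (obsEig A B lam z) : EllTwo U) ∈
      (ellTwoSub (adjBE A B)).topologicalClosure := by
    refine subset_closure fun k => ?_
    rw [lp.single_apply, Pi.single_apply]
    split_ifs
    exacts [h.obsEig_mem_adjBE hlam z, Submodule.zero_mem _]
  have h2 := Submodule.starProjection_inner_eq_zero v _ h1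
  rw [lp.inner_single_right, ← inner_conj_symm, map_eq_zero] at h2
  have h3 : ⟪obsEig A B lam z, v l - projBE A B v l⟫_ℂ = 0 := h2
  rwa [inner_sub_right, hz l, sub_zero] at h3

theorem admissibleFin_projBEFin (h : Setting S A ω μ γ τ) {K : ℕ} {v : UPow U K}
    (hv : AdmissibleFin S A μ γ τ B v) : AdmissibleFin S A μ γ τ B (projBEFin A B v) := by
  rw [h.admissibleFin_iff] at hv ⊢
  intro lam hlam z hz
  refine hv lam hlam z fun l => ?_
  have h1 : (PiLp.single 2 l (obsEig A B lam z) : UPow U K) ∈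
      (powSub (adjBE A B) K).topologicalClosure := by
    refine subset_closure fun k => ?_
    rw [PiLp.single_apply]
    split_ifs
    exacts [h.obsEig_mem_adjBE hlam z, Submodule.zero_mem _]
  have h2 := Submodule.starProjection_inner_eq_zero v _ h1
  rw [PiLp.inner_apply, Finset.sum_eq_single l (fun k _ hk => by simp [hk]) (by simp),
    PiLp.single_apply, if_pos rfl, ← inner_conj_symm, map_eq_zero] at h2
  have h3 : ⟪obsEig A B lam z, v l - projBEFin A B v l⟫_ℂ = 0 := h2
  rwa [inner_sub_right, hz l, sub_zero] at h3

end Setting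

end Admissible

end ParabolicControl

end

/-! ### Assembly of the five statements -/

theorem mainTheorem1
    {H U : Type*} [NormedAddCommGroup H] [InnerProductSpace ℂ H] [CompleteSpace H]
    [NormedAddCommGroup U] [InnerProductSpace ℂ U] [CompleteSpace U]
    (A : H →ₗ.[ℂ] H) (S : C0Semigroup H) (hA : S.IsGenerator A)
    (h₁ : HasIsolatedEigenvalues A) (h₂ : RootVectorsComplete A) (h₃ : S.IsAnalytic)
    (μ₀ : ℝ) (hμ₀ : ∃ s < μ₀, ∀ lam ∈ spec A, lam.re ≤ s)
    (h₄ : InterpolationProperty S A μ₀)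
    (γ : ℝ) (hγ : γ ∈ Set.Ico (0 : ℝ) 1) (B : U →L[ℂ] S.HNeg μ₀ γ)
    (τ : ℝ) (hτ : 0 < τ) (K : ℕ) (hK : 1 ≤ K) :
    (ApproxControllable S A μ₀ γ τ B ↔ FattoriniHautus A B) ∧
    (ApproxControllableByDim S A μ₀ γ τ B K ↔
      FattoriniHautus A B ∧ ∀ lam ∈ spec A, geomMult A lam ≤ K) ∧
    ((∀ lam : spec A,
        Nonempty (Module.Basis (Fin (geomMult A lam)) ℂ (eigSpace A† (conj (lam : ℂ))))) ∧
      ∀ ε : ∀ lam : spec A,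
          Module.Basis (Fin (geomMult A lam)) ℂ (eigSpace A† (conj (lam : ℂ))),
        (∀ v : EllTwo U, Admissible S A μ₀ γ τ B v ↔
          ∀ lam : spec A, Module.finrank ℂ (mapW B (fun k => (ε lam k : H)) v).range =
            geomMult A lam) ∧
        (∀ v : UPow U K, AdmissibleFin S A μ₀ γ τ B v ↔
          ∀ lam : spec A, (matW B (fun k => (ε lam k : H)) v).rank = geomMult A lam)) ∧
    (FattoriniHautus A B →
      IsResidualSet {v : EllTwo U | Admissible S A μ₀ γ τ B v} ∧
      ∀ v : EllTwo U, Admissible S A μ₀ γ τ B v → Admissible S A μ₀ γ τ B (projBE A B v)) ∧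
    (FattoriniHautus A B → (∀ lam ∈ spec A, geomMult A lam ≤ K) →
      IsResidualSet {v : UPow U K | AdmissibleFin S A μ₀ γ τ B v} ∧
      ∀ v : UPow U K, AdmissibleFin S A μ₀ γ τ B v →
        AdmissibleFin S A μ₀ γ τ B (projBEFin A B v)) := by
  obtain ⟨s, hs, hspec⟩ := hμ₀
  -- The midpoint leaves room on both sides: it exceeds the spectral bound `s`, as the growth
  -- estimate requires, and lies below `μ₀`, as the fractional powers require.
  have h : Setting S A ((s + μ₀) / 2) μ₀ γ τ :=
    { gen := hA
      growth := ⟨h₃, hA.exists_growth_bound h₃ hspec (by linarith)⟩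
      lt := by linarith
      isolated := h₁
      complete := h₂
      mem := hγ
      pos := hτ }
  refine ⟨h.approxControllable_iff, h.approxControllableByDim_iff K,
    ⟨fun lam => ?_, fun ε => ⟨fun v => ?_, fun v => ?_⟩⟩,
    fun hF => ⟨h.isResidualSet_admissible hF, fun v => h.admissible_projBE⟩,
    fun hF hle => ⟨h.isResidualSet_admissibleFin hF hle, fun v => h.admissibleFin_projBEFin⟩⟩
  · obtain ⟨hfd, hrank⟩ := h.finrank_eigSpace lam.2
    exact ⟨Module.finBasisOfFinrankEq ℂ _ hrank⟩
  · rw [h.admissible_iff, Subtype.forall]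
    refine forall₂_congr fun lam hlam => ?_
    rw [Setting.finrank_range_mapW_iff, h.separates_iff_adjBOn hlam (ε ⟨lam, hlam⟩)]
  · rw [h.admissibleFin_iff, Subtype.forall]
    refine forall₂_congr fun lam hlam => ?_
    rw [Setting.rank_matW_iff, h.separates_iff_adjBOn hlam (ε ⟨lam, hlam⟩)]
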